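/- Let $Z=(Z_t)_{t\ge 0}$ be a subordinator (a nonnegative process with $Z_0=0$ a.s., independent stationary increments and right-continuous nondecreasing paths) without drift, on a probability space $(\Omega,\mathbb P)$. Let $\rho$ be the Lévy measure of $Z_1$, i.e. the measure on $(0,\infty)$ with $\int (x\wedge 1)\,\rho(dx)<\infty$ and $\mathbb E e^{-uZ_1}=\exp\{-\int(1-e^{-ux})\rho(dx)\}$ for $u\ge 0$, and assume $\kappa:=\mathbb E Z_1\in(0,\infty)$. Let $f:\mathbb R\to[0,\infty)$ be Borel with $f(u)=0$ for $u<0$ and $I(t):=\int_0^t f(s)\,ds<\infty$ for every $t>0$. Put $$\psi(t)=\int_0^t f(t-s)\,dZ_s,\qquad t\ge 0 ,$$ a pathwise Lebesgue–Stieltjes integral, which for each $t$ is a.s. finite. Laws of processes are taken on $\mathbb R_+^{[0,\infty)}$ with the cylindrical $\sigma$-algebra, and $0$ denotes the zero function. The Lévy measure of a nonnegative infinitely divisible process $X=(X(t))_{t\ge 0}$ without drift is the unique measure $\nu$ on $\mathbb R_+^{[0,\infty)}$ such that $\int (y(t)\wedge 1)\,\nu(dy)<\infty$ for all $t$; $\mathbb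 E e^{-\sum_{i}\alpha_i X(t_i)}=\exp\{-\int(1-e^{-\sum_{i}\alpha_i y(t_i)})\,\nu(dy)\}$ for all finite families $t_i\ge0$, $\alpha_i\ge 0$; and $\nu(A)=\sup\{\nu(B): B \text{ measurable},\ B\subset A\setminus\{0\}\}$ for all measurable $A$. The measure $\kappa^{-1}x\,\rho(dx)$ is a probability law; "$V\sim\kappa^{-1}x\,\rho(dx)$" below refers to it. (a3) Let $a>0$ with $I(a)>0$. Then $s\mapsto f(a-s)/I(a)$ is a probability density on $[0,a]$. If $U_a$ has this density, $V\sim\kappa^{-1}x\,\rho(dx)$, and $U_a$, $V$, $\psi$ are independent, then $$\big(\psi(t)+Vf(t-U_a),\ t\ge0\big)\ \text{has the law of}\ \big(\psi(t),\ t\ge 0\big)\ \text{under}\ \frac{\psi(a)}{\kappa I(a)}\,d\mathbb P .$$ (b3) Suppose that $f$ is not a.e. zero and $\int_0^\infty e^{-\theta s}f(s)\,ds<\infty$ for some $\theta>0$. Let $Y$ be exponential with mean $\theta^{-1}$ and independent of $V\sim\kappa^{-1}x\,\rho(dx)$. Then the Lévy measure $\nu$ of $\psi$ exists and is given by $$\int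 F\,d\nu=\frac{\kappa}{\theta}\,\mathbb E\big[V^{-1}e^{\theta Y}F\big(Vf(t-Y),\ t\ge0\big)\big]\quad\text{for every measurable } F\ge 0;$$ that is, $\nu$ is the law of $(Vf(t-Y),\ t\ge 0)$ under $\kappa\theta^{-1}V^{-1}e^{\theta Y}\,d\mathbb P$. (c3) Let $a\ge0$, $D_a=\{s\ge0: f(a-s)=0\}$ and $D_a^c=[0,\infty)\setminus D_a$. By the law of $(\psi\mid\psi(a)=0)$ we mean the limit, in the sense of finite-dimensional distributions, of the conditional laws of $\psi$ given $\psi(a)\le\varepsilon$ (an event of positive probability) as $\varepsilon\downarrow0$; it is the elementary conditional law when $\mathbb P(\psi(a)=0)>0$. This law exists, there is a unique law of a nonnegative process ${\cal L}^{(a)}$, taken independent of $(\psi\mid\psi(a)=0)$, such that $\psi\overset{d}{=}(\psi\mid\psi(a)=0)+{\cal L}^{(a)}$, both components are infinitely divisible, and $$(\psi\mid\psi(a)=0)\overset{d}{=}\Big(\int_0^t f(t-s)1_{D_a}(s)\,dZ_s,\ t\ge0\Big),\qquad {\cal L}^{(a)}\overset{d}{=}\Big(\int_0^t f(t-s)1_{D_a^c}(s)\,dZ_s,\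 t\ge0\Big).$$ If moreover $f$ is not a.e. zero, the Lévy measures $\nu_a$ and $\tilde\nu_a$ of these two processes exist and are given, for every measurable $F\ge0$, by $$\int F\,d\nu_a=\int_{D_a}\!\int_0^\infty F\big(xf(t-s),\,t\ge0\big)\,\rho(dx)\,ds,\qquad \int F\,d\tilde\nu_a=\int_{D_a^c}\!\int_0^\infty F\big(xf(t-s),\,t\ge0\big)\,\rho(dx)\,ds .$$ -/

import Mathlib

open MeasureTheory ProbabilityTheory Filter Set Topology
open scoped NNReal ENNReal

noncomputable section

/-- A subordinator on a probability space: a `[0, ∞)`-valued process started at `0`, with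
independent and stationary increments and right-continuous nondecreasing paths. -/
structure Subordinator {Ω : Type*} [MeasurableSpace Ω] (P : Measure Ω) where
  /-- The value `Z_t(ω)`. -/
  val : ℝ≥0 → Ω → ℝ≥0
  measurable_val : ∀ t, Measurable (val t)
  zero_ae : ∀ᵐ ω ∂P, val 0 ω = 0
  mono : ∀ ω, Monotone fun t => val t ω
  right_cont : ∀ ω t, ContinuousWithinAt (fun t => val t ω) (Ici t) t
  indep : HasIndepIncrements (fun t ω => (val t ω : ℝ)) P
  stationary : ∀ s t : ℝ≥0,
    P.map (fun ω => (val (s + t) ω : ℝ) - val s ω) = P.map (fun ω => (val t ω : ℝ))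

/-- `ρ` is the Lévy measure on `(0, ∞)` of the law `μ` of a nonnegative infinitely divisible
random variable without drift: `μ` has Laplace transform
`u ↦ exp (- ∫ (1 - e^{-u x}) ρ(dx))`. -/
structure IsDriftlessLevyMeasure (ρ μ : Measure ℝ≥0) : Prop where
  zero : ρ {0} = 0
  finite : ∫⁻ x, ((min x 1 : ℝ≥0) : ℝ≥0∞) ∂ρ < ∞
  laplace : ∀ u : ℝ≥0, ∫ z, Real.exp (-((u : ℝ) * z)) ∂μ
    = Real.exp (-∫ x, (1 - Real.exp (-((u : ℝ) * x))) ∂ρ)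

namespace Subordinator

variable {Ω : Type*} [MeasurableSpace Ω] {P : Measure Ω}

/-- The mean `κ = E[Z_1]`. -/
def mean (Z : Subordinator P) : ℝ≥0∞ := ∫⁻ ω, Z.val 1 ω ∂P

/-- The path of `Z` as a Stieltjes function on the line, constant on `(-∞, 0]`. -/
def stieltjes (Z : Subordinator P) (ω : Ω) : StieltjesFunction ℝ where
  toFun s := Z.val s.toNNReal ω
  mono' _ _ h := NNReal.coe_le_coe.2 (Z.mono ω (Real.toNNReal_mono h))
  right_continuous' s := by
    have h1 : ContinuousWithinAt Real.toNNReal (Ici s) s :=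
      continuous_real_toNNReal.continuousWithinAt
    have h2 := (Z.right_cont ω s.toNNReal).comp h1
      (fun r hr => Real.toNNReal_mono hr)
    exact NNReal.continuous_coe.continuousAt.comp_continuousWithinAt h2

/-- The process `t ↦ ∫_0^t f(t - s) 1_D(s) dZ_s`, as a pathwise Lebesgue–Stieltjes integral.
For `f` locally integrable and `E[Z_1] < ∞` the integral is, for each `t`, almost surely finite;
on the exceptional null event the value is set to `0`. -/
def convOn (Z : Subordinator P) (f : ℝ → ℝ≥0) (D : Set ℝ) (t : ℝ≥0) (ω : Ω) : ℝ≥0 :=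
  (∫⁻ s in Ioc 0 (t : ℝ) ∩ D, f (t - s) ∂(Z.stieltjes ω).measure).toNNReal

/-- The stochastic convolution `ψ(t) = ∫_0^t f(t - s) dZ_s`. -/
def conv (Z : Subordinator P) (f : ℝ → ℝ≥0) : ℝ≥0 → Ω → ℝ≥0 := Z.convOn f univ

end Subordinator

/-- The law of a nonnegative process on the space of all functions `E → [0, ∞)` with its
cylindrical σ-algebra. -/
def processLaw {Ω E : Type*} [MeasurableSpace Ω] (P : Measure Ω) (X : E → Ω → ℝ≥0) :
    Measure (E → ℝ≥0) :=
  P.map fun ω x => X x ω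

/-- `ν` is the Lévy measure of the nonnegative infinitely divisible process without drift with
law `μ`. The field `inner` says that `ν(A)` is the inner `ν`-measure of `A` without the
origin, which makes `ν` unique. -/
structure IsProcessLevyMeasure {E : Type*} (ν μ : Measure (E → ℝ≥0)) : Prop where
  finite : ∀ x, ∫⁻ y, ((min (y x) 1 : ℝ≥0) : ℝ≥0∞) ∂ν < ∞
  laplace : ∀ (n : ℕ) (x : Fin n → E) (α : Fin n → ℝ≥0),
    ∫ y, Real.exp (-∑ i, (α i : ℝ) * y (x i)) ∂μ
      = Real.exp (-∫ y, (1 - Real.exp (-∑ i, (α i : ℝ) * y (x i))) ∂ν)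
  inner : ∀ A, MeasurableSet A →
    ν A = ⨆ (B : Set (E → ℝ≥0)) (_ : MeasurableSet B) (_ : B ⊆ A \ {0}), ν B

/-- A law on path space is infinitely divisible if all its finite-dimensional marginals are. -/
def IsInfDivLaw {E : Type*} (μ : Measure (E → ℝ≥0)) : Prop :=
  ∀ (I : Finset E) (n : ℕ), 0 < n → ∃ η : Measure (I → ℝ≥0), IsProbabilityMeasure η ∧
    (Measure.pi fun _ : Fin n => η).map (fun v => ∑ k, v k) = μ.map I.restrict

/-- `Q` is the law of `(ψ | ψ(a) = 0)`, where `μ` is the law of `ψ`: the elementary conditional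
law if `ψ(a) = 0` has positive probability, and in all cases the limit, in the sense of
finite-dimensional distributions, of the conditional laws given `ψ(a) ≤ ε` as `ε ↓ 0`. -/
structure IsCondLawAtZero {E : Type*} (μ : Measure (E → ℝ≥0)) (a : E)
    (Q : Measure (E → ℝ≥0)) : Prop where
  elementary : μ {y | y a = 0} ≠ 0 → Q = ProbabilityTheory.cond μ {y | y a = 0}
  pos : ∀ ε : ℝ≥0, 0 < ε → μ {y | y a ≤ ε} ≠ 0
  limit : ∀ (I : Finset E) (g : BoundedContinuousFunction (I → ℝ≥0) ℝ),
    Tendsto (fun ε : ℝ≥0 => ∫ y, g (I.restrict y) ∂(ProbabilityTheory.cond μ {y | y a ≤ ε}))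
      (𝓝[>] 0) (𝓝 (∫ y, g (I.restrict y) ∂Q))

/-- `I(a) = ∫_0^a f(s) ds`. -/
def primitiveAt (f : ℝ → ℝ≥0) (a : ℝ≥0) : ℝ≥0∞ := ∫⁻ s in Icc 0 (a : ℝ), f s

/-- The law on `[0, a]` with density `s ↦ f(a - s) / I(a)`. -/
def timeLaw (f : ℝ → ℝ≥0) (a : ℝ≥0) : Measure ℝ :=
  (volume.restrict (Icc 0 (a : ℝ))).withDensity fun s => f (a - s) / primitiveAt f a

/-- The law `κ⁻¹ x ρ(dx)`. -/
def sizeBiasedLaw (κ : ℝ≥0∞) (ρ : Measure ℝ≥0) : Measure ℝ≥0 :=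
  κ⁻¹ • ρ.withDensity fun x => (x : ℝ≥0∞)

/-- The path `t ↦ x f(t - s)`, `t ≥ 0`. -/
def shiftPath (f : ℝ → ℝ≥0) (x : ℝ≥0) (s : ℝ) : ℝ≥0 → ℝ≥0 := fun t => x * f (t - s)

/-- `D_a = {s ≥ 0 : f(a - s) = 0}`. -/
def zeroTimes (f : ℝ → ℝ≥0) (a : ℝ≥0) : Set ℝ := {s | 0 ≤ s ∧ f (a - s) = 0}

end

/-! Everything is read off Laplace transforms, which determine finite measures on path space. The
central fact is that a linear combination of values of the convolution is again an integral of a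
deterministic function against `dZ`. The Laplace functional of `dZ` at `g` is the exponential of
minus the integral of `laplaceExponent ρ (g s)` over time (`laplace_functional`). It is obtained for
step functions from independent increments, for continuous functions by Riemann sums, and for
integrable functions by Campbell's formula and the Lipschitz continuity of the exponent. Hence `∫
f(t - s) 1_D(s) dZ_s` has as Lévy measure the image of `ds ρ(dx)` on `D` under `(s, x) ↦ x f(· - s)`
(`shiftLevy`).

For (a3), add a coordinate `a` with coefficient `u` to the Laplace functional and differentiate at
`u = 0`. This gives the Palm formula `E[ψ(a) G(ψ)] = ∫ E[y(a) G(ψ + y)] ν(dy)` (`withDensity_eval`,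
`lintegral_eval_mul`). On a path `x f(· - s)` the weight `y(a)` is `x f(a - s)`, which splits into
the densities of `V` and `U_a` up to the constant `κ I(a)`.

For (b3), the weight `V⁻¹ e^{θY}` cancels the size-bias of `V` and the exponential decay of the law
of `Y`, leaving `ds ρ(dx)`. Being the Lévy measure also requires that paths nonzero on some fixed
countable set carry the measure. This holds because rational translates of a set of positive
Lebesgue measure cover almost every point. Conversely, a Lévy measure is unique: on `{y x ≠ 0}` it
is recovered from a finite measure with known Laplace transform, and measurable sets avoiding the
zero path are covered by countably many such events.

For (c3), split `[0, ∞)` into `D_a` and its complement. Lévy measures add, so laws convolve. The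
first factor vanishes at `a`. The second, `R`, has a Lévy measure whose paths vanishing at `a` are
all zero. By the Palm formula its mean at any time, conditionally on `z a ≤ ε`, is at most the Lévy
mean over `{y a ≤ ε}`, which tends to `0`. So the conditioned second factor degenerates to `0` and
the first factor is the conditional law. -/

noncomputable section

/-! ### Laplace transforms determine finite measures -/

/-- The exponential `y ↦ exp (-∑ i, c i * y i)` as a bounded continuous function. -/
def expNegSum {ι : Type*} [Fintype ι] (c : ι → ℝ≥0) : BoundedContinuousFunction (ι → ℝ≥0) ℝ :=
  BoundedContinuousFunction.ofNormedAddCommGroup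
    (fun y => Real.exp (-∑ i, (c i : ℝ) * y i)) (by fun_prop) 1 (fun y => by
      rw [Real.norm_eq_abs, Real.abs_exp, Real.exp_le_one_iff]
      have : 0 ≤ ∑ i, (c i : ℝ) * y i := Finset.sum_nonneg fun i _ => by positivity
      linarith)

theorem expNegSum_apply {ι : Type*} [Fintype ι] (c y : ι → ℝ≥0) :
    expNegSum c y = Real.exp (-∑ i, (c i : ℝ) * y i) := rfl

theorem expNegSum_add {ι : Type*} [Fintype ι] (c d : ι → ℝ≥0) :
    expNegSum (c + d) = expNegSum c * expNegSum d := by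
  ext y
  simp only [BoundedContinuousFunction.mul_apply, expNegSum_apply, ← Real.exp_add, Pi.add_apply,
    NNReal.coe_add, add_mul, Finset.sum_add_distrib]
  congr 1
  ring

theorem expNegSum_zero {ι : Type*} [Fintype ι] : expNegSum (0 : ι → ℝ≥0) = 1 := by
  ext y
  simp [expNegSum_apply]

/-- The star subalgebra spanned by the exponentials. -/
def expSubalgebra (ι : Type*) [Fintype ι] :
    StarSubalgebra ℝ (BoundedContinuousFunction (ι → ℝ≥0) ℝ) :=
  { Submodule.toSubalgebra (Submodule.span ℝ (range (expNegSum (ι := ι))))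
      (Submodule.subset_span ⟨0, expNegSum_zero⟩)
      (fun x y hx hy => by
        have h := Submodule.mul_mem_mul hx hy
        rw [Submodule.span_mul_span] at h
        refine Submodule.span_mono ?_ h
        rintro _ ⟨_, ⟨c, rfl⟩, _, ⟨d, rfl⟩, rfl⟩
        exact ⟨c + d, expNegSum_add c d⟩) with
    star_mem' := fun {g} hg => by
      have : star g = g := by ext; simp
      rw [this]; exact hg }

/-- A Stone–Weierstrass argument: the exponentials are closed under products, contain `1` and
separate points, so their span is a point-separating algebra on a Polish space, and integrals over
it determine a finite measure. -/
theorem ext_of_laplace_pi {ι : Type*} [Fintype ι] {μ ν : Measure (ι → ℝ≥0)} [IsFiniteMeasure μ]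
    [IsFiniteMeasure ν]
    (h : ∀ c : ι → ℝ≥0, ∫ y, Real.exp (-∑ i, (c i : ℝ) * y i) ∂μ
      = ∫ y, Real.exp (-∑ i, (c i : ℝ) * y i) ∂ν) : μ = ν := by
  classical
  refine ext_of_forall_mem_subalgebra_integral_eq_of_polish (𝕜 := ℝ) (A := expSubalgebra ι) ?_ ?_
  · intro y z hyz
    obtain ⟨i, hi⟩ := Function.ne_iff.1 hyz
    refine ⟨_, ⟨_, ⟨expNegSum (Pi.single i 1),
      Submodule.subset_span ⟨_, rfl⟩, rfl⟩, rfl⟩, ?_⟩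
    simp only [BoundedContinuousFunction.toContinuousMapStarₐ,
      BoundedContinuousFunction.toContinuousMapₐ, ne_eq]
    intro hc
    change Real.exp _ = Real.exp _ at hc
    rw [Real.exp_eq_exp, neg_inj] at hc
    apply hi
    have key : ∀ w : ι → ℝ≥0, ∑ j, (((Pi.single i 1 : ι → ℝ≥0) j : ℝ≥0) : ℝ) * w j = w i := by
      intro w
      rw [Finset.sum_eq_single i (fun j _ hj => by simp [hj]) (by simp)]
      simp
    rw [key, key] at hc
    exact_mod_cast hc
  · intro g hg
    replace hg : g ∈ Submodule.span ℝ (range (expNegSum (ι := ι))) := hg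
    induction hg using Submodule.span_induction with
    | mem g hg => obtain ⟨c, rfl⟩ := hg; exact h c
    | zero => simp
    | add a b ha hb iha ihb =>
      simp only [BoundedContinuousFunction.add_apply]
      rw [integral_add (a.integrable μ) (b.integrable μ),
        integral_add (a.integrable ν) (b.integrable ν), iha, ihb]
    | smul r a ha ih =>
      simp only [BoundedContinuousFunction.coe_smul]
      rw [integral_smul, integral_smul, ih]

/-- Finite measures on a path space with equal finite-dimensional marginals are equal. -/
theorem ext_of_map_restrict {E : Type*} {μ ν : Measure (E → ℝ≥0)} [IsFiniteMeasure μ]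
    [IsFiniteMeasure ν] (h : ∀ I : Finset E, μ.map I.restrict = ν.map I.restrict) : μ = ν :=
  IsProjectiveLimit.unique (P := fun I : Finset E => μ.map I.restrict)
    (fun _ => rfl) (fun I => (h I).symm)

theorem sum_equivFin_symm {E : Type*} (I : Finset E) (c : I → ℝ≥0) (y : E → ℝ≥0) :
    ∑ i, (c i : ℝ) * I.restrict y i =
      ∑ k : Fin I.card, (c (I.equivFin.symm k) : ℝ) * y (I.equivFin.symm k : E) :=
  (Equiv.sum_comp I.equivFin.symm fun i => (c i : ℝ) * I.restrict y i).symm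

/-- Finite measures on a path space with equal Laplace transforms are equal. -/
theorem ext_of_laplace {E : Type*} {μ ν : Measure (E → ℝ≥0)} [IsFiniteMeasure μ]
    [IsFiniteMeasure ν]
    (h : ∀ (n : ℕ) (x : Fin n → E) (α : Fin n → ℝ≥0),
      ∫ y, Real.exp (-∑ i, (α i : ℝ) * y (x i)) ∂μ =
        ∫ y, Real.exp (-∑ i, (α i : ℝ) * y (x i)) ∂ν) : μ = ν := by
  refine ext_of_map_restrict fun I => ext_of_laplace_pi fun c => ?_
  have hm : Measurable (I.restrict (π := fun _ : E => ℝ≥0)) := Finset.measurable_restrict I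
  rw [integral_map hm.aemeasurable, integral_map hm.aemeasurable]
  · simp_rw [sum_equivFin_symm]
    exact h _ _ _
  all_goals exact (expNegSum c).continuous.aestronglyMeasurable

end

noncomputable section

/-! ### Differentiation of Laplace transforms at the origin -/

theorem one_sub_exp_neg_nonneg {w : ℝ} (hw : 0 ≤ w) : 0 ≤ 1 - Real.exp (-w) := by
  have := Real.exp_le_one_iff.2 (neg_nonpos.2 hw)
  linarith

theorem one_sub_exp_neg_le (w : ℝ) : 1 - Real.exp (-w) ≤ w := by
  have := Real.add_one_le_exp (-w)
  linarith

theorem tendsto_one_sub_exp_neg_div (w : ℝ) :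
    Tendsto (fun u : ℝ => (1 - Real.exp (-(u * w))) / u) (𝓝[>] 0) (𝓝 w) := by
  have h1 : HasDerivAt (fun u : ℝ => 1 - Real.exp (-(u * w))) w 0 := by
    have h2 : HasDerivAt (fun u : ℝ => -(u * w)) (-(1 * w)) 0 := ((hasDerivAt_id 0).mul_const w).neg
    have h3 := (h2.exp).const_sub 1
    simpa using h3
  have h4 := (hasDerivWithinAt_iff_tendsto_slope' (by simp)).1 (h1.hasDerivWithinAt (s := Ioi 0))
  refine h4.congr' (Eventually.of_forall fun u => ?_)
  simp [slope_def_field]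

/-- Fatou's lemma for `(1 - e^{-uw}) / u → w` as `u ↓ 0`. It extracts a first moment from a linear
bound on a Laplace exponent, with no integrability known beforehand. -/
theorem lintegral_le_of_one_sub_exp_le {X : Type*} [MeasurableSpace X] {m : Measure X} {w : X → ℝ≥0}
    (hw : Measurable w) {C : ℝ≥0∞} {δ : ℝ} (hδ : 0 < δ)
    (h : ∀ u : ℝ, 0 < u → u < δ →
      ∫⁻ z, ENNReal.ofReal (1 - Real.exp (-(u * w z))) ∂m ≤ ENNReal.ofReal u * C) :
    ∫⁻ z, w z ∂m ≤ C := by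
  -- The shift by `2` keeps every term strictly below `δ`, including the one with `n = 0`.
  have hu : Tendsto (fun n : ℕ => δ / ((n : ℝ) + 2)) atTop (𝓝[>] 0) := by
    refine tendsto_nhdsWithin_iff.2 ⟨?_, Eventually.of_forall fun n => ?_⟩
    · exact tendsto_const_nhds.div_atTop
        (tendsto_atTop_add_const_right _ _ tendsto_natCast_atTop_atTop)
    · exact div_pos hδ (by positivity)
  have hlim : ∀ z, (w z : ℝ≥0∞) = liminf (fun n : ℕ =>
      ENNReal.ofReal ((1 - Real.exp (-((δ / ((n : ℝ) + 2)) * w z))) / (δ / ((n : ℝ) + 2)))) atTop := by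
    intro z
    refine (Tendsto.liminf_eq ?_).symm
    have h1 := (ENNReal.continuous_ofReal.tendsto _).comp
      ((tendsto_one_sub_exp_neg_div (w z)).comp hu)
    simpa [Function.comp_def] using h1
  simp_rw [hlim]
  refine (lintegral_liminf_le fun n => by fun_prop).trans ?_
  refine liminf_le_of_le (by isBoundedDefault) fun b hb => ?_
  obtain ⟨n, hn⟩ := hb.exists
  refine hn.trans ?_
  set u := δ / ((n : ℝ) + 2) with hu_def
  have hu0 : 0 < u := div_pos hδ (by positivity)
  have hu1 : u < δ := by
    rw [hu_def, div_lt_iff₀ (by positivity)]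
    have : (0 : ℝ) ≤ n := by positivity
    nlinarith
  simp_rw [ENNReal.ofReal_div_of_pos hu0, ENNReal.div_eq_inv_mul]
  rw [lintegral_const_mul _ (by fun_prop)]
  calc (ENNReal.ofReal u)⁻¹ * _ ≤ (ENNReal.ofReal u)⁻¹ * (ENNReal.ofReal u * C) := by
        gcongr; exact h u hu0 hu1
    _ = C := by
        rw [← mul_assoc, ENNReal.inv_mul_cancel (by simpa using hu0) ENNReal.ofReal_ne_top, one_mul]

theorem integrable_coe_of_lintegral_lt_top {X : Type*} [MeasurableSpace X] {m : Measure X}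
    {w : X → ℝ≥0} (hw : Measurable w) (h : ∫⁻ z, w z ∂m < ∞) :
    Integrable (fun z => (w z : ℝ)) m := by
  refine ⟨by fun_prop, ?_⟩
  simpa [HasFiniteIntegral] using h

/-- Dominated convergence: since `0 ≤ g ≤ 1`, the difference quotients are bounded by `w`. -/
theorem hasDerivWithinAt_integral_one_sub_exp {X : Type*} [MeasurableSpace X] {m : Measure X}
    {g : X → ℝ} (hg : Measurable g) (hg0 : ∀ z, 0 ≤ g z) (hg1 : ∀ z, g z ≤ 1)
    {w : X → ℝ≥0} (hw : Measurable w) (hwi : ∫⁻ z, w z ∂m < ∞) :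
    HasDerivWithinAt (fun u : ℝ => ∫ z, g z * (1 - Real.exp (-(u * w z))) ∂m)
      (∫ z, g z * w z ∂m) (Ioi 0) 0 := by
  rw [hasDerivWithinAt_iff_tendsto_slope' (by simp)]
  have h1 : ∀ u : ℝ, slope (fun u : ℝ => ∫ z, g z * (1 - Real.exp (-(u * w z))) ∂m) 0 u
      = ∫ z, g z * ((1 - Real.exp (-(u * w z))) / u) ∂m := by
    intro u
    simp only [slope_def_field, zero_mul, neg_zero, Real.exp_zero, sub_self, mul_zero,
      integral_zero, sub_zero]
    rw [← integral_div]
    simp_rw [mul_div_assoc]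
  simp_rw [funext h1]
  refine tendsto_integral_filter_of_dominated_convergence (fun z => (w z : ℝ))
    (Eventually.of_forall fun u => by fun_prop) ?_ (integrable_coe_of_lintegral_lt_top hw hwi) ?_
  · filter_upwards [self_mem_nhdsWithin] with u hu
    refine Eventually.of_forall fun z => ?_
    have hu0 : (0 : ℝ) < u := hu
    have h2 : 0 ≤ (1 - Real.exp (-(u * w z))) / u :=
      div_nonneg (one_sub_exp_neg_nonneg (by positivity)) hu0.le
    have h3 : (1 - Real.exp (-(u * w z))) / u ≤ w z := by
      rw [div_le_iff₀ hu0, mul_comm]; exact one_sub_exp_neg_le _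
    rw [Real.norm_eq_abs, abs_of_nonneg (mul_nonneg (hg0 z) h2)]
    calc _ ≤ 1 * ((1 - Real.exp (-(u * w z))) / u) := by gcongr; exact hg1 z
      _ ≤ _ := by linarith
  · exact Eventually.of_forall fun z => (tendsto_one_sub_exp_neg_div (w z)).const_mul (g z)

theorem integrable_mul_one_sub_exp {X : Type*} [MeasurableSpace X] {m : Measure X}
    {g : X → ℝ} (hg : Measurable g) (hg0 : ∀ z, 0 ≤ g z) (hg1 : ∀ z, g z ≤ 1)
    {w : X → ℝ≥0} (hw : Measurable w) (hwi : ∫⁻ z, w z ∂m < ∞) :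
    Integrable (fun z => g z * (1 - Real.exp (-(w z : ℝ)))) m := by
  refine (integrable_coe_of_lintegral_lt_top hw hwi).mono' (by fun_prop)
    (Eventually.of_forall fun z => ?_)
  have h2 : 0 ≤ 1 - Real.exp (-(w z : ℝ)) := one_sub_exp_neg_nonneg (w z).coe_nonneg
  have h3 := one_sub_exp_neg_le (w z)
  rw [Real.norm_eq_abs, abs_of_nonneg (mul_nonneg (hg0 z) h2)]
  calc _ ≤ 1 * (1 - Real.exp (-(w z : ℝ))) := by gcongr; exact hg1 z
    _ ≤ _ := by linarith

theorem integrable_one_sub_exp {X : Type*} [MeasurableSpace X] {m : Measure X}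
    {w : X → ℝ≥0} (hw : Measurable w) (hwi : ∫⁻ z, w z ∂m < ∞) :
    Integrable (fun z => 1 - Real.exp (-(w z : ℝ))) m := by
  simpa using integrable_mul_one_sub_exp (g := fun _ => 1) measurable_const (by simp) (by simp)
    hw hwi

/-- If `u ↦ ∫ g e^{-uw} dm` and `u ↦ c exp (-∫ h (1 - e^{-uv}) dk)` coincide on `[0, ∞)`, then so
do their derivatives at `0`. -/
theorem integral_mul_eq_of_laplace_eq {X Y : Type*} [MeasurableSpace X] [MeasurableSpace Y]
    {m : Measure X} [IsFiniteMeasure m] {k : Measure Y} {g : X → ℝ} (hg : Measurable g)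
    (hg0 : ∀ z, 0 ≤ g z) (hg1 : ∀ z, g z ≤ 1) {w : X → ℝ≥0} (hw : Measurable w)
    (hwi : ∫⁻ z, w z ∂m < ∞) {h : Y → ℝ} (hh : Measurable h)
    (hh0 : ∀ z, 0 ≤ h z) (hh1 : ∀ z, h z ≤ 1) {v : Y → ℝ≥0} (hv : Measurable v)
    (hvi : ∫⁻ z, v z ∂k < ∞) (c : ℝ)
    (heq : ∀ u : ℝ≥0, ∫ z, g z * Real.exp (-(u * w z)) ∂m
      = c * Real.exp (-∫ y, h y * (1 - Real.exp (-(u * v y))) ∂k)) :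
    ∫ z, g z * w z ∂m = c * ∫ y, h y * v y ∂k := by
  have hgi : Integrable g m := by
    refine Integrable.of_bound (by fun_prop) 1 (Eventually.of_forall fun z => ?_)
    rw [Real.norm_eq_abs, abs_of_nonneg (hg0 z)]; exact hg1 z
  have h1 := hasDerivWithinAt_integral_one_sub_exp hg hg0 hg1 hw hwi
  have h2 := hasDerivWithinAt_integral_one_sub_exp hh hh0 hh1 hv hvi
  have h3 : HasDerivWithinAt (fun u : ℝ => (∫ z, g z ∂m) -
      c * Real.exp (-∫ y, h y * (1 - Real.exp (-(u * v y))) ∂k))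
      (c * ∫ y, h y * v y ∂k) (Ioi 0) 0 := by
    have := ((h2.neg.exp).const_mul c).const_sub (∫ z, g z ∂m)
    simpa using this
  refine (uniqueDiffWithinAt_Ioi (0 : ℝ)).eq_deriv _ h1 (h3.congr_of_eventuallyEq ?_ ?_)
  · filter_upwards [self_mem_nhdsWithin] with u hu
    have hu0 : (0 : ℝ) < u := hu
    have h5 := heq ⟨u, hu0.le⟩
    change ∫ z, g z * Real.exp (-(u * w z)) ∂m
      = c * Real.exp (-∫ y, h y * (1 - Real.exp (-(u * v y))) ∂k) at h5
    rw [← h5, ← integral_sub hgi]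
    · simp_rw [mul_sub, mul_one]
    · refine Integrable.of_bound (by fun_prop) 1 (Eventually.of_forall fun z => ?_)
      rw [Real.norm_eq_abs, abs_of_nonneg (mul_nonneg (hg0 z) (Real.exp_nonneg _))]
      refine mul_le_one₀ (hg1 z) (Real.exp_nonneg _) (Real.exp_le_one_iff.2 ?_)
      have : 0 ≤ u * w z := by positivity
      linarith
  -- At `u = 0` the hypothesis reads `∫ g = c`, so the two functions being differentiated also agree
  -- at the base point.
  · have h5 := heq 0
    simp only [NNReal.coe_zero, zero_mul, neg_zero, Real.exp_zero, mul_one, sub_self, mul_zero,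
      integral_zero] at h5
    simp [h5]

end

noncomputable section

/-! ### Infinitely divisible processes with finite mean -/

/-- The law `μ` of a nonnegative process has the Laplace functional of a driftless infinitely
divisible process with Lévy measure `ν`, and `ν` has finite first moments. -/
structure HasLevyLaplace {E : Type*} (ν μ : Measure (E → ℝ≥0)) : Prop where
  moment : ∀ x, ∫⁻ y, y x ∂ν < ∞
  laplace : ∀ (n : ℕ) (x : Fin n → E) (α : Fin n → ℝ≥0),
    ∫ y, Real.exp (-∑ i, (α i : ℝ) * y (x i)) ∂μ
      = Real.exp (-∫ y, (1 - Real.exp (-∑ i, (α i : ℝ) * y (x i))) ∂ν)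

section Paths

variable {E : Type*}

theorem measurable_sum_mul_eval {n : ℕ} (x : Fin n → E) (α : Fin n → ℝ≥0) :
    Measurable fun y : E → ℝ≥0 => ∑ i, α i * y (x i) := by
  fun_prop

theorem coe_sum_mul_eval {n : ℕ} (x : Fin n → E) (α : Fin n → ℝ≥0) (y : E → ℝ≥0) :
    ((∑ i, α i * y (x i) : ℝ≥0) : ℝ) = ∑ i, (α i : ℝ) * y (x i) := by
  push_cast; rfl

theorem measurable_exp_neg_sum {n : ℕ} (x : Fin n → E) (α : Fin n → ℝ≥0) :
    Measurable fun y : E → ℝ≥0 => Real.exp (-∑ i, (α i : ℝ) * y (x i)) := by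
  simp_rw [← coe_sum_mul_eval]
  have := measurable_sum_mul_eval x α
  fun_prop

theorem exp_neg_sum_le_one {n : ℕ} (x : Fin n → E) (α : Fin n → ℝ≥0) (y : E → ℝ≥0) :
    Real.exp (-∑ i, (α i : ℝ) * y (x i)) ≤ 1 := by
  rw [← coe_sum_mul_eval, Real.exp_le_one_iff, neg_nonpos]
  exact NNReal.coe_nonneg _

theorem integrable_exp_neg_sum {n : ℕ} (x : Fin n → E) (α : Fin n → ℝ≥0)
    (μ : Measure (E → ℝ≥0)) [IsFiniteMeasure μ] :
    Integrable (fun y => Real.exp (-∑ i, (α i : ℝ) * y (x i))) μ := by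
  refine Integrable.of_bound (measurable_exp_neg_sum x α).aestronglyMeasurable 1
    (Eventually.of_forall fun z => ?_)
  rw [Real.norm_eq_abs, abs_of_nonneg (Real.exp_nonneg _)]
  exact exp_neg_sum_le_one x α z

theorem laplace_conv {n : ℕ} (x : Fin n → E) (α : Fin n → ℝ≥0) (μ ν : Measure (E → ℝ≥0))
    [IsFiniteMeasure μ] [IsFiniteMeasure ν] :
    ∫ y, Real.exp (-∑ i, (α i : ℝ) * y (x i)) ∂(μ.conv ν)
      = (∫ y, Real.exp (-∑ i, (α i : ℝ) * y (x i)) ∂μ) *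
        ∫ y, Real.exp (-∑ i, (α i : ℝ) * y (x i)) ∂ν := by
  rw [Measure.conv, integral_map measurable_add.aemeasurable
    (measurable_exp_neg_sum x α).aestronglyMeasurable, ← integral_prod_mul]
  refine integral_congr_ae (Eventually.of_forall fun p => ?_)
  simp only [Pi.add_apply, NNReal.coe_add, mul_add, Finset.sum_add_distrib, neg_add, Real.exp_add]

theorem lintegral_sum_mul_eval_lt_top {ν : Measure (E → ℝ≥0)} (h : ∀ x, ∫⁻ y, y x ∂ν < ∞)
    {n : ℕ} (x : Fin n → E) (α : Fin n → ℝ≥0) :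
    ∫⁻ y, ((∑ i, α i * y (x i) : ℝ≥0) : ℝ≥0∞) ∂ν < ∞ := by
  simp_rw [ENNReal.ofNNReal_finsetSum, ENNReal.coe_mul]
  rw [lintegral_finsetSum _ fun i _ => by fun_prop]
  refine ENNReal.sum_lt_top.2 fun i _ => ?_
  rw [lintegral_const_mul _ (by fun_prop)]
  exact ENNReal.mul_lt_top ENNReal.coe_lt_top (h _)

theorem integrable_one_sub_exp_neg_sum {ν : Measure (E → ℝ≥0)} (h : ∀ x, ∫⁻ y, y x ∂ν < ∞)
    {n : ℕ} (x : Fin n → E) (α : Fin n → ℝ≥0) :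
    Integrable (fun y => 1 - Real.exp (-∑ i, (α i : ℝ) * y (x i))) ν := by
  simp_rw [← coe_sum_mul_eval]
  exact integrable_one_sub_exp (measurable_sum_mul_eval x α) (lintegral_sum_mul_eval_lt_top h x α)

namespace HasLevyLaplace

variable {ν μ : Measure (E → ℝ≥0)}

theorem laplace_eval (h : HasLevyLaplace ν μ) (x : E) (u : ℝ≥0) :
    ∫ y, Real.exp (-((u : ℝ) * y x)) ∂μ
      = Real.exp (-∫ y, (1 - Real.exp (-((u : ℝ) * y x))) ∂ν) := by
  simpa using h.laplace 1 (fun _ => x) (fun _ => u)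

theorem lintegral_one_sub_exp_le (h : HasLevyLaplace ν μ) [IsProbabilityMeasure μ] (x : E)
    (u : ℝ≥0) :
    ∫⁻ z, ENNReal.ofReal (1 - Real.exp (-((u : ℝ) * z x))) ∂μ
      ≤ ENNReal.ofReal (∫ y, (1 - Real.exp (-((u : ℝ) * y x))) ∂ν) := by
  have hi : Integrable (fun z : E → ℝ≥0 => Real.exp (-((u : ℝ) * z x))) μ := by
    simpa using integrable_exp_neg_sum (fun _ : Fin 1 => x) (fun _ => u) μ
  have hi' : Integrable (fun z : E → ℝ≥0 => 1 - Real.exp (-((u : ℝ) * z x))) μ :=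
    (integrable_const _).sub hi
  rw [← ofReal_integral_eq_lintegral_ofReal hi'
    (Eventually.of_forall fun z => one_sub_exp_neg_nonneg (by positivity)),
    integral_sub (integrable_const _) hi, h.laplace_eval]
  refine ENNReal.ofReal_le_ofReal ?_
  simpa using one_sub_exp_neg_le _

/-- Combine `1 - e^{-p} ≤ p` for the Laplace exponent with Fatou. The inequality suffices, because
its role is to make the size-biased law finite. -/
theorem moment_law_le (h : HasLevyLaplace ν μ) [IsProbabilityMeasure μ] (x : E) :
    ∫⁻ z, z x ∂μ ≤ ∫⁻ y, y x ∂ν := by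
  refine lintegral_le_of_one_sub_exp_le (measurable_pi_apply x) one_pos fun u hu _ => ?_
  lift u to ℝ≥0 using hu.le
  refine (h.lintegral_one_sub_exp_le x u).trans ?_
  have hi : Integrable (fun y : E → ℝ≥0 => (1 - Real.exp (-((u : ℝ) * y x)))) ν := by
    simpa using integrable_one_sub_exp_neg_sum h.moment (fun _ : Fin 1 => x) (fun _ => u)
  rw [ofReal_integral_eq_lintegral_ofReal hi
    (Eventually.of_forall fun z => one_sub_exp_neg_nonneg (by positivity)),
    ← lintegral_const_mul _ (by fun_prop)]
  refine lintegral_mono fun y => ?_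
  refine (ENNReal.ofReal_le_ofReal (one_sub_exp_neg_le _)).trans_eq ?_
  rw [ENNReal.ofReal_mul u.coe_nonneg]
  simp

/-- Size-biasing an infinitely divisible process at `x` amounts to adding an independent path drawn
from the Lévy measure biased at `x`. -/
theorem withDensity_eval (h : HasLevyLaplace ν μ) [IsProbabilityMeasure μ] (x : E) :
    μ.withDensity (fun z => (z x : ℝ≥0∞)) = μ.conv (ν.withDensity fun y => (y x : ℝ≥0∞)) := by
  have hμ : ∫⁻ z, z x ∂μ < ∞ := (h.moment_law_le x).trans_lt (h.moment x)
  have : IsFiniteMeasure (μ.withDensity (fun z => (z x : ℝ≥0∞))) :=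
    isFiniteMeasure_withDensity hμ.ne
  have : IsFiniteMeasure (ν.withDensity (fun z => (z x : ℝ≥0∞))) :=
    isFiniteMeasure_withDensity (h.moment x).ne
  refine ext_of_laplace fun n t α => ?_
  rw [laplace_conv]
  have hx : Measurable fun z : E → ℝ≥0 => z x := measurable_pi_apply x
  rw [integral_withDensity_eq_integral_smul hx, integral_withDensity_eq_integral_smul hx]
  simp only [NNReal.smul_def, smul_eq_mul, mul_comm _ (Real.exp _)]
  refine integral_mul_eq_of_laplace_eq (measurable_exp_neg_sum t α) (fun _ => Real.exp_nonneg _)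
    (exp_neg_sum_le_one t α) hx hμ (measurable_exp_neg_sum t α) (fun _ => Real.exp_nonneg _)
    (exp_neg_sum_le_one t α) hx (h.moment x) _ fun u => ?_
  -- Insert `x` as an extra coordinate with coefficient `u`. Differentiating at `u = 0` brings down
  -- `z x` under `μ` and `y x` under `ν`.
  have h1 := h.laplace (n + 1) (Fin.cons x t) (Fin.cons u α)
  simp only [Fin.sum_univ_succ, Fin.cons_zero, Fin.cons_succ, neg_add, Real.exp_add] at h1
  simp_rw [mul_comm _ (Real.exp (-((u : ℝ) * _)))]
  rw [h1, h.laplace, ← Real.exp_add]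
  congr 1
  rw [← neg_add, ← integral_add (integrable_one_sub_exp_neg_sum h.moment t α)]
  · congr 1
    refine integral_congr_ae (Eventually.of_forall fun y => ?_)
    simp only
    ring
  · have hm : Measurable fun z : E → ℝ≥0 => u * z x := hx.const_mul u
    have := integrable_mul_one_sub_exp (m := ν) (measurable_exp_neg_sum t α)
      (fun _ => Real.exp_nonneg _) (exp_neg_sum_le_one t α) hm (by
        simp_rw [ENNReal.coe_mul]
        rw [lintegral_const_mul _ (by fun_prop)]
        exact ENNReal.mul_lt_top ENNReal.coe_lt_top (h.moment _))
    simpa using this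

/-- The Palm (Mecke) formula, the integrated form of `withDensity_eval`. It drives both the
size-bias identity and the conditioning estimate. -/
theorem lintegral_eval_mul (h : HasLevyLaplace ν μ) [IsProbabilityMeasure μ] (x : E)
    {G : (E → ℝ≥0) → ℝ≥0∞} (hG : Measurable G) :
    ∫⁻ z, z x * G z ∂μ = ∫⁻ z, ∫⁻ y, y x * G (z + y) ∂ν ∂μ := by
  have : IsFiniteMeasure (ν.withDensity (fun z => (z x : ℝ≥0∞))) :=
    isFiniteMeasure_withDensity (h.moment x).ne
  have hx : Measurable fun z : E → ℝ≥0 => (z x : ℝ≥0∞) := by fun_prop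
  have h1 := lintegral_withDensity_eq_lintegral_mul μ hx hG
  simp only [Pi.mul_apply] at h1
  rw [← h1, h.withDensity_eval, Measure.lintegral_conv hG]
  refine lintegral_congr fun z => ?_
  have h2 : Measurable fun y => G (z + y) := hG.comp (measurable_const_add z)
  rw [lintegral_withDensity_eq_lintegral_mul ν hx h2]
  rfl

/-- The mean of `z x` on `{z a ≤ ε}` is controlled by the part of the Lévy measure on
`{y a ≤ ε}`. -/
theorem setLIntegral_eval_le (h : HasLevyLaplace ν μ) [IsProbabilityMeasure μ] (a x : E) (ε : ℝ≥0) :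
    ∫⁻ z in {z | z a ≤ ε}, z x ∂μ
      ≤ μ {z | z a ≤ ε} * ∫⁻ y in {y | y a ≤ ε}, y x ∂ν := by
  have hS : MeasurableSet {z : E → ℝ≥0 | z a ≤ ε} :=
    measurableSet_le (measurable_pi_apply a) measurable_const
  have h1 := h.lintegral_eval_mul x (G := {z | z a ≤ ε}.indicator 1) (measurable_one.indicator hS)
  calc ∫⁻ z in {z | z a ≤ ε}, z x ∂μ
      = ∫⁻ z, z x * {z | z a ≤ ε}.indicator 1 z ∂μ := by
        rw [← lintegral_indicator hS]
        refine lintegral_congr fun z => ?_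
        by_cases hz : z ∈ {z : E → ℝ≥0 | z a ≤ ε} <;> simp [hz]
    _ = _ := h1
    _ ≤ ∫⁻ z, {z | z a ≤ ε}.indicator 1 z * ∫⁻ y in {y | y a ≤ ε}, y x ∂ν ∂μ := by
        refine lintegral_mono fun z => ?_
        simp only
        rw [← lintegral_const_mul' _ _ (by by_cases hz : z ∈ {z : E → ℝ≥0 | z a ≤ ε} <;> simp [hz]),
          ← lintegral_indicator hS]
        refine lintegral_mono fun y => ?_
        -- By nonnegativity, `z a + y a ≤ ε` forces both `z a ≤ ε` and `y a ≤ ε`, which decouples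
        -- the two integrals.
        by_cases hzy : z + y ∈ {z : E → ℝ≥0 | z a ≤ ε}
        · have hzy' : z a + y a ≤ ε := hzy
          have hz : z ∈ {z : E → ℝ≥0 | z a ≤ ε} := le_trans le_self_add hzy'
          have hy : y ∈ {z : E → ℝ≥0 | z a ≤ ε} := le_trans le_add_self hzy'
          simp [hzy, hz, hy]
        · simp [hzy]
    _ = _ := by
        rw [lintegral_mul_const _ (measurable_one.indicator hS), lintegral_indicator_one hS]

/-- A driftless infinitely divisible variable has `0` in its support. -/
theorem measure_eval_le_ne_zero (h : HasLevyLaplace ν μ) [IsProbabilityMeasure μ] (a : E) {ε : ℝ≥0}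
    (hε : 0 < ε) : μ {z | z a ≤ ε} ≠ 0 := by
  intro h0
  have hlow : ∀ᵐ z ∂μ, ε < z a := by
    rw [ae_iff]; simpa using h0
  have hi : Integrable (fun y : E → ℝ≥0 => (y a : ℝ)) ν :=
    integrable_coe_of_lintegral_lt_top (measurable_pi_apply a) (h.moment a)
  -- If `z a > ε` almost surely, the Laplace transform is at most `e^{-uε}`, so the exponent divided
  -- by `u` stays above `ε`. Without drift this quotient tends to `0` as `u → ∞`, a contradiction.
  have hkey : ∀ u : ℝ≥0, 0 < u → (ε : ℝ) ≤ ∫ y, (1 - Real.exp (-((u : ℝ) * y a))) / u ∂ν := by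
    intro u hu
    have hu' : (0 : ℝ) < u := hu
    have h1 : ∫ z, Real.exp (-((u : ℝ) * z a)) ∂μ ≤ Real.exp (-(u * ε)) := by
      have hi : Integrable (fun z : E → ℝ≥0 => Real.exp (-((u : ℝ) * z a))) μ := by
        simpa using integrable_exp_neg_sum (fun _ : Fin 1 => a) (fun _ => u) μ
      calc _ ≤ ∫ z, Real.exp (-((u : ℝ) * ε)) ∂μ := by
            refine integral_mono_ae hi (integrable_const _) ?_
            filter_upwards [hlow] with z hz
            have hz' : (ε : ℝ) < z a := hz
            gcongr
        _ = _ := by simp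
    rw [h.laplace_eval, Real.exp_le_exp, neg_le_neg_iff] at h1
    rw [integral_div, le_div_iff₀ hu', mul_comm]
    exact h1
  have hlim : Tendsto (fun n : ℕ => ∫ y, (1 - Real.exp (-(((n + 1 : ℝ≥0) : ℝ) * y a)))
      / ((n + 1 : ℝ≥0) : ℝ) ∂ν) atTop (𝓝 (∫ _, (0 : ℝ) ∂ν)) := by
    refine tendsto_integral_of_dominated_convergence (fun y => (y a : ℝ))
      (fun n => Measurable.aestronglyMeasurable (by fun_prop)) hi
      (fun n => Eventually.of_forall fun y => ?_) (Eventually.of_forall fun y => ?_)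
    · have hu : (0 : ℝ) < ((n + 1 : ℝ≥0) : ℝ) := by positivity
      rw [Real.norm_eq_abs, abs_of_nonneg (div_nonneg (one_sub_exp_neg_nonneg (by positivity)) hu.le),
        div_le_iff₀ hu, mul_comm]
      exact one_sub_exp_neg_le _
    · have hup : Tendsto (fun n : ℕ => (1 : ℝ) / ((n : ℝ) + 1)) atTop (𝓝 0) :=
        tendsto_one_div_add_atTop_nhds_zero_nat
      refine squeeze_zero (fun n => div_nonneg (one_sub_exp_neg_nonneg (by positivity))
        (by positivity)) (fun n => ?_) hup
      push_cast
      gcongr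
      have := Real.exp_nonneg (-(((n : ℝ) + 1) * y a))
      linarith
  have h2 := ge_of_tendsto' hlim fun n => hkey (n + 1) (by positivity)
  simp only [integral_zero] at h2
  have h3 : (0 : ℝ) < ε := hε
  linarith

end HasLevyLaplace

end Paths

end

noncomputable section

/-! ### Conditioning on a vanishing coordinate -/

section Conditioning

variable {E : Type*}

/-- For uncountable `E` the singleton `{0}` is not measurable, so the argument compares Laplace
transforms, each of which sees finitely many coordinates. -/
theorem eq_dirac_zero_of_lintegral_eval_eq_zero {μ : Measure (E → ℝ≥0)} [IsProbabilityMeasure μ]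
    (h : ∀ x, ∫⁻ z, z x ∂μ = 0) : μ = Measure.dirac 0 := by
  refine ext_of_laplace fun n x α => ?_
  rw [integral_dirac' _ _ (measurable_exp_neg_sum x α).stronglyMeasurable]
  have h1 : ∀ᵐ z ∂μ, ∀ i, z (x i) = 0 := by
    refine ae_all_iff.2 fun i => ?_
    have h2 := (lintegral_eq_zero_iff (by fun_prop)).1 (h (x i))
    filter_upwards [h2] with z hz
    simpa using hz
  rw [integral_congr_ae (g := fun _ => (1 : ℝ))]
  · simp
  · filter_upwards [h1] with z hz
    simp [hz]

/-- Adding a path that vanishes at `a` does not change the coordinate `a`, so the constraint falls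
on the `R`-component alone. -/
theorem restrict_conv_eq {Q R : Measure (E → ℝ≥0)} [SFinite Q] [SFinite R] {a : E}
    (hQ : ∀ᵐ y ∂Q, y a = 0) (ε : ℝ≥0) :
    (Q.conv R).restrict {y | y a ≤ ε} = Q.conv (R.restrict {y | y a ≤ ε}) := by
  have hS : MeasurableSet {z : E → ℝ≥0 | z a ≤ ε} :=
    measurableSet_le (measurable_pi_apply a) measurable_const
  rw [Measure.conv, Measure.restrict_map measurable_add hS, Measure.conv]
  congr 1
  have h1 : Q.prod (R.restrict {y | y a ≤ ε}) = (Q.prod R).restrict (univ ×ˢ {y | y a ≤ ε}) := by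
    rw [← Measure.prod_restrict, Measure.restrict_univ]
  rw [h1]
  refine Measure.restrict_congr_set ?_
  have h2 : ∀ᵐ p ∂Q.prod R, p.1 a = 0 := Measure.quasiMeasurePreserving_fst.ae hQ
  filter_upwards [h2] with p hp
  refine propext ?_
  change p.1 a + p.2 a ≤ ε ↔ p.1 ∈ univ ∧ p.2 a ≤ ε
  simp [hp]

theorem measure_conv_eval_le {Q R : Measure (E → ℝ≥0)} [IsProbabilityMeasure Q]
    [IsProbabilityMeasure R] {a : E} (hQ : ∀ᵐ y ∂Q, y a = 0) (ε : ℝ≥0) :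
    (Q.conv R) {y | y a ≤ ε} = R {y | y a ≤ ε} := by
  rw [← Measure.restrict_apply_univ, restrict_conv_eq hQ, Measure.conv,
    Measure.map_apply measurable_add MeasurableSet.univ, preimage_univ, ← univ_prod_univ,
    Measure.prod_prod]
  simp

theorem cond_conv_eq {Q R : Measure (E → ℝ≥0)} [IsProbabilityMeasure Q] [IsProbabilityMeasure R]
    {a : E} (hQ : ∀ᵐ y ∂Q, y a = 0) (ε : ℝ≥0) :
    ProbabilityTheory.cond (Q.conv R) {y | y a ≤ ε}
      = Q.conv (ProbabilityTheory.cond R {y | y a ≤ ε}) := by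
  rw [ProbabilityTheory.cond, ProbabilityTheory.cond, measure_conv_eval_le hQ,
    restrict_conv_eq hQ, Measure.conv_smul_right]

/-- Convergence to the zero path from convergence of means. Near `0` use continuity of `g`; away
from `0` bound its oscillation by a multiple of the sum of coordinates, as in Markov's inequality.
-/
theorem tendsto_integral_of_tendsto_lintegral_eval {ι : Type*} {l : Filter ι}
    {R : ι → Measure (E → ℝ≥0)} (hR : ∀ᶠ i in l, IsProbabilityMeasure (R i))
    (h : ∀ x, Tendsto (fun i => ∫⁻ z, z x ∂(R i)) l (𝓝 0)) (I : Finset E)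
    (g : BoundedContinuousFunction (I → ℝ≥0) ℝ) :
    Tendsto (fun i => ∫ z, g (I.restrict z) ∂(R i)) l (𝓝 (g 0)) := by
  rw [Metric.tendsto_nhds]
  intro η hη
  obtain ⟨δ, hδ, hδg⟩ := Metric.continuousAt_iff.1 (g.continuous.continuousAt (x := 0)) (η / 2)
    (half_pos hη)
  -- Outside the `δ`-ball some coordinate is at least `δ`, so `C` times the coordinate sum dominates
  -- the maximal oscillation `2‖g‖`.
  set C : ℝ := 2 * ‖g‖ / δ with hC
  have hC0 : 0 ≤ C := by positivity
  have hbound : ∀ z : E → ℝ≥0, |g (I.restrict z) - g 0| ≤ η / 2 + C * ∑ x ∈ I, (z x : ℝ) := by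
    intro z
    have hs0 : 0 ≤ ∑ x ∈ I, (z x : ℝ) := Finset.sum_nonneg fun x _ => by positivity
    by_cases hz : dist (I.restrict z) 0 < δ
    · have := hδg hz
      rw [Real.dist_eq] at this
      have h3 : 0 ≤ C * ∑ x ∈ I, (z x : ℝ) := by positivity
      linarith
    · rw [dist_pi_lt_iff hδ] at hz
      push Not at hz
      obtain ⟨x, hx⟩ := hz
      have h4 : δ ≤ ∑ x ∈ I, (z x : ℝ) := by
        refine hx.trans ?_
        have h5 : dist (I.restrict z x) ((0 : I → ℝ≥0) x) = (z x : ℝ) := by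
          simp [NNReal.dist_eq, Finset.restrict]
        rw [h5]
        exact Finset.single_le_sum (f := fun x => (z x : ℝ)) (fun x _ => by positivity) x.2
      have h6 : 2 * ‖g‖ ≤ C * ∑ x ∈ I, (z x : ℝ) := by
        calc 2 * ‖g‖ = C * δ := by rw [hC]; field_simp
          _ ≤ _ := by gcongr
      have h7 : |g (I.restrict z) - g 0| ≤ 2 * ‖g‖ := by
        rw [← Real.dist_eq]; exact g.dist_le_two_norm _ _
      linarith [half_pos hη]
  have hsum : Tendsto (fun i => ∑ x ∈ I, ∫⁻ z, z x ∂(R i)) l (𝓝 0) := by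
    simpa using tendsto_finsetSum I fun x _ => h x
  -- Dividing by `C + 1` rather than `C` allows `C = 0` and makes the final inequality strict.
  have hev : ∀ᶠ i in l, ∑ x ∈ I, ∫⁻ z, z x ∂(R i) < ENNReal.ofReal (η / 2 / (C + 1)) :=
    hsum.eventually_lt_const (by simpa using (by positivity : 0 < η / 2 / (C + 1)))
  filter_upwards [hR, hev] with i hRi hi
  have hfin : ∀ x ∈ I, ∫⁻ z, z x ∂(R i) < ∞ :=
    ENNReal.sum_lt_top.1 (hi.trans ENNReal.ofReal_lt_top)
  have hint : ∀ x ∈ I, Integrable (fun z : E → ℝ≥0 => (z x : ℝ)) (R i) := fun x hx =>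
    integrable_coe_of_lintegral_lt_top (measurable_pi_apply x) (hfin x hx)
  have hgm : Measurable fun z : E → ℝ≥0 => g (I.restrict z) :=
    g.continuous.measurable.comp (Finset.measurable_restrict I)
  have hgi : Integrable (fun z : E → ℝ≥0 => g (I.restrict z)) (R i) :=
    Integrable.of_bound hgm.aestronglyMeasurable ‖g‖
      (Eventually.of_forall fun z => g.norm_coe_le_norm _)
  have hreal : ∑ x ∈ I, ∫ z, (z x : ℝ) ∂(R i) < η / 2 / (C + 1) := by
    have h8 : ∀ x ∈ I, ∫ z, (z x : ℝ) ∂(R i) = (∫⁻ z, z x ∂(R i)).toReal := fun x hx => by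
      rw [integral_eq_lintegral_of_nonneg_ae (Eventually.of_forall fun z => by positivity)
        (by exact (hint x hx).1)]
      simp
    rw [Finset.sum_congr rfl h8, ← ENNReal.toReal_sum fun x hx => (hfin x hx).ne]
    refine (ENNReal.lt_ofReal_iff_toReal_lt (hi.trans ENNReal.ofReal_lt_top).ne).1 hi
  rw [Real.dist_eq]
  have h9 : (∫ z, g (I.restrict z) ∂(R i)) - g 0 = ∫ z, (g (I.restrict z) - g 0) ∂(R i) := by
    rw [integral_sub hgi (integrable_const _)]; simp
  rw [h9]
  calc |∫ z, (g (I.restrict z) - g 0) ∂(R i)| ≤ ∫ z, |g (I.restrict z) - g 0| ∂(R i) :=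
        abs_integral_le_integral_abs
    _ ≤ ∫ z, (η / 2 + C * ∑ x ∈ I, (z x : ℝ)) ∂(R i) :=
        integral_mono (hgi.sub (integrable_const _)).abs
          ((integrable_const _).add ((integrable_finsetSum I hint).const_mul C)) hbound
    _ = η / 2 + C * ∑ x ∈ I, ∫ z, (z x : ℝ) ∂(R i) := by
        rw [integral_add (integrable_const _) ((integrable_finsetSum I hint).const_mul C),
          integral_const_mul, integral_finsetSum I hint]
        simp
    _ < η := by
        have h10 : C * (η / 2 / (C + 1)) < η / 2 := by
          rw [← mul_div_assoc, div_lt_iff₀ (by positivity)]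
          nlinarith
        have h11 : C * ∑ x ∈ I, ∫ z, (z x : ℝ) ∂(R i) ≤ C * (η / 2 / (C + 1)) := by gcongr
        linarith

/-- If the law of a process is `Q ∗ R` with `Q` carried by paths vanishing at `a` and `R` infinitely
divisible with a Lévy measure carried by paths not vanishing at `a`, then `Q` is the law of the
process conditioned to vanish at `a`. -/
theorem isCondLawAtZero_conv {Q R ν : Measure (E → ℝ≥0)} [IsProbabilityMeasure Q]
    [IsProbabilityMeasure R] (hR : HasLevyLaplace ν R) {a : E} (hQ : ∀ᵐ y ∂Q, y a = 0)
    (hν : ∀ x, ∫⁻ y in {y | y a = 0}, y x ∂ν = 0) : IsCondLawAtZero (Q.conv R) a Q := by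
  have hS : ∀ ε : ℝ≥0, MeasurableSet {z : E → ℝ≥0 | z a ≤ ε} := fun ε =>
    measurableSet_le (measurable_pi_apply a) measurable_const
  have hcond : ∀ (x : E) (ε : ℝ≥0), R {z | z a ≤ ε} ≠ 0 →
      ∫⁻ z, z x ∂(ProbabilityTheory.cond R {y | y a ≤ ε}) ≤ ∫⁻ y in {y | y a ≤ ε}, y x ∂ν := by
    intro x ε hε
    rw [ProbabilityTheory.cond, lintegral_smul_measure, smul_eq_mul]
    calc _ ≤ (R {z | z a ≤ ε})⁻¹ * (R {z | z a ≤ ε} * ∫⁻ y in {y | y a ≤ ε}, y x ∂ν) := by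
          gcongr; exact hR.setLIntegral_eval_le a x ε
      _ = _ := by
          rw [← mul_assoc, ENNReal.inv_mul_cancel hε (measure_ne_top _ _), one_mul]
  refine ⟨fun h0 => ?_, fun ε hε => ?_, fun I g => ?_⟩
  -- The elementary case is `ε = 0` of the same estimate: all conditional means vanish, so the
  -- conditioned `R` is the point mass at the zero path.
  · have h1 : {y : E → ℝ≥0 | y a = 0} = {y | y a ≤ 0} := by ext; simp
    rw [h1] at h0 ⊢
    rw [measure_conv_eval_le hQ] at h0
    have : IsProbabilityMeasure (ProbabilityTheory.cond R {y | y a ≤ 0}) :=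
      cond_isProbabilityMeasure h0
    have h2 : ProbabilityTheory.cond R {y | y a ≤ 0} = Measure.dirac 0 := by
      refine eq_dirac_zero_of_lintegral_eval_eq_zero fun x => ?_
      have h3 := hcond x 0 h0
      rw [← h1, hν x] at h3
      rw [← h1]
      exact le_antisymm h3 bot_le
    rw [cond_conv_eq hQ, h2, Measure.conv_dirac_zero]
  · rw [measure_conv_eval_le hQ]
    exact hR.measure_eval_le_ne_zero a hε
  · have hprob : ∀ᶠ ε : ℝ≥0 in 𝓝[>] 0,
        IsProbabilityMeasure (ProbabilityTheory.cond R {y | y a ≤ ε}) := by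
      filter_upwards [self_mem_nhdsWithin] with ε hε
      exact cond_isProbabilityMeasure (hR.measure_eval_le_ne_zero a hε)
    have hlim : ∀ x, Tendsto (fun ε : ℝ≥0 =>
        ∫⁻ z, z x ∂(ProbabilityTheory.cond R {y | y a ≤ ε})) (𝓝[>] 0) (𝓝 0) := by
      intro x
      have h1 : Tendsto (fun ε : ℝ≥0 => ∫⁻ y in {y | y a ≤ ε}, y x ∂ν) (𝓝[>] 0) (𝓝 0) := by
        -- Continuity from above of the finite measure `y x ν(dy)` along the events `{y a ≤ ε}`,
        -- which decrease to `{y a = 0}`.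
        have h2 := tendsto_measure_biInter_gt (μ := ν.withDensity fun y => (y x : ℝ≥0∞))
          (s := fun ε : ℝ≥0 => {y : E → ℝ≥0 | y a ≤ ε}) (a := 0)
          (fun ε _ => (hS ε).nullMeasurableSet) (fun i j _ hij y hy => le_trans hy hij)
          ⟨1, one_pos, by
            rw [withDensity_apply _ (hS 1)]
            exact ((setLIntegral_le_lintegral _ _).trans_lt (hR.moment x)).ne⟩
        have h3 : ⋂ r : ℝ≥0, ⋂ (_ : r > 0), {y : E → ℝ≥0 | y a ≤ r} = {y | y a = 0} := by
          ext y
          simp only [mem_iInter, mem_ofPred_eq]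
          refine ⟨fun hy => ?_, fun hy r _ => by simp [hy]⟩
          exact le_antisymm (le_of_forall_gt_imp_ge_of_dense hy) bot_le
        have hS0 : MeasurableSet {y : E → ℝ≥0 | y a = 0} := by
          have := hS 0
          simpa using this
        rw [h3, withDensity_apply _ hS0, hν x] at h2
        refine h2.congr fun ε => ?_
        simp only [Function.comp_apply]
        rw [withDensity_apply _ (hS ε)]
      refine tendsto_of_tendsto_of_tendsto_of_le_of_le' tendsto_const_nhds h1
        (Eventually.of_forall fun _ => bot_le) ?_
      filter_upwards [self_mem_nhdsWithin] with ε hε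
      exact hcond x ε (hR.measure_eval_le_ne_zero a hε)
    have hrm : Measurable (I.restrict (π := fun _ : E => ℝ≥0)) := Finset.measurable_restrict I
    have hcont : Continuous fun z : I → ℝ≥0 => ∫ y, g (I.restrict y + z) ∂Q := by
      refine continuous_of_dominated (bound := fun _ => ‖g‖) (fun z => ?_) (fun z => ?_)
        (integrable_const _) (Eventually.of_forall fun y => by fun_prop)
      · exact (g.continuous.measurable.comp (hrm.add_const z)).aestronglyMeasurable
      · exact Eventually.of_forall fun y => g.norm_coe_le_norm _
    -- Averaging `g` over the `Q`-component leaves a bounded continuous function of the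
    -- `R`-component, whose value at `0` is the claimed limit.
    let h : BoundedContinuousFunction (I → ℝ≥0) ℝ :=
      BoundedContinuousFunction.ofNormedAddCommGroup
        (fun z : I → ℝ≥0 => ∫ y, g (I.restrict y + z) ∂Q) hcont ‖g‖ (fun z => by
          refine (norm_integral_le_of_norm_le_const (C := ‖g‖)
            (Eventually.of_forall fun y => g.norm_coe_le_norm _)).trans ?_
          simp)
    have hfin := tendsto_integral_of_tendsto_lintegral_eval hprob hlim I h
    have h0 : h 0 = ∫ y, g (I.restrict y) ∂Q := by
      change ∫ y, g (I.restrict y + 0) ∂Q = _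
      simp
    rw [h0] at hfin
    refine hfin.congr' ?_
    filter_upwards [hprob] with ε hε
    have hgm : Measurable fun y : E → ℝ≥0 => g (I.restrict y) := g.continuous.measurable.comp hrm
    rw [cond_conv_eq hQ, Measure.conv, integral_map measurable_add.aemeasurable
      hgm.aestronglyMeasurable, integral_prod_symm]
    · rfl
    · refine Integrable.of_bound (Measurable.aestronglyMeasurable ?_) ‖g‖
        (Eventually.of_forall fun y => g.norm_coe_le_norm _)
      exact hgm.comp measurable_add

theorem IsCondLawAtZero.unique {μ Q Q' : Measure (E → ℝ≥0)} [IsFiniteMeasure Q]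
    [IsFiniteMeasure Q'] {a : E} (h : IsCondLawAtZero μ a Q) (h' : IsCondLawAtZero μ a Q') :
    Q = Q' := by
  refine ext_of_map_restrict fun I => ext_of_forall_integral_eq_of_IsFiniteMeasure fun g => ?_
  have hrm : Measurable (I.restrict (π := fun _ : E => ℝ≥0)) := Finset.measurable_restrict I
  rw [integral_map hrm.aemeasurable g.continuous.aestronglyMeasurable,
    integral_map hrm.aemeasurable g.continuous.aestronglyMeasurable]
  exact tendsto_nhds_unique (h.limit I g) (h'.limit I g)

/-- Convolution with an infinitely divisible law is injective. -/
theorem HasLevyLaplace.conv_right_cancel {ν Q R R' : Measure (E → ℝ≥0)} [IsFiniteMeasure Q]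
    [IsFiniteMeasure R] [IsFiniteMeasure R'] (hQ : HasLevyLaplace ν Q)
    (h : Q.conv R = Q.conv R') : R = R' := by
  refine ext_of_laplace fun n x α => ?_
  have h1 := laplace_conv x α Q R
  rw [h, laplace_conv, hQ.laplace] at h1
  exact (mul_left_cancel₀ (Real.exp_ne_zero _) h1).symm

end Conditioning

end

noncomputable section

/-! ### Uniqueness of the Lévy measure of a process -/

section Uniqueness

variable {E : Type*}

/-- A measurable set of paths depends on countably many coordinates only. -/
theorem exists_countable_dependsOn {B : Set (E → ℝ≥0)} (hB : MeasurableSet B) :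
    ∃ J : Set E, J.Countable ∧ ∀ y z : E → ℝ≥0, (∀ x ∈ J, y x = z x) → (y ∈ B ↔ z ∈ B) := by
  rw [← generateFrom_measurableCylinders] at hB
  induction hB with
  | basic B hB =>
    obtain ⟨I, S, hS, rfl⟩ := (mem_measurableCylinders _).1 hB
    refine ⟨I, I.countable_toSet, fun y z hyz => ?_⟩
    have : I.restrict y = I.restrict z := by
      ext x
      simp [Finset.restrict, hyz x x.2]
    simp [mem_cylinder, this]
  | empty => exact ⟨∅, countable_empty, by simp⟩
  | compl B _ ih =>
    obtain ⟨J, hJ, h⟩ := ih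
    exact ⟨J, hJ, fun y z hyz => not_congr (h y z hyz)⟩
  | iUnion B _ ih =>
    choose J hJ h using ih
    refine ⟨⋃ n, J n, countable_iUnion hJ, fun y z hyz => ?_⟩
    simp only [mem_iUnion]
    exact exists_congr fun n => h n y z fun x hx => hyz x (mem_iUnion.2 ⟨n, hx⟩)

theorem measurableSet_eval_ne_zero (x : E) : MeasurableSet {y : E → ℝ≥0 | y x ≠ 0} :=
  measurableSet_eq_fun (measurable_pi_apply x) measurable_const |>.compl

/-- The coefficient `α i + 1` is at least `1` even when `α i = 0`, so a single coordinate above `1`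
already makes the right side exceed `1`. This gives integrability from truncated moments only. -/
theorem one_sub_exp_neg_sum_le {n : ℕ} (x : Fin n → E) (α : Fin n → ℝ≥0) (y : E → ℝ≥0) :
    1 - Real.exp (-∑ i, (α i : ℝ) * y (x i))
      ≤ ((∑ i, (α i + 1) * min (y (x i)) 1 : ℝ≥0) : ℝ) := by
  by_cases h : ∀ i, y (x i) ≤ 1
  · refine (one_sub_exp_neg_le _).trans ?_
    rw [← coe_sum_mul_eval, NNReal.coe_le_coe]
    refine Finset.sum_le_sum fun i _ => ?_
    rw [min_eq_left (h i)]
    gcongr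
    exact le_self_add
  · push Not at h
    obtain ⟨i, hi⟩ := h
    have h1 : (1 : ℝ≥0) ≤ ∑ i, (α i + 1) * min (y (x i)) 1 := by
      refine le_trans ?_ (Finset.single_le_sum (f := fun i => (α i + 1) * min (y (x i)) 1)
        (fun _ _ => bot_le) (Finset.mem_univ i))
      rw [min_eq_right hi.le, mul_one]
      exact le_add_self
    have h2 : (1 : ℝ) ≤ ((∑ i, (α i + 1) * min (y (x i)) 1 : ℝ≥0) : ℝ) := by exact_mod_cast h1
    have := Real.exp_nonneg (-∑ i, (α i : ℝ) * y (x i))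
    linarith

namespace IsProcessLevyMeasure

variable {ν ν' μ : Measure (E → ℝ≥0)}

theorem integrable_one_sub_exp_neg_sum (h : IsProcessLevyMeasure ν μ) {n : ℕ} (x : Fin n → E)
    (α : Fin n → ℝ≥0) :
    Integrable (fun y => 1 - Real.exp (-∑ i, (α i : ℝ) * y (x i))) ν := by
  have hm : Measurable fun y : E → ℝ≥0 => ∑ i, (α i + 1) * min (y (x i)) 1 := by fun_prop
  have hi := integrable_coe_of_lintegral_lt_top (m := ν) hm (by
    simp_rw [ENNReal.ofNNReal_finsetSum, ENNReal.coe_mul]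
    rw [lintegral_finsetSum _ fun i _ => by fun_prop]
    refine ENNReal.sum_lt_top.2 fun i _ => ?_
    rw [lintegral_const_mul _ (by fun_prop)]
    exact ENNReal.mul_lt_top ENNReal.coe_lt_top (h.finite _))
  refine hi.mono' ((measurable_exp_neg_sum x α).const_sub 1).aestronglyMeasurable
    (Eventually.of_forall fun y => ?_)
  have h0 : 0 ≤ 1 - Real.exp (-∑ i, (α i : ℝ) * y (x i)) := by
    linarith [exp_neg_sum_le_one x α y]
  rw [Real.norm_eq_abs, abs_of_nonneg h0]
  exact one_sub_exp_neg_sum_le x α y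

theorem integrable_one_sub_exp_neg_eval (h : IsProcessLevyMeasure ν μ) (x : E) :
    Integrable (fun y : E → ℝ≥0 => 1 - Real.exp (-(y x : ℝ))) ν := by
  simpa using h.integrable_one_sub_exp_neg_sum (fun _ : Fin 1 => x) (fun _ => 1)

/-- The Laplace transform of `(1 - e^{-y x}) ν(dy)` as a difference of Laplace exponents. -/
theorem integral_exp_mul_one_sub_exp (h : IsProcessLevyMeasure ν μ) (x : E) {n : ℕ}
    (t : Fin n → E) (α : Fin n → ℝ≥0) :
    ∫ y, (1 - Real.exp (-(y x : ℝ))) * Real.exp (-∑ i, (α i : ℝ) * y (t i)) ∂ν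
      = Real.log (∫ y, Real.exp (-∑ i, (α i : ℝ) * y (t i)) ∂μ)
        - Real.log (∫ y, Real.exp (-∑ i, ((Fin.cons 1 α : Fin (n + 1) → ℝ≥0) i : ℝ) *
            y ((Fin.cons x t : Fin (n + 1) → E) i)) ∂μ) := by
  rw [h.laplace, h.laplace, Real.log_exp, Real.log_exp, neg_sub_neg,
    ← integral_sub (h.integrable_one_sub_exp_neg_sum _ _) (h.integrable_one_sub_exp_neg_sum _ _)]
  refine integral_congr_ae (Eventually.of_forall fun y => ?_)
  simp only [Fin.sum_univ_succ, Fin.cons_zero, Fin.cons_succ, neg_add, Real.exp_add,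
    NNReal.coe_one, one_mul]
  ring

/-- The weight `1 - e^{-y x}` makes a Lévy measure finite, and the Laplace transform of the result
is a difference of Laplace exponents, which depend on `μ` only. -/
theorem withDensity_eq (h : IsProcessLevyMeasure ν μ) (h' : IsProcessLevyMeasure ν' μ) (x : E) :
    ν.withDensity (fun y => ((1 - Real.exp (-(y x : ℝ))).toNNReal : ℝ≥0∞))
      = ν'.withDensity fun y => ((1 - Real.exp (-(y x : ℝ))).toNNReal : ℝ≥0∞) := by
  have : IsFiniteMeasure (ν.withDensity
      (fun y => ((1 - Real.exp (-(y x : ℝ))).toNNReal : ℝ≥0∞))) :=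
    isFiniteMeasure_withDensity_ofReal (h.integrable_one_sub_exp_neg_eval x).2
  have : IsFiniteMeasure (ν'.withDensity
      (fun y => ((1 - Real.exp (-(y x : ℝ))).toNNReal : ℝ≥0∞))) :=
    isFiniteMeasure_withDensity_ofReal (h'.integrable_one_sub_exp_neg_eval x).2
  refine ext_of_laplace fun n t α => ?_
  have hm : Measurable fun y : E → ℝ≥0 => (1 - Real.exp (-(y x : ℝ))).toNNReal := by fun_prop
  rw [integral_withDensity_eq_integral_smul hm, integral_withDensity_eq_integral_smul hm]
  have hc : ∀ y : E → ℝ≥0, (((1 - Real.exp (-(y x : ℝ))).toNNReal : ℝ≥0) : ℝ)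
      = 1 - Real.exp (-(y x : ℝ)) := fun y =>
    Real.coe_toNNReal _ (one_sub_exp_neg_nonneg (y x).coe_nonneg)
  simp only [NNReal.smul_def, smul_eq_mul, hc]
  rw [h.integral_exp_mul_one_sub_exp, h'.integral_exp_mul_one_sub_exp]

/-- The weight is positive exactly where `y x ≠ 0`, so there it can be divided out. -/
theorem restrict_eval_ne_zero_eq (h : IsProcessLevyMeasure ν μ) (h' : IsProcessLevyMeasure ν' μ)
    (x : E) : ν.restrict {y | y x ≠ 0} = ν'.restrict {y | y x ≠ 0} := by
  have hS := measurableSet_eval_ne_zero x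
  have hd : Measurable fun y : E → ℝ≥0 =>
    ((1 - Real.exp (-(y x : ℝ))).toNNReal : ℝ≥0∞) := by fun_prop
  have key : ∀ m : Measure (E → ℝ≥0), ∀ A, MeasurableSet A → m.restrict {y | y x ≠ 0} A =
      ∫⁻ y in A ∩ {y | y x ≠ 0}, ((1 - Real.exp (-(y x : ℝ))).toNNReal : ℝ≥0∞)⁻¹
        ∂(m.withDensity fun y => ((1 - Real.exp (-(y x : ℝ))).toNNReal : ℝ≥0∞)) := by
    intro m A hA
    have hd' : Measurable fun y : E → ℝ≥0 =>
      ((1 - Real.exp (-(y x : ℝ))).toNNReal : ℝ≥0∞)⁻¹ := hd.inv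
    rw [setLIntegral_withDensity_eq_setLIntegral_mul m hd hd' (hA.inter hS),
      Measure.restrict_apply hA, ← setLIntegral_one]
    refine setLIntegral_congr_fun (hA.inter hS) fun y hy => ?_
    have hy0 : 0 < (y x : ℝ) := by
      have : y x ≠ 0 := hy.2
      exact_mod_cast pos_iff_ne_zero.2 this
    refine (ENNReal.mul_inv_cancel ?_ ENNReal.coe_ne_top).symm
    have : Real.exp (-(y x : ℝ)) < 1 := by simpa using hy0
    simpa using this
  refine Measure.ext fun A hA => ?_
  rw [key ν A hA, key ν' A hA, h.withDensity_eq h' x]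

/-- The Lévy measure of a process is unique. -/
theorem unique (h : IsProcessLevyMeasure ν μ) (h' : IsProcessLevyMeasure ν' μ) : ν = ν' := by
  refine Measure.ext fun A hA => ?_
  rw [h.inner A hA, h'.inner A hA]
  refine iSup_congr fun B => iSup_congr fun hB => iSup_congr fun hBA => ?_
  obtain ⟨J, hJ, hdep⟩ := exists_countable_dependsOn hB
  -- A path vanishing on `J` is indistinguishable from `0` for `B`, and `0 ∉ B`. Hence `B` is
  -- covered by countably many events on which the two measures already agree.
  have hsub : B ⊆ ⋃ x ∈ J, {y | y x ≠ 0} := by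
    intro y hy
    by_contra hcon
    simp only [mem_iUnion, mem_ofPred_eq, not_exists, not_not] at hcon
    exact (hBA ((hdep y 0 fun x hx => hcon x hx).1 hy)).2 rfl
  have hrestr := (Measure.restrict_biUnion_congr (μ := ν) (ν := ν')
    (s := J) (t := fun x : E => {y : E → ℝ≥0 | y x ≠ 0}) hJ).2
    fun x _ => h.restrict_eval_ne_zero_eq h' x
  rw [← inter_eq_left.2 hsub, ← Measure.restrict_apply hB, ← Measure.restrict_apply hB, hrestr]

end IsProcessLevyMeasure

/-- A measure with the Laplace functional property that is carried by paths which do not vanish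
identically on a fixed countable set is the Lévy measure. -/
theorem HasLevyLaplace.isProcessLevyMeasure {ν μ : Measure (E → ℝ≥0)} (h : HasLevyLaplace ν μ)
    {J : Set E} (hJ : J.Countable) (hν : ∀ᵐ y ∂ν, ∃ x ∈ J, y x ≠ 0) :
    IsProcessLevyMeasure ν μ := by
  refine ⟨fun x => lt_of_le_of_lt (lintegral_mono fun y => ?_) (h.moment x), h.laplace,
    fun A hA => le_antisymm ?_ ?_⟩
  · exact ENNReal.coe_le_coe.2 (min_le_left _ _)
  · have hS : MeasurableSet {y : E → ℝ≥0 | ∃ x ∈ J, y x ≠ 0} := by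
      have h1 : {y : E → ℝ≥0 | ∃ x ∈ J, y x ≠ 0} = ⋃ x ∈ J, {y | y x ≠ 0} := by ext; simp
      rw [h1]
      exact MeasurableSet.biUnion hJ fun x _ => measurableSet_eval_ne_zero x
    -- Removing the paths that vanish on `J` costs no mass and leaves a measurable set that excludes
    -- the zero path.
    refine le_trans (le_of_eq ?_) (le_iSup₂_of_le (A ∩ {y | ∃ x ∈ J, y x ≠ 0}) (hA.inter hS)
      (le_iSup_of_le ?_ le_rfl))
    · refine measure_congr ?_
      filter_upwards [hν] with y hy
      refine propext ⟨fun h => ⟨h, hy⟩, fun h => h.1⟩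
    · rintro y ⟨hyA, x, _, hx⟩
      exact ⟨hyA, fun h0 => hx (by rw [mem_singleton_iff.1 h0]; rfl)⟩
  · exact iSup₂_le fun B _ => iSup_le fun hBA => measure_mono fun y hy => (hBA hy).1

end Uniqueness

end

noncomputable section

/-! ### One-dimensional laws of a subordinator -/

/-- A monotone additive function on `[0, ∞)` is linear. -/
theorem eq_mul_of_monotone_of_add {c : ℝ≥0 → ℝ} (hmono : Monotone c)
    (hadd : ∀ s t, c (s + t) = c s + c t) (t : ℝ≥0) : c t = t * c 1 := by
  have h0 : c 0 = 0 := by simpa using hadd 0 0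
  have hnat : ∀ (n : ℕ) (s : ℝ≥0), c (n * s) = n * c s := by
    intro n s
    induction n with
    | zero => simp [h0]
    | succ n ih => push_cast; rw [add_mul, one_mul, hadd, ih]; ring
  have hc1 : 0 ≤ c 1 := by rw [← h0]; exact hmono bot_le
  have hnat1 : ∀ n : ℕ, c n = n * c 1 := fun n => by simpa using hnat n 1
  -- With `k = ⌊(n + 1) t⌋`, both `c ((n + 1) t)` and `(n + 1) t * c 1` lie between `k * c 1` and
  -- `(k + 1) * c 1`. Monotonicity thus replaces continuity.
  have hbound : ∀ n : ℕ, |((n : ℝ) + 1) * (c t - t * c 1)| ≤ c 1 := by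
    intro n
    have hlo := hmono (Nat.floor_le (a := ((n + 1 : ℕ) : ℝ≥0) * t) bot_le)
    have hhi := hmono (Nat.lt_floor_add_one (((n + 1 : ℕ) : ℝ≥0) * t)).le
    rw [hadd, hnat, hnat1] at hhi
    rw [hnat, hnat1] at hlo
    set k := ⌊((n + 1 : ℕ) : ℝ≥0) * t⌋₊
    have h1 : (k : ℝ) ≤ ((n : ℝ) + 1) * t := by
      have := Nat.floor_le (a := ((n + 1 : ℕ) : ℝ≥0) * t) bot_le
      exact_mod_cast this
    have h2 : ((n : ℝ) + 1) * t ≤ k + 1 := by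
      have := (Nat.lt_floor_add_one (((n + 1 : ℕ) : ℝ≥0) * t)).le
      exact_mod_cast this
    push_cast at hlo hhi
    rw [abs_le]
    constructor <;> nlinarith
  have hlim : Tendsto (fun n : ℕ => c 1 / ((n : ℝ) + 1)) atTop (𝓝 0) :=
    tendsto_const_nhds.div_atTop (tendsto_atTop_add_const_right _ _ tendsto_natCast_atTop_atTop)
  have : |c t - t * c 1| ≤ 0 := by
    refine ge_of_tendsto' hlim fun n => ?_
    have hn : (0 : ℝ) < (n : ℝ) + 1 := by positivity
    have := hbound n
    rw [abs_mul, abs_of_pos hn] at this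
    rw [le_div_iff₀ hn, mul_comm]
    exact this
  have := abs_nonpos_iff.1 this
  linarith

/-- The Laplace exponent `u ↦ ∫ (1 - e^{-ux}) ρ(dx)`. -/
def laplaceExponent (ρ : Measure ℝ≥0) (u : ℝ≥0) : ℝ := ∫ x, (1 - Real.exp (-((u : ℝ) * x))) ∂ρ

theorem IsDriftlessLevyMeasure.integrable {ρ μ : Measure ℝ≥0} (h : IsDriftlessLevyMeasure ρ μ)
    (u : ℝ≥0) : Integrable (fun x : ℝ≥0 => 1 - Real.exp (-((u : ℝ) * x))) ρ := by
  have hi := integrable_coe_of_lintegral_lt_top (m := ρ) (w := fun x => min x 1) (by fun_prop)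
    h.finite
  refine (hi.const_mul ((u : ℝ) + 1)).mono' (Measurable.aestronglyMeasurable (by fun_prop))
    (Eventually.of_forall fun x => ?_)
  rw [Real.norm_eq_abs, abs_of_nonneg (one_sub_exp_neg_nonneg (by positivity))]
  rcases le_total x 1 with hx | hx
  · rw [min_eq_left hx]
    refine (one_sub_exp_neg_le _).trans ?_
    have := x.coe_nonneg
    nlinarith
  · rw [min_eq_right hx]
    have := Real.exp_nonneg (-((u : ℝ) * x))
    have := u.coe_nonneg
    push_cast
    linarith

theorem laplaceExponent_nonneg (ρ : Measure ℝ≥0) (u : ℝ≥0) : 0 ≤ laplaceExponent ρ u :=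
  integral_nonneg fun _ => one_sub_exp_neg_nonneg (by positivity)

namespace Subordinator

variable {Ω : Type*} [MeasurableSpace Ω] {P : Measure Ω}

theorem laplace_increment (Z : Subordinator P) (u s t : ℝ≥0) :
    ∫ ω, Real.exp (-((u : ℝ) * ((Z.val (s + t) ω : ℝ) - Z.val s ω))) ∂P
      = ∫ ω, Real.exp (-((u : ℝ) * Z.val t ω)) ∂P := by
  have h1 := Z.measurable_val t
  have h2 := Z.measurable_val s
  have h3 := Z.measurable_val (s + t)
  have h := congrArg (fun m : Measure ℝ => ∫ r, Real.exp (-((u : ℝ) * r)) ∂m) (Z.stationary s t)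
  rwa [integral_map (by fun_prop) (Measurable.aestronglyMeasurable (by fun_prop)),
    integral_map (by fun_prop) (Measurable.aestronglyMeasurable (by fun_prop))] at h

theorem laplace_add (Z : Subordinator P) (u s t : ℝ≥0) :
    ∫ ω, Real.exp (-((u : ℝ) * Z.val (s + t) ω)) ∂P
      = (∫ ω, Real.exp (-((u : ℝ) * Z.val s ω)) ∂P) *
        ∫ ω, Real.exp (-((u : ℝ) * Z.val t ω)) ∂P := by
  have h1 := Z.measurable_val s
  have h2 := Z.measurable_val (s + t)
  have hind := Z.indep.indepFun_eval_sub (r := 0) (s := s) (t := s + t) bot_le le_self_add (by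
    filter_upwards [Z.zero_ae] with ω hω
    simp [hω])
  rw [← Z.laplace_increment u s t]
  have h := hind.integral_fun_comp_mul_comp (f := fun r : ℝ => Real.exp (-((u : ℝ) * r)))
    (g := fun r : ℝ => Real.exp (-((u : ℝ) * r))) (by fun_prop)
    (Measurable.aemeasurable (by fun_prop)) (Measurable.aestronglyMeasurable (by fun_prop))
    (Measurable.aestronglyMeasurable (by fun_prop))
  simp only [Pi.sub_apply] at h
  rw [← h]
  refine integral_congr_ae (Eventually.of_forall fun ω => ?_)
  simp only
  rw [← Real.exp_add]
  congr 1
  ring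

variable [IsProbabilityMeasure P]

theorem integrable_exp_val (Z : Subordinator P) (u t : ℝ≥0) :
    Integrable (fun ω => Real.exp (-((u : ℝ) * Z.val t ω))) P := by
  have := Z.measurable_val t
  refine Integrable.of_bound (Measurable.aestronglyMeasurable (by fun_prop)) 1
    (Eventually.of_forall fun ω => ?_)
  rw [Real.norm_eq_abs, Real.abs_exp, Real.exp_le_one_iff, neg_nonpos]
  positivity

/-- For fixed `u`, minus the logarithm of the Laplace transform is additive in time by the
independent stationary increments and monotone because paths are nondecreasing, hence linear. -/
theorem laplace_val (Z : Subordinator P) {ρ : Measure ℝ≥0}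
    (hρ : IsDriftlessLevyMeasure ρ (P.map (Z.val 1))) (u t : ℝ≥0) :
    ∫ ω, Real.exp (-((u : ℝ) * Z.val t ω)) ∂P = Real.exp (-(t * laplaceExponent ρ u)) := by
  have hpos : ∀ s, 0 < ∫ ω, Real.exp (-((u : ℝ) * Z.val s ω)) ∂P := fun s =>
    integral_exp_pos (Z.integrable_exp_val u s)
  have hlin := eq_mul_of_monotone_of_add
    (c := fun s => -Real.log (∫ ω, Real.exp (-((u : ℝ) * Z.val s ω)) ∂P))
    (fun s r hsr => neg_le_neg (Real.log_le_log (hpos r)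
      (integral_mono (Z.integrable_exp_val u r) (Z.integrable_exp_val u s) fun ω => by
        have : Z.val s ω ≤ Z.val r ω := Z.mono ω hsr
        simp only
        gcongr)))
    (fun s r => by
      rw [Z.laplace_add, Real.log_mul (hpos s).ne' (hpos r).ne', neg_add]) t
  have h1 : ∫ ω, Real.exp (-((u : ℝ) * Z.val 1 ω)) ∂P = Real.exp (-laplaceExponent ρ u) := by
    have h2 := hρ.laplace u
    rwa [integral_map (Z.measurable_val 1).aemeasurable
      (Measurable.aestronglyMeasurable (by fun_prop))] at h2
  simp only [h1, Real.log_exp, neg_neg] at hlin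
  rw [← hlin, neg_neg, Real.exp_log (hpos t)]

theorem laplace_sub (Z : Subordinator P) {ρ : Measure ℝ≥0}
    (hρ : IsDriftlessLevyMeasure ρ (P.map (Z.val 1))) (u : ℝ≥0) {s t : ℝ≥0} (hst : s ≤ t) :
    ∫ ω, Real.exp (-((u : ℝ) * ((Z.val t ω : ℝ) - Z.val s ω))) ∂P
      = Real.exp (-(((t : ℝ) - s) * laplaceExponent ρ u)) := by
  obtain ⟨r, rfl⟩ := exists_add_of_le hst
  rw [Z.laplace_increment, Z.laplace_val hρ]
  simp

/-- The Laplace transform of `Z_1` is at least `1 - uκ`, so the exponent is `O(u)` near `0`, and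
Fatou turns this into a first moment of `ρ`. -/
theorem lintegral_levy_lt_top (Z : Subordinator P) {ρ : Measure ℝ≥0}
    (hρ : IsDriftlessLevyMeasure ρ (P.map (Z.val 1))) (hκ : Z.mean < ∞) :
    ∫⁻ x, x ∂ρ < ∞ := by
  have hm := Z.measurable_val 1
  set κ : ℝ := ∫ ω, (Z.val 1 ω : ℝ) ∂P with hκdef
  have hi : Integrable (fun ω => (Z.val 1 ω : ℝ)) P := integrable_coe_of_lintegral_lt_top hm hκ
  have hκ0 : 0 ≤ κ := integral_nonneg fun _ => NNReal.coe_nonneg _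
  refine lt_of_le_of_lt (lintegral_le_of_one_sub_exp_le (C := ENNReal.ofReal (2 * κ)) measurable_id
    (δ := 1 / (2 * (κ + 1))) (by positivity) fun u hu hu1 => ?_) ENNReal.ofReal_lt_top
  lift u to ℝ≥0 using hu.le
  have hu2 : (u : ℝ) * κ ≤ 1 / 2 := by
    rw [lt_div_iff₀ (by positivity)] at hu1
    nlinarith
  have h1 : 1 - u * κ ≤ Real.exp (-laplaceExponent ρ u) := by
    have h2 := Z.laplace_val hρ u 1
    simp only [NNReal.coe_one, one_mul] at h2
    rw [← h2]
    calc 1 - u * κ = ∫ ω, (1 - (u : ℝ) * Z.val 1 ω) ∂P := by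
          rw [integral_sub (integrable_const _) (hi.const_mul _), integral_const_mul]; simp [hκdef]
      _ ≤ _ := by
          refine integral_mono ((integrable_const _).sub (hi.const_mul _))
            (Z.integrable_exp_val u 1) fun ω => ?_
          have := one_sub_exp_neg_le ((u : ℝ) * Z.val 1 ω)
          simp only
          linarith
  -- The choice of `δ` gives `uκ ≤ 1/2`. Then `e^p (1 - uκ) ≤ 1` yields `e^p ≤ 2`, and so `p ≤ e^p -
  -- 1 ≤ uκ e^p ≤ 2uκ`.
  have h3 : laplaceExponent ρ u ≤ u * (2 * κ) := by
    set p := laplaceExponent ρ u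
    have h4 : p + 1 ≤ Real.exp p := Real.add_one_le_exp p
    have h5 : Real.exp p * Real.exp (-p) = 1 := by rw [← Real.exp_add]; simp
    have h6 := Real.exp_pos p
    have h7 := mul_le_mul_of_nonneg_left h1 h6.le
    have h8 : 0 ≤ (u : ℝ) * κ := by positivity
    have h9 : Real.exp p ≤ 2 := by nlinarith
    nlinarith
  simp only [id]
  rw [← ofReal_integral_eq_lintegral_ofReal (hρ.integrable u)
    (Eventually.of_forall fun z => one_sub_exp_neg_nonneg (by positivity)),
    ← ENNReal.ofReal_mul u.coe_nonneg]
  exact ENNReal.ofReal_le_ofReal h3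

/-- Differentiate the Laplace transform at `0`. The upper bound by Fatou comes first, since the
derivative needs a finite mean. -/
theorem lintegral_val (Z : Subordinator P) {ρ : Measure ℝ≥0}
    (hρ : IsDriftlessLevyMeasure ρ (P.map (Z.val 1))) (hm : ∫⁻ x, x ∂ρ < ∞) (t : ℝ≥0) :
    ∫⁻ ω, Z.val t ω ∂P = t * ∫⁻ x, x ∂ρ := by
  have hZ := Z.measurable_val t
  have hfin : ∫⁻ ω, Z.val t ω ∂P ≤ t * ∫⁻ x, x ∂ρ := by
    refine lintegral_le_of_one_sub_exp_le hZ one_pos fun u hu _ => ?_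
    lift u to ℝ≥0 using hu.le
    have hi : Integrable (fun ω => 1 - Real.exp (-((u : ℝ) * Z.val t ω))) P :=
      (integrable_const _).sub (Z.integrable_exp_val u t)
    rw [← ofReal_integral_eq_lintegral_ofReal hi
      (Eventually.of_forall fun z => one_sub_exp_neg_nonneg (by positivity)),
      integral_sub (integrable_const _) (Z.integrable_exp_val u t), Z.laplace_val hρ]
    calc _ ≤ ENNReal.ofReal (t * laplaceExponent ρ u) := by
          refine ENNReal.ofReal_le_ofReal ?_
          simpa using one_sub_exp_neg_le (t * laplaceExponent ρ u)
      _ = t * ∫⁻ x, ENNReal.ofReal (1 - Real.exp (-((u : ℝ) * x))) ∂ρ := by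
          rw [ENNReal.ofReal_mul t.coe_nonneg, laplaceExponent,
            ofReal_integral_eq_lintegral_ofReal (hρ.integrable u)
            (Eventually.of_forall fun z => one_sub_exp_neg_nonneg (by positivity))]
          simp
      _ ≤ t * ∫⁻ x, u * x ∂ρ := by
          gcongr with x
          refine (ENNReal.ofReal_le_ofReal (one_sub_exp_neg_le _)).trans_eq ?_
          rw [ENNReal.ofReal_mul u.coe_nonneg]
          simp
      _ = _ := by
          rw [lintegral_const_mul _ (by fun_prop), ENNReal.ofReal_coe_nnreal]
          ring
  have hlt : ∫⁻ ω, Z.val t ω ∂P < ∞ := hfin.trans_lt (ENNReal.mul_lt_top ENNReal.coe_lt_top hm)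
  have hvi : ∫⁻ x, (x : ℝ≥0∞) ∂(t • ρ) < ∞ := by
    rw [lintegral_smul_measure]
    exact ENNReal.mul_lt_top ENNReal.coe_lt_top hm
  have h := integral_mul_eq_of_laplace_eq (m := P) (k := t • ρ) (g := fun _ => 1)
    measurable_const (by simp) (by simp) hZ hlt (h := fun _ => 1) measurable_const (by simp)
    (by simp) measurable_id hvi 1 fun u => by
      simp only [one_mul, id]
      rw [Z.laplace_val hρ, integral_smul_nnreal_measure]
      rfl
  simp only [one_mul, id] at h
  rw [integral_smul_nnreal_measure, integral_eq_lintegral_of_nonneg_ae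
    (Eventually.of_forall fun _ => NNReal.coe_nonneg _) (by fun_prop),
    integral_eq_lintegral_of_nonneg_ae
    (Eventually.of_forall fun _ => NNReal.coe_nonneg _) (by fun_prop)] at h
  simp only [ENNReal.ofReal_coe_nnreal] at h
  rw [← ENNReal.toReal_eq_toReal_iff' hlt.ne (ENNReal.mul_lt_top ENNReal.coe_lt_top hm).ne, h,
    ENNReal.toReal_mul]
  simp [NNReal.smul_def]

theorem mean_eq (Z : Subordinator P) {ρ : Measure ℝ≥0}
    (hρ : IsDriftlessLevyMeasure ρ (P.map (Z.val 1))) (hκ : Z.mean < ∞) :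
    Z.mean = ∫⁻ x, x ∂ρ := by
  simpa [mean] using Z.lintegral_val hρ (Z.lintegral_levy_lt_top hρ hκ) 1

end Subordinator

end

noncomputable section

/-! ### The Laplace functional of the random measure `dZ` -/

theorem abs_exp_neg_sub_exp_neg_le {a b : ℝ} (ha : 0 ≤ a) (hb : 0 ≤ b) :
    |Real.exp (-a) - Real.exp (-b)| ≤ |a - b| := by
  wlog hab : a ≤ b generalizing a b
  · rw [abs_sub_comm, abs_sub_comm a b]
    exact this hb ha (le_of_not_ge hab)
  have h1 : Real.exp (-b) = Real.exp (-a) * Real.exp (-(b - a)) := by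
    rw [← Real.exp_add]; congr 1; ring
  have h2 : Real.exp (-a) ≤ 1 := Real.exp_le_one_iff.2 (by linarith)
  have h3 := one_sub_exp_neg_le (b - a)
  have h4 := one_sub_exp_neg_nonneg (sub_nonneg.2 hab)
  have h5 := Real.exp_nonneg (-a)
  rw [h1, abs_of_nonneg (by nlinarith), abs_sub_comm, abs_of_nonneg (sub_nonneg.2 hab)]
  nlinarith

/-- The first moment of `ρ` makes the exponent Lipschitz, so the Laplace functional can be extended
by `L¹` approximation of the integrand. -/
theorem abs_laplaceExponent_sub_le {ρ : Measure ℝ≥0} (hm : ∫⁻ x, x ∂ρ < ∞) (u v : ℝ≥0) :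
    |laplaceExponent ρ u - laplaceExponent ρ v| ≤ (∫⁻ x, x ∂ρ).toReal * |(u : ℝ) - v| := by
  have hi : ∀ u : ℝ≥0, Integrable (fun x : ℝ≥0 => 1 - Real.exp (-((u : ℝ) * x))) ρ := fun u => by
    have := integrable_one_sub_exp (m := ρ) (w := fun x => u * x) (by fun_prop) (by
      simp_rw [ENNReal.coe_mul]
      rw [lintegral_const_mul _ (by fun_prop)]
      exact ENNReal.mul_lt_top ENNReal.coe_lt_top hm)
    simpa using this
  have hx : Integrable (fun x : ℝ≥0 => (x : ℝ)) ρ :=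
    integrable_coe_of_lintegral_lt_top measurable_id hm
  rw [laplaceExponent, laplaceExponent, ← integral_sub (hi u) (hi v)]
  refine abs_integral_le_integral_abs.trans ?_
  have h1 : (∫⁻ x, (x : ℝ≥0∞) ∂ρ).toReal = ∫ x, (x : ℝ) ∂ρ := by
    rw [integral_eq_lintegral_of_nonneg_ae (Eventually.of_forall fun _ => NNReal.coe_nonneg _)
      (by fun_prop)]
    simp
  rw [h1, ← integral_mul_const]
  refine integral_mono ((hi u).sub (hi v)).abs (hx.mul_const _) fun x => ?_
  have := abs_exp_neg_sub_exp_neg_le (a := v * x) (b := u * x) (by positivity) (by positivity)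
  calc |(1 - Real.exp (-((u : ℝ) * x))) - (1 - Real.exp (-((v : ℝ) * x)))|
      = |Real.exp (-((v : ℝ) * x)) - Real.exp (-((u : ℝ) * x))| := by congr 1; ring
    _ ≤ |(v : ℝ) * x - u * x| := this
    _ = x * |(u : ℝ) - v| := by
        rw [← sub_mul, abs_mul, abs_of_nonneg x.coe_nonneg, abs_sub_comm, mul_comm]

theorem continuous_laplaceExponent {ρ : Measure ℝ≥0} (hm : ∫⁻ x, x ∂ρ < ∞) :
    Continuous (laplaceExponent ρ) := by
  refine (LipschitzWith.of_dist_le_mul (K := (∫⁻ x, x ∂ρ).toNNReal) fun u v => ?_).continuous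
  rw [Real.dist_eq, NNReal.dist_eq]
  exact abs_laplaceExponent_sub_le hm u v

theorem laplaceExponent_zero (ρ : Measure ℝ≥0) : laplaceExponent ρ 0 = 0 := by
  simp [laplaceExponent]

theorem natCeil_mul_div_eq {M : ℝ} (hM : 0 < M) {j : ℕ} {s : ℝ}
    (hs : s ∈ Ioc ((j : ℝ) / M) ((j + 1 : ℕ) / M)) : ((⌈M * s⌉₊ : ℕ) : ℝ) / M = ((j + 1 : ℕ) : ℝ) / M := by
  have : ⌈M * s⌉₊ = j + 1 := by
    rw [Nat.ceil_eq_iff (by simp)]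
    rw [mem_Ioc, div_lt_iff₀ hM, le_div_iff₀ hM] at hs
    constructor
    · simpa [mul_comm] using hs.1
    · simpa [mul_comm] using hs.2
  rw [this]

/-- The integral of a step function on a regular grid. -/
theorem setIntegral_step (m : Measure ℝ) [IsLocallyFiniteMeasure m] (G : ℝ → ℝ) {M : ℝ}
    (hM : 0 < M) (j : ℕ) :
    IntegrableOn (fun s => G ((⌈M * s⌉₊ : ℕ) / M)) (Ioc 0 ((j : ℝ) / M)) m ∧
    ∫ s in Ioc 0 ((j : ℝ) / M), G ((⌈M * s⌉₊ : ℕ) / M) ∂m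
      = ∑ k : Fin j, G (((k : ℕ) + 1 : ℕ) / M) *
        m.real (Ioc (((k : ℕ) : ℝ) / M) (((k : ℕ) + 1 : ℕ) / M)) := by
  induction j with
  | zero => simp
  | succ j ih =>
    have h1 : Ioc (0 : ℝ) ((j + 1 : ℕ) / M) =
        Ioc 0 ((j : ℝ) / M) ∪ Ioc ((j : ℝ) / M) ((j + 1 : ℕ) / M) := by
      rw [Ioc_union_Ioc_eq_Ioc (by positivity)]
      gcongr
      simp
    have hcongr : EqOn (fun s => G ((⌈M * s⌉₊ : ℕ) / M)) (fun _ => G ((j + 1 : ℕ) / M))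
        (Ioc ((j : ℝ) / M) ((j + 1 : ℕ) / M)) := fun s hs => by
      simp only [natCeil_mul_div_eq hM hs]
    have h2 : IntegrableOn (fun s => G ((⌈M * s⌉₊ : ℕ) / M))
        (Ioc ((j : ℝ) / M) ((j + 1 : ℕ) / M)) m :=
      (integrableOn_congr_fun hcongr measurableSet_Ioc).2
        (integrableOn_const measure_Ioc_lt_top.ne)
    rw [h1]
    refine ⟨ih.1.union h2, ?_⟩
    rw [setIntegral_union (Ioc_disjoint_Ioc_of_le le_rfl) measurableSet_Ioc ih.1 h2, ih.2,
      setIntegral_congr_fun measurableSet_Ioc hcongr, Fin.sum_univ_castSucc]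
    simp [mul_comm]

namespace Subordinator

variable {Ω : Type*} [MeasurableSpace Ω] {P : Measure Ω}

theorem stieltjes_Ioc (Z : Subordinator P) (ω : Ω) (a b : ℝ) :
    (Z.stieltjes ω).measure (Ioc a b)
      = ENNReal.ofReal ((Z.val b.toNNReal ω : ℝ) - Z.val a.toNNReal ω) :=
  StieltjesFunction.measure_Ioc _ _ _

/-- On a bounded window the measures are finite, so measurability need only be checked on the
π-system of half-open intervals, where the mass is an increment of `Z`. -/
theorem measurable_stieltjes_restrict (Z : Subordinator P) (T : ℝ) :
    Measurable fun ω => (Z.stieltjes ω).measure.restrict (Ioc 0 T) := by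
  have hfin : ∀ ω, IsFiniteMeasure ((Z.stieltjes ω).measure.restrict (Ioc 0 T)) := fun ω =>
    ⟨by rw [Measure.restrict_apply_univ]; exact measure_Ioc_lt_top⟩
  have hmeas : ∀ a b : ℝ, Measurable fun ω => (Z.stieltjes ω).measure (Ioc a b) := fun a b => by
    simp_rw [Z.stieltjes_Ioc]
    have := Z.measurable_val b.toNNReal
    have := Z.measurable_val a.toNNReal
    fun_prop
  refine Measurable.measure_of_isPiSystem (S := {S | ∃ l u, l < u ∧ Ioc l u = S})
    (by rw [← borel_eq_generateFrom_Ioc ℝ]; exact BorelSpace.measurable_eq)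
    (isPiSystem_Ioc id id) ?_ ?_
  · rintro _ ⟨a, b, _, rfl⟩
    simp_rw [Measure.restrict_apply measurableSet_Ioc, Ioc_inter_Ioc]
    exact hmeas _ _
  · simp_rw [Measure.restrict_apply_univ]
    exact hmeas _ _

variable [IsProbabilityMeasure P]

theorem lintegral_increment (Z : Subordinator P) {ρ : Measure ℝ≥0}
    (hρ : IsDriftlessLevyMeasure ρ (P.map (Z.val 1))) (hm : ∫⁻ x, x ∂ρ < ∞) {s t : ℝ≥0}
    (hst : s ≤ t) :
    ∫⁻ ω, ENNReal.ofReal ((Z.val t ω : ℝ) - Z.val s ω) ∂P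
      = (∫⁻ x, x ∂ρ) * ENNReal.ofReal ((t : ℝ) - s) := by
  have h1 := Z.measurable_val s
  have h2 := Z.measurable_val t
  have h3 : ∫⁻ ω, Z.val t ω ∂P = ∫⁻ ω, Z.val s ω ∂P +
      ∫⁻ ω, ENNReal.ofReal ((Z.val t ω : ℝ) - Z.val s ω) ∂P := by
    rw [← lintegral_add_left (by fun_prop)]
    refine lintegral_congr fun ω => ?_
    have h4 : (Z.val s ω : ℝ) ≤ Z.val t ω := Z.mono ω hst
    rw [← ENNReal.ofReal_coe_nnreal, ← ENNReal.ofReal_coe_nnreal,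
      ← ENNReal.ofReal_add (NNReal.coe_nonneg _) (sub_nonneg.2 h4)]
    congr 1
    ring
  obtain ⟨r, rfl⟩ := exists_add_of_le hst
  rw [Z.lintegral_val hρ hm, Z.lintegral_val hρ hm, ENNReal.coe_add, add_mul,
    ENNReal.add_right_inj (ENNReal.mul_lt_top ENNReal.coe_lt_top hm).ne] at h3
  rw [← h3, mul_comm]
  simp

/-- Campbell's formula for the mean of `∫ h dZ`. -/
theorem lintegral_lintegral_stieltjes (Z : Subordinator P) {ρ : Measure ℝ≥0}
    (hρ : IsDriftlessLevyMeasure ρ (P.map (Z.val 1))) (hm : ∫⁻ x, x ∂ρ < ∞) (T : ℝ≥0)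
    {h : ℝ → ℝ≥0∞} (hh : Measurable h) :
    ∫⁻ ω, ∫⁻ s in Ioc 0 (T : ℝ), h s ∂(Z.stieltjes ω).measure ∂P
      = (∫⁻ x, x ∂ρ) * ∫⁻ s in Ioc 0 (T : ℝ), h s := by
  have hmeas := Z.measurable_stieltjes_restrict T
  have hinc : ∀ a b : ℝ, 0 ≤ a → ∫⁻ ω, (Z.stieltjes ω).measure (Ioc a b) ∂P
      = (∫⁻ x, x ∂ρ) * volume (Ioc a b) := by
    intro a b ha
    rcases le_total a b with hab | hab
    · simp_rw [Z.stieltjes_Ioc]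
      rw [Z.lintegral_increment hρ hm (Real.toNNReal_mono hab), Real.volume_Ioc,
        Real.coe_toNNReal _ ha, Real.coe_toNNReal _ (ha.trans hab)]
    · simp [Ioc_eq_empty_of_le hab]
  -- The mean measure of `dZ` on the window is identified on half-open intervals; integrating `h`
  -- against it then gives the formula.
  have heq : (P.bind fun ω => (Z.stieltjes ω).measure.restrict (Ioc 0 (T : ℝ)))
      = (∫⁻ x, x ∂ρ) • volume.restrict (Ioc 0 (T : ℝ)) := by
    have : IsFiniteMeasure (P.bind fun ω => (Z.stieltjes ω).measure.restrict (Ioc 0 (T : ℝ))) := by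
      refine ⟨?_⟩
      rw [Measure.bind_apply MeasurableSet.univ hmeas.aemeasurable]
      simp_rw [Measure.restrict_apply_univ]
      rw [hinc 0 T le_rfl]
      exact ENNReal.mul_lt_top hm measure_Ioc_lt_top
    refine Measure.ext_of_Ioc_finite _ _ ?_ fun a b _ => ?_
    · rw [Measure.bind_apply MeasurableSet.univ hmeas.aemeasurable]
      simp_rw [Measure.restrict_apply_univ]
      rw [hinc 0 T le_rfl]
      simp
    · rw [Measure.bind_apply measurableSet_Ioc hmeas.aemeasurable]
      simp_rw [Measure.restrict_apply measurableSet_Ioc, Ioc_inter_Ioc]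
      rw [hinc _ _ le_sup_right, Measure.smul_apply, Measure.restrict_apply measurableSet_Ioc,
        Ioc_inter_Ioc, smul_eq_mul]
  rw [← Measure.lintegral_bind hmeas.aemeasurable hh.aemeasurable, heq, lintegral_smul_measure,
    smul_eq_mul]

end Subordinator

end

/-! ### The Laplace functional of `dZ`: from step functions to integrable functions -/

noncomputable section

namespace Subordinator

variable {Ω : Type*} [MeasurableSpace Ω] {P : Measure Ω}

theorem measurable_setLIntegral_stieltjes (Z : Subordinator P) (T : ℝ) {h : ℝ → ℝ≥0∞}
    (hh : Measurable h) :
    Measurable fun ω => ∫⁻ s in Ioc 0 T, h s ∂(Z.stieltjes ω).measure :=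
  (Measure.measurable_lintegral hh).comp (Z.measurable_stieltjes_restrict T)

variable [IsProbabilityMeasure P]

/-- The Laplace functional of `dZ` at a step function on a regular grid. -/
theorem laplace_step (Z : Subordinator P) {ρ : Measure ℝ≥0}
    (hρ : IsDriftlessLevyMeasure ρ (P.map (Z.val 1))) (g : ℝ → ℝ≥0) {M : ℝ} (hM : 0 < M) (j : ℕ) :
    ∫ ω, Real.exp (-∫ s in Ioc 0 ((j : ℝ) / M), (g ((⌈M * s⌉₊ : ℕ) / M) : ℝ)
        ∂(Z.stieltjes ω).measure) ∂P
      = Real.exp (-∫ s in Ioc 0 ((j : ℝ) / M), laplaceExponent ρ (g ((⌈M * s⌉₊ : ℕ) / M))) := by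
  simp_rw [(setIntegral_step _ (fun s => (g s : ℝ)) hM j).2]
  rw [(setIntegral_step _ (fun s => laplaceExponent ρ (g s)) hM j).2]
  let t : Fin (j + 1) → ℝ≥0 := fun i => ((i : ℕ) : ℝ≥0) / M.toNNReal
  have ht : Monotone t := fun a b hab => by
    have : (a : ℕ) ≤ b := hab
    simp only [t]
    gcongr
  have htN : ∀ k : ℕ, ((k : ℝ) / M).toNNReal = (k : ℝ≥0) / M.toNNReal := fun k => by
    rw [Real.toNNReal_div (by positivity)]
    simp
  have hind := Z.indep j t ht
  have hval : ∀ (k : Fin j) (ω : Ω),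
      (Z.stieltjes ω).measure.real (Ioc (((k : ℕ) : ℝ) / M) (((k : ℕ) + 1 : ℕ) / M))
        = (Z.val (t k.succ) ω : ℝ) - Z.val (t k.castSucc) ω := by
    intro k ω
    rw [Measure.real, Z.stieltjes_Ioc, htN, htN]
    refine ENNReal.toReal_ofReal (sub_nonneg.2 (NNReal.coe_le_coe.2 (Z.mono ω ?_)))
    gcongr
    simp
  have hZm : ∀ i, Measurable fun ω => (Z.val (t i) ω : ℝ) := fun i =>
    (Z.measurable_val (t i)).coe_nnreal_real
  -- On a grid, the exponential of the step integral is a product over independent increments.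
  have hprod := hind.integral_fun_prod_comp
    (f := fun (k : Fin j) (r : ℝ) => Real.exp (-((g (((k : ℕ) + 1 : ℕ) / M) : ℝ) * r)))
    (fun i => ((hZm _).sub (hZm _)).aemeasurable)
    (fun i => Measurable.aestronglyMeasurable (by fun_prop))
  simp only [← Real.exp_sum, Finset.sum_neg_distrib] at hprod
  simp_rw [hval]
  rw [hprod, ← Finset.sum_neg_distrib, Real.exp_sum]
  refine Finset.prod_congr rfl fun k _ => ?_
  rw [Z.laplace_sub hρ _ (ht (Fin.castSucc_lt_succ (i := k)).le), Measure.real, Real.volume_Ioc]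
  have h1 : ((t k.succ : ℝ≥0) : ℝ) - t k.castSucc = 1 / M := by
    simp only [t, Fin.val_succ, Fin.val_castSucc]
    push_cast
    rw [Real.coe_toNNReal _ hM.le]
    ring
  have h2 : (((k : ℕ) + 1 : ℕ) : ℝ) / M - ((k : ℕ) : ℝ) / M = 1 / M := by
    push_cast
    ring
  rw [h1, h2, ENNReal.toReal_ofReal (by positivity), mul_comm]

theorem tendsto_natCeil_mul_div {s : ℝ} (hs : 0 ≤ s) :
    Tendsto (fun n : ℕ => ((⌈((n : ℝ) + 1) * s⌉₊ : ℕ) : ℝ) / ((n : ℝ) + 1)) atTop (𝓝 s) := by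
  have h := tendsto_nat_ceil_mul_div_atTop (R := ℝ) hs
  have h2 : Tendsto (fun n : ℕ => (n : ℝ) + 1) atTop atTop :=
    tendsto_atTop_add_const_right _ _ tendsto_natCast_atTop_atTop
  refine (h.comp h2).congr fun n => ?_
  simp [mul_comm]

/-- The Laplace functional of `dZ` at a continuous function. -/
theorem laplace_continuous (Z : Subordinator P) {ρ : Measure ℝ≥0}
    (hρ : IsDriftlessLevyMeasure ρ (P.map (Z.val 1))) (hm : ∫⁻ x, x ∂ρ < ∞) {g : ℝ → ℝ≥0}
    (hg : Continuous g) (T : ℕ) :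
    ∫ ω, Real.exp (-∫ s in Ioc 0 (T : ℝ), (g s : ℝ) ∂(Z.stieltjes ω).measure) ∂P
      = Real.exp (-∫ s in Ioc 0 (T : ℝ), laplaceExponent ρ (g s)) := by
  obtain ⟨B, hB⟩ := (isCompact_Icc (a := (0 : ℝ)) (b := T)).bddAbove_image hg.continuousOn
  have hφ := continuous_laplaceExponent hm
  obtain ⟨C, hC⟩ := (isCompact_Icc (a := (0 : ℝ)) (b := T)).bddAbove_image
    (hφ.comp hg).continuousOn
  -- Since `T` is an integer it is a point of every grid of mesh `1/(n + 1)`, so rounding up does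
  -- not leave `[0, T]`.
  have hmem : ∀ (n : ℕ) (s : ℝ), s ∈ Ioc 0 (T : ℝ) →
      ((⌈((n : ℝ) + 1) * s⌉₊ : ℕ) : ℝ) / ((n : ℝ) + 1) ∈ Icc (0 : ℝ) T := by
    intro n s hs
    refine ⟨by positivity, ?_⟩
    rw [div_le_iff₀ (by positivity)]
    have : ⌈((n : ℝ) + 1) * s⌉₊ ≤ T * (n + 1) := by
      refine Nat.ceil_le.2 ?_
      push_cast
      rw [mul_comm]
      have := hs.2
      gcongr
    exact_mod_cast this
  have hlim : ∀ (m : Measure ℝ) [IsLocallyFiniteMeasure m] (G : ℝ≥0 → ℝ), Continuous G →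
      ∀ K : ℝ, (∀ r ∈ Icc (0 : ℝ) T, |G (g r)| ≤ K) →
      Tendsto (fun n : ℕ => ∫ s in Ioc 0 (T : ℝ),
        G (g (((⌈((n : ℝ) + 1) * s⌉₊ : ℕ) : ℝ) / ((n : ℝ) + 1))) ∂m) atTop
        (𝓝 (∫ s in Ioc 0 (T : ℝ), G (g s) ∂m)) := by
    intro m _ G hG K hK
    have : IsFiniteMeasure (m.restrict (Ioc 0 (T : ℝ))) :=
      ⟨by rw [Measure.restrict_apply_univ]; exact measure_Ioc_lt_top⟩
    refine tendsto_integral_of_dominated_convergence (fun _ => K) (fun n => ?_)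
      (integrable_const _) (fun n => ?_) ?_
    · have h1 : Measurable fun s : ℝ =>
          ((⌈((n : ℝ) + 1) * s⌉₊ : ℕ) : ℝ) / ((n : ℝ) + 1) :=
        (measurable_from_nat.comp
          (Nat.measurable_ceil.comp (measurable_id.const_mul _))).div_const _
      exact ((hG.comp hg).measurable.comp h1).aestronglyMeasurable
    · filter_upwards [ae_restrict_mem measurableSet_Ioc] with s hs
      exact hK _ (hmem n s hs)
    · filter_upwards [ae_restrict_mem measurableSet_Ioc] with s hs
      exact ((hG.comp hg).tendsto s).comp (tendsto_natCeil_mul_div hs.1.le)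
  have hstep : ∀ n : ℕ, ∫ ω, Real.exp (-∫ s in Ioc 0 (T : ℝ),
        (g (((⌈((n : ℝ) + 1) * s⌉₊ : ℕ) : ℝ) / ((n : ℝ) + 1)) : ℝ) ∂(Z.stieltjes ω).measure) ∂P
      = Real.exp (-∫ s in Ioc 0 (T : ℝ),
        laplaceExponent ρ (g (((⌈((n : ℝ) + 1) * s⌉₊ : ℕ) : ℝ) / ((n : ℝ) + 1)))) := by
    intro n
    have h := Z.laplace_step hρ g (M := (n : ℝ) + 1) (by positivity) (T * (n + 1))
    have h2 : ((T * (n + 1) : ℕ) : ℝ) / ((n : ℝ) + 1) = T := by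
      push_cast
      field_simp
    rwa [h2] at h
  have hR := ((Real.continuous_exp.comp continuous_neg).tendsto _).comp
    (hlim volume (laplaceExponent ρ) hφ C (fun r hr => by
      rw [abs_of_nonneg (laplaceExponent_nonneg _ _)]
      exact hC ⟨r, hr, rfl⟩))
  have hL : Tendsto (fun n : ℕ => ∫ ω, Real.exp (-∫ s in Ioc 0 (T : ℝ),
        (g (((⌈((n : ℝ) + 1) * s⌉₊ : ℕ) : ℝ) / ((n : ℝ) + 1)) : ℝ) ∂(Z.stieltjes ω).measure) ∂P)
      atTop (𝓝 (∫ ω, Real.exp (-∫ s in Ioc 0 (T : ℝ), (g s : ℝ) ∂(Z.stieltjes ω).measure) ∂P)) := by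
    refine tendsto_integral_of_dominated_convergence (fun _ => 1) (fun n => ?_)
      (integrable_const _) (fun n => Eventually.of_forall fun ω => ?_)
      (Eventually.of_forall fun ω => ?_)
    -- A non-measurable integrand would have integral `0` by convention, whereas the step formula
    -- gives a positive value. This yields measurability for free.
    · by_contra hcon
      have h1 := hstep n
      rw [integral_undef (fun hi => hcon hi.1)] at h1
      exact (Real.exp_pos _).ne h1
    · rw [Real.norm_eq_abs, Real.abs_exp, Real.exp_le_one_iff, neg_nonpos]
      exact integral_nonneg fun _ => NNReal.coe_nonneg _
    · exact ((Real.continuous_exp.comp continuous_neg).tendsto _).comp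
        (hlim (Z.stieltjes ω).measure (fun r => (r : ℝ)) NNReal.continuous_coe B (fun r hr => by
          rw [abs_of_nonneg (NNReal.coe_nonneg _)]
          exact NNReal.coe_le_coe.2 (hB ⟨r, hr, rfl⟩)))
  simp_rw [hstep] at hL
  exact tendsto_nhds_unique hL hR

/-- Almost surely, a function which is integrable on `(0, T]` is integrable against `dZ`. -/
theorem ae_setLIntegral_stieltjes_lt_top (Z : Subordinator P) {ρ : Measure ℝ≥0}
    (hρ : IsDriftlessLevyMeasure ρ (P.map (Z.val 1))) (hm : ∫⁻ x, x ∂ρ < ∞) (T : ℝ≥0)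
    {h : ℝ → ℝ≥0∞} (hh : Measurable h) (hi : ∫⁻ s in Ioc 0 (T : ℝ), h s < ∞) :
    ∀ᵐ ω ∂P, ∫⁻ s in Ioc 0 (T : ℝ), h s ∂(Z.stieltjes ω).measure < ∞ := by
  refine ae_lt_top (Z.measurable_setLIntegral_stieltjes T hh) ?_
  rw [Z.lintegral_lintegral_stieltjes hρ hm T hh]
  exact (ENNReal.mul_lt_top hm hi).ne

/-- The Laplace functional of `dZ`. -/
theorem laplace_functional (Z : Subordinator P) {ρ : Measure ℝ≥0}
    (hρ : IsDriftlessLevyMeasure ρ (P.map (Z.val 1))) (hm : ∫⁻ x, x ∂ρ < ∞) {g : ℝ → ℝ≥0}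
    (hg : Measurable g) (T : ℕ) (hi : ∫⁻ s in Ioc 0 (T : ℝ), g s < ∞) :
    ∫ ω, Real.exp (-(∫⁻ s in Ioc 0 (T : ℝ), g s ∂(Z.stieltjes ω).measure).toReal) ∂P
      = Real.exp (-∫ s in Ioc 0 (T : ℝ), laplaceExponent ρ (g s)) := by
  set κ : ℝ := (∫⁻ x, x ∂ρ).toReal with hκ
  have hφ := continuous_laplaceExponent hm
  have hgr : Integrable (fun s => (g s : ℝ)) (volume.restrict (Ioc 0 (T : ℝ))) :=
    integrable_coe_of_lintegral_lt_top hg hi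
  have hφi : ∀ {g : ℝ → ℝ≥0}, Measurable g →
      Integrable (fun s => (g s : ℝ)) (volume.restrict (Ioc 0 (T : ℝ))) →
      Integrable (fun s => laplaceExponent ρ (g s)) (volume.restrict (Ioc 0 (T : ℝ))) := by
    intro g hg hgr
    refine (hgr.const_mul κ).mono' (hφ.measurable.comp hg).aestronglyMeasurable
      (Eventually.of_forall fun s => ?_)
    have := abs_laplaceExponent_sub_le hm (g s) 0
    rw [laplaceExponent_zero, sub_zero, NNReal.coe_zero, sub_zero,
      abs_of_nonneg (NNReal.coe_nonneg _)] at this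
    exact this
  have hexpi : ∀ {h : ℝ → ℝ≥0}, Measurable h → Integrable (fun ω =>
      Real.exp (-(∫⁻ s in Ioc 0 (T : ℝ), h s ∂(Z.stieltjes ω).measure).toReal)) P := by
    intro h hh
    have := Z.measurable_setLIntegral_stieltjes T (h := fun s => (h s : ℝ≥0∞)) (by fun_prop)
    refine Integrable.of_bound (Measurable.aestronglyMeasurable (by fun_prop)) 1
      (Eventually.of_forall fun ω => ?_)
    rw [Real.norm_eq_abs, Real.abs_exp, Real.exp_le_one_iff, neg_nonpos]
    exact ENNReal.toReal_nonneg
  refine eq_of_forall_dist_le fun ε hε => ?_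
  -- Both sides of the identity move by at most `κη` when `g` moves by `η` in `L¹`, hence the
  -- condition `2κη ≤ ε`.
  obtain ⟨η, hη, hηε⟩ : ∃ η : ℝ, 0 < η ∧ 2 * κ * η ≤ ε := by
    have hκ0 : 0 ≤ κ := ENNReal.toReal_nonneg
    refine ⟨ε / (2 * (κ + 1)), by positivity, ?_⟩
    rw [← mul_div_assoc, div_le_iff₀ (by positivity)]
    nlinarith
  obtain ⟨h₀, -, happ, hcont₀, hi₀⟩ := hgr.exists_hasCompactSupport_integral_sub_le hη
  -- Taking the positive part keeps continuity and cannot increase the distance to the nonnegative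
  -- `g`.
  set h : ℝ → ℝ≥0 := fun s => (h₀ s).toNNReal with hdef
  have hcont : Continuous h := by fun_prop
  have hhm : Measurable h := hcont.measurable
  have hhr : Integrable (fun s => (h s : ℝ)) (volume.restrict (Ioc 0 (T : ℝ))) := by
    refine hi₀.norm.mono' (by fun_prop) (Eventually.of_forall fun s => ?_)
    rw [Real.norm_eq_abs, abs_of_nonneg (NNReal.coe_nonneg _), hdef, Real.coe_toNNReal']
    exact max_le (le_abs_self _) (abs_nonneg _)
  have hdist : ∀ s, |(g s : ℝ) - h s| ≤ |(g s : ℝ) - h₀ s| := by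
    intro s
    have h1 : (g s : ℝ) = max (g s : ℝ) 0 := (max_eq_left (NNReal.coe_nonneg _)).symm
    rw [hdef, Real.coe_toNNReal']
    nth_rewrite 1 [h1]
    exact abs_max_sub_max_le_abs _ _ _
  have hL1 : ∫ s in Ioc 0 (T : ℝ), |(g s : ℝ) - h s| ≤ η :=
    (integral_mono (hgr.sub hhr).abs (hgr.sub hi₀).norm hdist).trans happ
  have hL1' : ∫⁻ s in Ioc 0 (T : ℝ), ENNReal.ofReal |(g s : ℝ) - h s| ≤ ENNReal.ofReal η := by
    have hd : Integrable (fun s => |(g s : ℝ) - h s|) (volume.restrict (Ioc 0 (T : ℝ))) :=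
      (hgr.sub hhr).abs
    rw [← ofReal_integral_eq_lintegral_ofReal hd
      (Eventually.of_forall fun s => abs_nonneg _)]
    exact ENNReal.ofReal_le_ofReal hL1
  have hR : |Real.exp (-∫ s in Ioc 0 (T : ℝ), laplaceExponent ρ (h s))
      - Real.exp (-∫ s in Ioc 0 (T : ℝ), laplaceExponent ρ (g s))| ≤ κ * η := by
    refine (abs_exp_neg_sub_exp_neg_le
      (integral_nonneg fun s => laplaceExponent_nonneg _ _)
      (integral_nonneg fun s => laplaceExponent_nonneg _ _)).trans ?_
    rw [← integral_sub (hφi hhm hhr) (hφi hg hgr)]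
    refine abs_integral_le_integral_abs.trans ?_
    calc _ ≤ ∫ s in Ioc 0 (T : ℝ), κ * |(g s : ℝ) - h s| := by
          refine integral_mono ((hφi hhm hhr).sub (hφi hg hgr)).abs
            ((hgr.sub hhr).abs.const_mul κ) fun s => ?_
          rw [abs_sub_comm (g s : ℝ)]
          exact abs_laplaceExponent_sub_le hm _ _
      _ = κ * ∫ s in Ioc 0 (T : ℝ), |(g s : ℝ) - h s| := integral_const_mul _ _
      _ ≤ κ * η := by
          have : 0 ≤ κ := ENNReal.toReal_nonneg
          gcongr
  have hhfin : ∫⁻ s in Ioc 0 (T : ℝ), h s < ∞ := by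
    simpa [HasFiniteIntegral] using hhr.2
  have hdm : Measurable fun s => ENNReal.ofReal |(g s : ℝ) - h s| := by fun_prop
  have hcamp : ∫⁻ ω, ∫⁻ s in Ioc 0 (T : ℝ), ENNReal.ofReal |(g s : ℝ) - h s|
      ∂(Z.stieltjes ω).measure ∂P ≤ ENNReal.ofReal (κ * η) := by
    have := Z.lintegral_lintegral_stieltjes hρ hm (T : ℝ≥0) hdm
    simp only [NNReal.coe_natCast] at this
    rw [this, ENNReal.ofReal_mul ENNReal.toReal_nonneg, ENNReal.ofReal_toReal hm.ne]
    gcongr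
  have hL : |∫ ω, Real.exp (-(∫⁻ s in Ioc 0 (T : ℝ), g s ∂(Z.stieltjes ω).measure).toReal) ∂P
      - ∫ ω, Real.exp (-(∫⁻ s in Ioc 0 (T : ℝ), h s ∂(Z.stieltjes ω).measure).toReal) ∂P|
      ≤ κ * η := by
    rw [← integral_sub (hexpi hg) (hexpi hhm)]
    have hκη : 0 ≤ κ * η := mul_nonneg ENNReal.toReal_nonneg hη.le
    refine abs_integral_le_integral_abs.trans ?_
    have hd : Integrable (fun ω =>
        |Real.exp (-(∫⁻ s in Ioc 0 (T : ℝ), g s ∂(Z.stieltjes ω).measure).toReal) -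
          Real.exp (-(∫⁻ s in Ioc 0 (T : ℝ), h s ∂(Z.stieltjes ω).measure).toReal)|) P :=
      ((hexpi hg).sub (hexpi hhm)).abs
    rw [integral_eq_lintegral_of_nonneg_ae (Eventually.of_forall fun ω => abs_nonneg _) hd.1]
    refine ENNReal.toReal_le_of_le_ofReal hκη ((lintegral_mono_ae ?_).trans hcamp)
    have e1 := Z.ae_setLIntegral_stieltjes_lt_top hρ hm (T : ℝ≥0)
      (h := fun s => (g s : ℝ≥0∞)) (by fun_prop) hi
    have e2 := Z.ae_setLIntegral_stieltjes_lt_top hρ hm (T : ℝ≥0)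
      (h := fun s => (h s : ℝ≥0∞)) (by fun_prop) hhfin
    filter_upwards [e1, e2] with ω h1 h2
    simp only [NNReal.coe_natCast] at h1 h2
    have i1 := integrable_coe_of_lintegral_lt_top hg h1
    have i2 := integrable_coe_of_lintegral_lt_top hhm h2
    have i3 : Integrable (fun s => |(g s : ℝ) - h s|)
      ((Z.stieltjes ω).measure.restrict (Ioc 0 (T : ℝ))) := (i1.sub i2).abs
    rw [← ofReal_integral_eq_lintegral_ofReal i3
      (Eventually.of_forall fun s => abs_nonneg _)]
    refine ENNReal.ofReal_le_ofReal ?_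
    refine (abs_exp_neg_sub_exp_neg_le ENNReal.toReal_nonneg ENNReal.toReal_nonneg).trans ?_
    have c1 : ∀ {k : ℝ → ℝ≥0}, Measurable k →
        (∫⁻ s in Ioc 0 (T : ℝ), k s ∂(Z.stieltjes ω).measure).toReal
          = ∫ s in Ioc 0 (T : ℝ), (k s : ℝ) ∂(Z.stieltjes ω).measure := by
      intro k hk
      rw [integral_eq_lintegral_of_nonneg_ae (Eventually.of_forall fun _ => NNReal.coe_nonneg _)
        (by fun_prop)]
      simp
    rw [c1 hg, c1 hhm, ← integral_sub i1 i2]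
    exact abs_integral_le_integral_abs
  have hmid : ∫ ω, Real.exp (-(∫⁻ s in Ioc 0 (T : ℝ), h s ∂(Z.stieltjes ω).measure).toReal) ∂P
      = Real.exp (-∫ s in Ioc 0 (T : ℝ), laplaceExponent ρ (h s)) := by
    rw [← Z.laplace_continuous hρ hm hcont T]
    refine integral_congr_ae (Eventually.of_forall fun ω => ?_)
    simp only
    rw [integral_eq_lintegral_of_nonneg_ae (Eventually.of_forall fun _ => NNReal.coe_nonneg _)
      (by fun_prop)]
    simp
  rw [hmid] at hL
  rw [Real.dist_eq]
  have := abs_sub_le (∫ ω, Real.exp (-(∫⁻ s in Ioc 0 (T : ℝ), g s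
    ∂(Z.stieltjes ω).measure).toReal) ∂P) (Real.exp (-∫ s in Ioc 0 (T : ℝ), laplaceExponent ρ (h s)))
    (Real.exp (-∫ s in Ioc 0 (T : ℝ), laplaceExponent ρ (g s)))
  linarith

end Subordinator

end

noncomputable section

/-! ### The Lévy measure of a stochastic convolution -/

theorem IsDriftlessLevyMeasure.ae_ne_zero {ρ μ : Measure ℝ≥0} (h : IsDriftlessLevyMeasure ρ μ) :
    ∀ᵐ x ∂ρ, x ≠ 0 := by
  rw [ae_iff]
  simpa using h.zero

/-- The measure `x ρ(dx)` is finite and `ρ` has density `1/x` with respect to it, as `ρ {0} = 0`.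
Products with `ρ` and Tonelli rely on this. -/
theorem IsDriftlessLevyMeasure.sFinite {ρ μ : Measure ℝ≥0} (h : IsDriftlessLevyMeasure ρ μ)
    (hm : ∫⁻ x, x ∂ρ < ∞) : SFinite ρ := by
  have : IsFiniteMeasure (ρ.withDensity fun x => (x : ℝ≥0∞)) := isFiniteMeasure_withDensity hm.ne
  have h1 : (ρ.withDensity fun x => (x : ℝ≥0∞)).withDensity (fun x => (x : ℝ≥0∞))⁻¹ = ρ := by
    refine withDensity_inv_same (by fun_prop) ?_ (Eventually.of_forall fun x => ENNReal.coe_ne_top)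
    filter_upwards [h.ae_ne_zero] with x hx
    simpa using hx
  rw [← h1]
  infer_instance

/-- Rational translates of a set of positive measure cover almost everything. -/
theorem ae_exists_rat_sub_mem {N : Set ℝ} (hN : MeasurableSet N) (hN0 : volume N ≠ 0) :
    ∀ᵐ s : ℝ, ∃ q : ℚ, (q : ℝ) - s ∈ N := by
  obtain ⟨N', hN'N, hN', hN'0, hN'fin⟩ : ∃ N' ⊆ N, MeasurableSet N' ∧ volume N' ≠ 0 ∧
      volume N' ≠ ∞ := by
    obtain ⟨N', h1, h2, h3, h4⟩ := Measure.exists_subset_measure_lt_top hN (pos_iff_ne_zero.2 hN0)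
    exact ⟨N', h2, h1, h3.ne', h4.ne⟩
  set A : Set ℝ := {s | ∀ q : ℚ, (q : ℝ) - s ∉ N} with hA
  have hAm : MeasurableSet A := by
    have h1 : A = ⋂ q : ℚ, ((fun s : ℝ => (q : ℝ) - s) ⁻¹' N)ᶜ := by ext; simp [hA]
    rw [h1]
    exact MeasurableSet.iInter fun q => ((measurable_const_sub _) hN).compl
  have hrat : ∀ q : ℚ, volume (A ∩ (fun s : ℝ => (q : ℝ) - s) ⁻¹' N') = 0 := by
    intro q
    have : A ∩ (fun s : ℝ => (q : ℝ) - s) ⁻¹' N' = ∅ := by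
      ext s
      simp only [mem_inter_iff, mem_preimage, mem_empty_iff_false, iff_false, not_and]
      exact fun hs hq => hs q (hN'N hq)
    simp [this]
  -- Translation is continuous in measure on sets of finite measure, so nullity for rational shifts
  -- passes to all real shifts.
  have hall : ∀ t : ℝ, volume (A ∩ (fun s : ℝ => t - s) ⁻¹' N') = 0 := by
    intro t
    let F : C(ℝ, C(ℝ, ℝ)) := (⟨fun p : ℝ × ℝ => p.1 - p.2, by fun_prop⟩ : C(ℝ × ℝ, ℝ)).curry
    have hpres : ∀ r : ℝ, MeasurePreserving (F r) volume volume := fun r =>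
      Measure.measurePreserving_sub_left volume r
    have hlim := tendsto_measure_symmDiff_preimage_nhds_zero (μ := (volume : Measure ℝ))
      (ν := (volume : Measure ℝ)) (F.continuous.tendsto t) (Eventually.of_forall hpres) (hpres t)
      hN'.nullMeasurableSet hN'fin
    refine le_antisymm (le_of_forall_gt_imp_ge_of_dense fun ε hε => ?_) bot_le
    have hev : {r : ℝ | volume (symmDiff (F r ⁻¹' N') (F t ⁻¹' N')) < ε} ∈ 𝓝 t :=
      hlim.eventually_lt_const hε
    obtain ⟨_, ⟨q, rfl⟩, hr⟩ := Rat.denseRange_cast.inter_nhds_nonempty hev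
    calc volume (A ∩ (fun s : ℝ => t - s) ⁻¹' N')
        ≤ volume ((A ∩ (fun s : ℝ => (q : ℝ) - s) ⁻¹' N') ∪
            symmDiff (F q ⁻¹' N') (F t ⁻¹' N')) := by
          refine measure_mono fun s hs => ?_
          by_cases hq : (q : ℝ) - s ∈ N'
          · exact Or.inl ⟨hs.1, hq⟩
          · exact Or.inr (Or.inr ⟨hs.2, hq⟩)
      _ ≤ volume (A ∩ (fun s : ℝ => (q : ℝ) - s) ⁻¹' N') +
            volume (symmDiff (F q ⁻¹' N') (F t ⁻¹' N')) := measure_union_le _ _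
      _ ≤ ε := by
          rw [hrat q, zero_add]
          exact le_of_lt hr
  have hS : MeasurableSet {p : ℝ × ℝ | p.2 ∈ A ∧ p.1 - p.2 ∈ N'} :=
    (measurable_snd hAm).inter ((measurable_fst.sub measurable_snd) hN')
  -- Compute the measure of one planar set in both orders: all `t`-sections are null, while the
  -- `s`-section over each point of `A` has measure `volume N' > 0`. Hence `A` is null.
  have h1 : (volume.prod volume : Measure (ℝ × ℝ)) {p : ℝ × ℝ | p.2 ∈ A ∧ p.1 - p.2 ∈ N'} = 0 := by
    rw [Measure.prod_apply hS]
    simp only [lintegral_eq_zero_iff (measurable_measure_prodMk_left hS)]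
    exact Eventually.of_forall fun t => hall t
  rw [Measure.prod_apply_symm hS] at h1
  have h2 : ∀ s : ℝ, volume ((fun t : ℝ => (t, s)) ⁻¹' {p : ℝ × ℝ | p.2 ∈ A ∧ p.1 - p.2 ∈ N'})
      = A.indicator (fun _ => volume N') s := by
    intro s
    by_cases hs : s ∈ A
    · rw [indicator_of_mem hs]
      have : (fun t : ℝ => (t, s)) ⁻¹' {p : ℝ × ℝ | p.2 ∈ A ∧ p.1 - p.2 ∈ N'}
          = (fun t => t - s) ⁻¹' N' := by
        ext t
        simp [hs]
      rw [this]
      exact (measurePreserving_sub_right volume s).measure_preimage hN'.nullMeasurableSet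
    · rw [indicator_of_notMem hs]
      have : (fun t : ℝ => (t, s)) ⁻¹' {p : ℝ × ℝ | p.2 ∈ A ∧ p.1 - p.2 ∈ N'} = ∅ := by
        ext t
        simp [hs]
      simp [this]
  simp_rw [h2] at h1
  rw [lintegral_indicator_const hAm, mul_eq_zero] at h1
  rw [ae_iff]
  simp only [not_exists]
  exact h1.resolve_left hN'0

/-- The image of Lebesgue measure on `[0, ∞) ∩ D` times `ρ` under `(s, x) ↦ x f(· - s)`. -/
def shiftLevy (f : ℝ → ℝ≥0) (D : Set ℝ) (ρ : Measure ℝ≥0) : Measure (ℝ≥0 → ℝ≥0) :=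
  ((volume.restrict (Ici 0 ∩ D)).prod ρ).map fun p => shiftPath f p.2 p.1

section ShiftLevy

variable {f : ℝ → ℝ≥0} {ρ : Measure ℝ≥0}

theorem measurable_shiftPath (hf : Measurable f) :
    Measurable fun p : ℝ × ℝ≥0 => shiftPath f p.2 p.1 :=
  measurable_pi_iff.2 fun t => by
    simp only [shiftPath]
    fun_prop

theorem lintegral_shiftLevy (hf : Measurable f) [SFinite ρ] (D : Set ℝ)
    {F : (ℝ≥0 → ℝ≥0) → ℝ≥0∞} (hF : Measurable F) :
    ∫⁻ y, F y ∂(shiftLevy f D ρ) = ∫⁻ s in Ici 0 ∩ D, ∫⁻ x, F (shiftPath f x s) ∂ρ := by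
  rw [shiftLevy, lintegral_map hF (measurable_shiftPath hf)]
  exact lintegral_prod _ (hF.comp (measurable_shiftPath hf)).aemeasurable

theorem setLIntegral_sub_eq_primitiveAt (f : ℝ → ℝ≥0) (t : ℝ≥0) :
    ∫⁻ s in Icc 0 (t : ℝ), f (t - s) = primitiveAt f t := by
  rw [primitiveAt, ← lintegral_indicator measurableSet_Icc, ← lintegral_indicator measurableSet_Icc,
    ← lintegral_sub_left_eq_self _ (t : ℝ)]
  refine lintegral_congr fun s => ?_
  by_cases hs : s ∈ Icc 0 (t : ℝ)
  · have hs' : (t : ℝ) - s ∈ Icc 0 (t : ℝ) := ⟨by linarith [hs.2], by linarith [hs.1]⟩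
    rw [indicator_of_mem hs, indicator_of_mem hs']
    simp
  · have hs' : (t : ℝ) - s ∉ Icc 0 (t : ℝ) := fun h => hs ⟨by linarith [h.2], by linarith [h.1]⟩
    rw [indicator_of_notMem hs, indicator_of_notMem hs']

theorem setLIntegral_Ici_sub_eq_primitiveAt (hfneg : ∀ u < 0, f u = 0) (t : ℝ≥0) :
    ∫⁻ s in Ici (0 : ℝ), f (t - s) = primitiveAt f t := by
  rw [← setLIntegral_sub_eq_primitiveAt, ← lintegral_indicator measurableSet_Icc,
    ← lintegral_indicator measurableSet_Ici]
  refine lintegral_congr fun s => ?_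
  by_cases hs0 : 0 ≤ s
  · by_cases hst : s ≤ t
    · rw [indicator_of_mem (mem_Ici.2 hs0), indicator_of_mem (mem_Icc.2 ⟨hs0, hst⟩)]
    · rw [indicator_of_mem (mem_Ici.2 hs0), indicator_of_notMem fun h => hst h.2,
        hfneg _ (by linarith [not_le.1 hst])]
      rfl
  · rw [indicator_of_notMem (by simpa using hs0), indicator_of_notMem fun h => hs0 h.1]

theorem primitiveAt_lt_top (hfint : ∀ t : ℝ≥0, 0 < t → primitiveAt f t < ∞) (t : ℝ≥0) :
    primitiveAt f t < ∞ := by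
  rcases eq_or_ne t 0 with rfl | ht
  · simp [primitiveAt]
  · exact hfint t (pos_iff_ne_zero.2 ht)

theorem moment_shiftLevy_lt_top (hf : Measurable f) (hfneg : ∀ u < 0, f u = 0)
    (hfint : ∀ t : ℝ≥0, 0 < t → primitiveAt f t < ∞) [SFinite ρ] (hm : ∫⁻ x, x ∂ρ < ∞)
    (D : Set ℝ) (t : ℝ≥0) : ∫⁻ y, y t ∂(shiftLevy f D ρ) < ∞ := by
  rw [lintegral_shiftLevy hf D (F := fun y => (y t : ℝ≥0∞)) (by fun_prop)]
  simp only [shiftPath, ENNReal.coe_mul]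
  simp_rw [lintegral_mul_const _ measurable_coe_nnreal_ennreal]
  rw [lintegral_const_mul _ (by fun_prop)]
  refine ENNReal.mul_lt_top hm (lt_of_le_of_lt (lintegral_mono_set inter_subset_left) ?_)
  rw [setLIntegral_Ici_sub_eq_primitiveAt hfneg]
  exact primitiveAt_lt_top hfint t

/-- The paths charged by `shiftLevy` do not vanish identically on a fixed countable set. -/
theorem exists_countable_ae_shiftLevy_ne_zero (hf : Measurable f) (hfneg : ∀ u < 0, f u = 0)
    [SFinite ρ] (hρ0 : ∀ᵐ x ∂ρ, x ≠ 0) (hpos : ∃ a, 0 < primitiveAt f a) :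
    ∃ J : Set ℝ≥0, J.Countable ∧
      ∀ D : Set ℝ, ∀ᵐ y ∂(shiftLevy f D ρ), ∃ t ∈ J, y t ≠ 0 := by
  obtain ⟨a, ha⟩ := hpos
  have hN : MeasurableSet {s : ℝ | f s ≠ 0} := measurableSet_eq_fun hf measurable_const |>.compl
  have hN0 : volume {s : ℝ | f s ≠ 0} ≠ 0 := by
    intro h0
    refine ha.ne' ?_
    have : ∀ᵐ s : ℝ, f s = 0 := h0
    refine (lintegral_congr_ae (ae_restrict_of_ae ?_)).trans lintegral_zero
    filter_upwards [this] with s hs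
    simp [hs]
  refine ⟨range fun q : ℚ => (q : ℝ).toNNReal, countable_range _, fun D => ?_⟩
  have hJ : (range fun q : ℚ => (q : ℝ).toNNReal).Countable := countable_range _
  have hS : MeasurableSet {y : ℝ≥0 → ℝ≥0 | ∃ t ∈ range fun q : ℚ => (q : ℝ).toNNReal, y t ≠ 0} := by
    have h1 : {y : ℝ≥0 → ℝ≥0 | ∃ t ∈ range fun q : ℚ => (q : ℝ).toNNReal, y t ≠ 0}
        = ⋃ t ∈ range fun q : ℚ => (q : ℝ).toNNReal, {y | y t ≠ 0} := by ext; simp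
    rw [h1]
    exact MeasurableSet.biUnion hJ fun t _ => measurableSet_eval_ne_zero t
  rw [shiftLevy, ae_map_iff (measurable_shiftPath hf).aemeasurable hS]
  have h1 : ∀ᵐ p ∂(volume.restrict (Ici 0 ∩ D)).prod ρ, ∃ q : ℚ, f ((q : ℝ) - p.1) ≠ 0 :=
    Measure.quasiMeasurePreserving_fst.ae (ae_restrict_of_ae (ae_exists_rat_sub_mem hN hN0))
  have h2 : ∀ᵐ p ∂(volume.restrict (Ici 0 ∩ D)).prod ρ, p.2 ≠ 0 :=
    Measure.quasiMeasurePreserving_snd.ae hρ0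
  have h3 : ∀ᵐ p ∂(volume.restrict (Ici 0 ∩ D)).prod ρ, 0 ≤ p.1 := by
    refine Measure.quasiMeasurePreserving_fst.ae (p := fun s : ℝ => 0 ≤ s) ?_
    exact ae_restrict_of_ae_restrict_of_subset inter_subset_left (ae_restrict_mem measurableSet_Ici)
  filter_upwards [h1, h2, h3] with p hp1 hp2 hp3
  obtain ⟨q, hq⟩ := hp1
  refine ⟨_, ⟨q, rfl⟩, ?_⟩
  -- As `f` vanishes on negatives and `p.1 ≥ 0`, the rational `q` is nonnegative and is not altered
  -- by `toNNReal`.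
  have hq0 : 0 ≤ (q : ℝ) - p.1 := le_of_not_gt fun h => hq (hfneg _ h)
  rw [shiftPath, Real.coe_toNNReal _ (by linarith)]
  exact mul_ne_zero hp2 hq

end ShiftLevy

end

noncomputable section

/-! ### Laplace functionals of stochastic convolutions -/

/-- Because `f` vanishes on negatives, the cut-off at `t` is automatic, so several times can share
the domain `(0, T]`. -/
theorem setLIntegral_Ioc_inter_eq {f : ℝ → ℝ≥0} (hfneg : ∀ u < 0, f u = 0) {D : Set ℝ}
    (hD : MeasurableSet D) {t T : ℝ} (htT : t ≤ T) (m : Measure ℝ) :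
    ∫⁻ s in Ioc 0 t ∩ D, f (t - s) ∂m
      = ∫⁻ s in Ioc 0 T, ((D.indicator (fun s => f (t - s)) s : ℝ≥0) : ℝ≥0∞) ∂m := by
  rw [← lintegral_indicator (measurableSet_Ioc.inter hD), ← lintegral_indicator measurableSet_Ioc]
  refine lintegral_congr fun s => ?_
  by_cases hsD : s ∈ D
  · by_cases hs0 : 0 < s
    · by_cases hst : s ≤ t
      · have h1 : s ∈ Ioc 0 t ∩ D := ⟨⟨hs0, hst⟩, hsD⟩
        have h2 : s ∈ Ioc 0 T := ⟨hs0, hst.trans htT⟩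
        rw [indicator_of_mem h1, indicator_of_mem h2, indicator_of_mem hsD]
      · rw [indicator_of_notMem (fun h => hst h.1.2)]
        symm
        refine indicator_apply_eq_zero.2 fun _ => ?_
        rw [indicator_of_mem hsD, hfneg _ (by linarith [not_le.1 hst])]
        rfl
    · rw [indicator_of_notMem (fun h => hs0 h.1.1), indicator_of_notMem (fun h => hs0 h.1)]
  · rw [indicator_of_notMem (fun h => hsD h.2)]
    symm
    refine indicator_apply_eq_zero.2 fun _ => ?_
    rw [indicator_of_notMem hsD]
    rfl

namespace Subordinator

variable {Ω : Type*} [MeasurableSpace Ω] {P : Measure Ω} {f : ℝ → ℝ≥0}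

theorem measurable_convOn (Z : Subordinator P) (hf : Measurable f) (hfneg : ∀ u < 0, f u = 0)
    {D : Set ℝ} (hD : MeasurableSet D) (t : ℝ≥0) : Measurable (Z.convOn f D t) := by
  unfold convOn
  simp_rw [setLIntegral_Ioc_inter_eq hfneg hD (le_refl (t : ℝ))]
  have hg : Measurable (D.indicator fun s => f (t - s)) :=
    Measurable.indicator (by fun_prop) hD
  exact (Z.measurable_setLIntegral_stieltjes t (by fun_prop)).ennreal_toNNReal

theorem measurable_convOn_path (Z : Subordinator P) (hf : Measurable f)
    (hfneg : ∀ u < 0, f u = 0) {D : Set ℝ} (hD : MeasurableSet D) :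
    Measurable fun ω t => Z.convOn f D t ω :=
  measurable_pi_iff.2 fun t => Z.measurable_convOn hf hfneg hD t

variable [IsProbabilityMeasure P]

theorem isProbabilityMeasure_processLaw_convOn (Z : Subordinator P) (hf : Measurable f)
    (hfneg : ∀ u < 0, f u = 0) {D : Set ℝ} (hD : MeasurableSet D) :
    IsProbabilityMeasure (processLaw P (Z.convOn f D)) :=
  Measure.isProbabilityMeasure_map (Z.measurable_convOn_path hf hfneg hD).aemeasurable

/-- A linear combination of values at the times `t i` is almost surely one integral `∫ g dZ` with `g
= ∑ α i 1_D f(t i - ·)`, to which the Laplace functional applies. -/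
theorem hasLevyLaplace_convOn (Z : Subordinator P) {ρ : Measure ℝ≥0}
    (hρ : IsDriftlessLevyMeasure ρ (P.map (Z.val 1))) (hm : ∫⁻ x, x ∂ρ < ∞)
    (hf : Measurable f) (hfneg : ∀ u < 0, f u = 0)
    (hfint : ∀ t : ℝ≥0, 0 < t → primitiveAt f t < ∞) {D : Set ℝ} (hD : MeasurableSet D) :
    HasLevyLaplace (shiftLevy f D ρ) (processLaw P (Z.convOn f D)) := by
  have := hρ.sFinite hm
  have hmom := moment_shiftLevy_lt_top (ρ := ρ) hf hfneg hfint hm D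
  refine ⟨hmom, fun n t α => ?_⟩
  set T : ℕ := ⌈∑ i, t i⌉₊ with hT
  have htT : ∀ i, (t i : ℝ) ≤ T := by
    intro i
    have h1 : t i ≤ ∑ i, t i :=
      Finset.single_le_sum (f := t) (fun _ _ => bot_le) (Finset.mem_univ i)
    exact_mod_cast h1.trans (Nat.le_ceil _)
  have hgi : ∀ i, Measurable (D.indicator fun s => f (t i - s)) := fun i =>
    Measurable.indicator (by fun_prop) hD
  have hfin : ∀ i, ∫⁻ s in Ioc 0 (T : ℝ),
      ((D.indicator (fun s => f (t i - s)) s : ℝ≥0) : ℝ≥0∞) < ∞ := by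
    intro i
    rw [← setLIntegral_Ioc_inter_eq hfneg hD (htT i)]
    have hsub : Ioc 0 (t i : ℝ) ∩ D ⊆ Ici 0 := fun s hs => mem_Ici.2 hs.1.1.le
    refine lt_of_le_of_lt (lintegral_mono_set hsub) ?_
    rw [setLIntegral_Ici_sub_eq_primitiveAt hfneg]
    exact primitiveAt_lt_top hfint _
  set g : ℝ → ℝ≥0 := fun s => ∑ i, α i * D.indicator (fun s => f (t i - s)) s with hg
  have hgm : Measurable g := Finset.measurable_fun_sum _ fun i _ => (hgi i).const_mul (α i)
  have hsum : ∀ m : Measure ℝ, ∫⁻ s in Ioc 0 (T : ℝ), g s ∂m = ∑ i, α i *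
      ∫⁻ s in Ioc 0 (T : ℝ), ((D.indicator (fun s => f (t i - s)) s : ℝ≥0) : ℝ≥0∞) ∂m := by
    intro m
    simp only [hg, ENNReal.ofNNReal_finsetSum, ENNReal.coe_mul]
    rw [lintegral_finsetSum _ fun i _ => ((hgi i).coe_nnreal_ennreal).const_mul _]
    refine Finset.sum_congr rfl fun i _ => ?_
    rw [lintegral_const_mul _ (hgi i).coe_nnreal_ennreal]
  have hgfin : ∫⁻ s in Ioc 0 (T : ℝ), g s < ∞ := by
    rw [hsum]
    exact ENNReal.sum_lt_top.2 fun i _ => ENNReal.mul_lt_top ENNReal.coe_lt_top (hfin i)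
  have hL : ∫ y, Real.exp (-∑ i, (α i : ℝ) * y (t i)) ∂(processLaw P (Z.convOn f D))
      = ∫ ω, Real.exp (-(∫⁻ s in Ioc 0 (T : ℝ), g s ∂(Z.stieltjes ω).measure).toReal) ∂P := by
    rw [processLaw, integral_map (Z.measurable_convOn_path hf hfneg hD).aemeasurable
      (measurable_exp_neg_sum t α).aestronglyMeasurable]
    refine integral_congr_ae ?_
    -- An infinite integral is sent to `0` by `toNNReal`, so linearity in the coefficients holds
    -- only on the event where all the integrals are finite.
    have hae : ∀ᵐ ω ∂P, ∀ i, ∫⁻ s in Ioc 0 (T : ℝ),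
        ((D.indicator (fun s => f (t i - s)) s : ℝ≥0) : ℝ≥0∞) ∂(Z.stieltjes ω).measure < ∞ :=
      ae_all_iff.2 fun i => Z.ae_setLIntegral_stieltjes_lt_top hρ hm (T : ℝ≥0)
        (hgi i).coe_nnreal_ennreal (hfin i)
    filter_upwards [hae] with ω hω
    rw [hsum, ENNReal.toReal_sum fun i _ => (ENNReal.mul_lt_top ENNReal.coe_lt_top (hω i)).ne]
    simp only [convOn, ENNReal.toReal_mul, ENNReal.coe_toReal]
    congr 2
    refine Finset.sum_congr rfl fun i _ => ?_
    rw [setLIntegral_Ioc_inter_eq hfneg hD (htT i)]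
    rfl
  have hR : ∫ y, (1 - Real.exp (-∑ i, (α i : ℝ) * y (t i))) ∂(shiftLevy f D ρ)
      = ∫ s in Ioc 0 (T : ℝ), laplaceExponent ρ (g s) := by
    have hint := integrable_one_sub_exp_neg_sum hmom t α
    rw [shiftLevy] at hint ⊢
    have hmeas := ((measurable_exp_neg_sum t α).const_sub 1).aestronglyMeasurable
      (μ := ((volume.restrict (Ici 0 ∩ D)).prod ρ).map fun p => shiftPath f p.2 p.1)
    rw [integral_map (measurable_shiftPath hf).aemeasurable hmeas]
    rw [integrable_map_measure hmeas (measurable_shiftPath hf).aemeasurable] at hint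
    refine (integral_prod _ hint).trans ?_
    have hDm : MeasurableSet (Ici (0 : ℝ) ∩ D) := measurableSet_Ici.inter hD
    have h1 : ∫ s in Ici 0 ∩ D, ∫ x, (1 - Real.exp (-∑ i, (α i : ℝ) * shiftPath f x s (t i))) ∂ρ
        = ∫ s in Ici 0 ∩ D, laplaceExponent ρ (g s) := by
      refine setIntegral_congr_fun hDm fun s hs => ?_
      simp only [laplaceExponent, hg, shiftPath]
      refine integral_congr_ae (Eventually.of_forall fun x => ?_)
      simp only [indicator_of_mem hs.2]
      push_cast
      rw [Finset.sum_mul]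
      congr 3
      refine Finset.sum_congr rfl fun i _ => ?_
      ring
    refine h1.trans ?_
    -- The function `g` vanishes off `D` and beyond `T`, and the exponent vanishes at `0`, so both
    -- domains carry the same integral.
    rw [← setIntegral_eq_of_subset_of_forall_sdiff_eq_zero measurableSet_Ici
      (inter_subset_left (s := Ici (0 : ℝ)) (t := D)), integral_Ici_eq_integral_Ioi,
      setIntegral_eq_of_subset_of_forall_sdiff_eq_zero measurableSet_Ioi
      (show Ioc (0 : ℝ) T ⊆ Ioi 0 from Ioc_subset_Ioi_self)]
    · intro s hs
      have hsT : (T : ℝ) < s := by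
        by_contra hcon
        exact hs.2 ⟨hs.1, not_lt.1 hcon⟩
      have : g s = 0 := by
        refine Finset.sum_eq_zero fun i _ => ?_
        have h2 : f (t i - s) = 0 := hfneg _ (by linarith [htT i])
        by_cases hsD : s ∈ D <;> simp [hsD, h2]
      rw [this, laplaceExponent_zero]
    · intro s hs
      have hsD : s ∉ D := fun h => hs.2 ⟨hs.1, h⟩
      have : g s = 0 := by simp [hg, hsD]
      rw [this, laplaceExponent_zero]
  rw [hL, hR, Z.laplace_functional hρ hm hgm T hgfin]

/-- The subordinator `t ↦ Z_{ct}`. -/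
def timeScale (Z : Subordinator P) (c : ℝ≥0) : Subordinator P where
  val t ω := Z.val (c * t) ω
  measurable_val t := Z.measurable_val (c * t)
  zero_ae := by simpa using Z.zero_ae
  mono ω _ _ h := Z.mono ω (mul_le_mul_right h c)
  right_cont ω t := by
    have h1 : ContinuousWithinAt (fun t : ℝ≥0 => c * t) (Ici t) t := by fun_prop
    exact (Z.right_cont ω (c * t)).comp h1 fun s hs => mul_le_mul_right hs c
  indep n t ht := Z.indep n (fun i => c * t i) fun _ _ h => mul_le_mul_right (ht h) c
  stationary s t := by
    have := Z.stationary (c * s) (c * t)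
    rwa [← mul_add] at this

theorem isDriftlessLevyMeasure_timeScale (Z : Subordinator P) {ρ : Measure ℝ≥0}
    (hρ : IsDriftlessLevyMeasure ρ (P.map (Z.val 1))) (c : ℝ≥0) :
    IsDriftlessLevyMeasure (c • ρ) (P.map ((Z.timeScale c).val 1)) := by
  refine ⟨by simp [hρ.zero], ?_, fun u => ?_⟩
  · rw [lintegral_smul_measure]
    exact ENNReal.mul_lt_top ENNReal.coe_lt_top hρ.finite
  · rw [integral_map ((Z.timeScale c).measurable_val 1).aemeasurable
      (Measurable.aestronglyMeasurable (by fun_prop)), integral_smul_nnreal_measure]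
    have := Z.laplace_val hρ u c
    simpa [timeScale, NNReal.smul_def, laplaceExponent] using this

end Subordinator

theorem shiftLevy_smul (f : ℝ → ℝ≥0) (D : Set ℝ) (ρ : Measure ℝ≥0) [SFinite ρ] (c : ℝ≥0) :
    shiftLevy f D (c • ρ) = c • shiftLevy f D ρ := by
  have h : ∀ m : Measure ℝ≥0, c • m = (c : ℝ≥0∞) • m := fun m => rfl
  have h' : ∀ m : Measure (ℝ≥0 → ℝ≥0), c • m = (c : ℝ≥0∞) • m := fun m => rfl
  rw [shiftLevy, shiftLevy, h, h', Measure.prod_smul_right, Measure.map_smul]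

/-- A law all of whose roots `(1/n) ν` are realized is infinitely divisible. -/
theorem HasLevyLaplace.isInfDivLaw {E : Type*} {ν μ : Measure (E → ℝ≥0)} [IsFiniteMeasure μ]
    (h : HasLevyLaplace ν μ)
    (hroot : ∀ n : ℕ, 0 < n → ∃ η : Measure (E → ℝ≥0), IsProbabilityMeasure η ∧
      HasLevyLaplace ((n : ℝ≥0)⁻¹ • ν) η) : IsInfDivLaw μ := by
  intro I n hn
  obtain ⟨η, hη, hηL⟩ := hroot n hn
  have hrm : Measurable (I.restrict (π := fun _ : E => ℝ≥0)) := Finset.measurable_restrict I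
  have hηI : IsProbabilityMeasure (η.map I.restrict) :=
    Measure.isProbabilityMeasure_map hrm.aemeasurable
  refine ⟨η.map I.restrict, hηI, ext_of_laplace_pi fun c => ?_⟩
  have hsm : Measurable fun v : Fin n → I → ℝ≥0 => ∑ k, v k := by fun_prop
  have hexp := (expNegSum c).continuous
  have hmap : ∀ m : Measure (E → ℝ≥0), ∫ y, Real.exp (-∑ i, (c i : ℝ) * y i) ∂(m.map I.restrict)
      = ∫ y, Real.exp (-∑ k : Fin I.card, (c (I.equivFin.symm k) : ℝ) *
        y (I.equivFin.symm k : E)) ∂m := by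
    intro m
    rw [integral_map hrm.aemeasurable (by exact hexp.aestronglyMeasurable)]
    simp_rw [sum_equivFin_symm]
  rw [integral_map hsm.aemeasurable (by exact hexp.aestronglyMeasurable), hmap, h.laplace]
  have h1 : ∀ v : Fin n → I → ℝ≥0, Real.exp (-∑ i, (c i : ℝ) * ((∑ k, v k) i : ℝ≥0))
      = ∏ k, Real.exp (-∑ i, (c i : ℝ) * v k i) := by
    intro v
    rw [← Real.exp_sum, Finset.sum_neg_distrib, Finset.sum_comm]
    congr 2
    refine Finset.sum_congr rfl fun i _ => ?_
    rw [Finset.sum_apply, NNReal.coe_sum, Finset.mul_sum]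
  simp_rw [h1]
  rw [integral_fintype_prod_eq_prod (fun (_ : Fin n) (y : I → ℝ≥0) =>
    Real.exp (-∑ i, (c i : ℝ) * y i))]
  simp only [hmap, hηL.laplace, Finset.prod_const, Finset.card_univ, Fintype.card_fin]
  rw [integral_smul_nnreal_measure, ← Real.exp_nat_mul, NNReal.smul_def]
  congr 1
  have : (n : ℝ) ≠ 0 := by positivity
  push_cast
  rw [smul_eq_mul]
  field_simp

/-- The `n`-th root is the same convolution driven by `t ↦ Z_{t/n}`, whose Lévy measure is `ρ / n`.
-/
theorem Subordinator.isInfDivLaw_convOn {Ω : Type*} [MeasurableSpace Ω] {P : Measure Ω}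
    [IsProbabilityMeasure P] {f : ℝ → ℝ≥0} (Z : Subordinator P) {ρ : Measure ℝ≥0}
    (hρ : IsDriftlessLevyMeasure ρ (P.map (Z.val 1))) (hm : ∫⁻ x, x ∂ρ < ∞)
    (hf : Measurable f) (hfneg : ∀ u < 0, f u = 0)
    (hfint : ∀ t : ℝ≥0, 0 < t → primitiveAt f t < ∞) {D : Set ℝ} (hD : MeasurableSet D) :
    IsInfDivLaw (processLaw P (Z.convOn f D)) := by
  have := hρ.sFinite hm
  have := Z.isProbabilityMeasure_processLaw_convOn hf hfneg hD
  refine (Z.hasLevyLaplace_convOn hρ hm hf hfneg hfint hD).isInfDivLaw fun n _ => ?_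
  refine ⟨processLaw P ((Z.timeScale (n : ℝ≥0)⁻¹).convOn f D),
    isProbabilityMeasure_processLaw_convOn _ hf hfneg hD, ?_⟩
  rw [← shiftLevy_smul]
  refine hasLevyLaplace_convOn _ (Z.isDriftlessLevyMeasure_timeScale hρ _) ?_ hf hfneg hfint hD
  rw [lintegral_smul_measure]
  exact ENNReal.mul_lt_top ENNReal.coe_lt_top hm

end

noncomputable section

/-! ### Size-biasing and the representation of the Lévy measure -/

section Representation

variable {f : ℝ → ℝ≥0} {ρ : Measure ℝ≥0} {κ : ℝ≥0∞}

theorem isProbabilityMeasure_sizeBiasedLaw (hκ : κ = ∫⁻ x, x ∂ρ) (hκ0 : 0 < κ) (hκt : κ < ∞) :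
    IsProbabilityMeasure (sizeBiasedLaw κ ρ) := by
  refine ⟨?_⟩
  rw [sizeBiasedLaw, Measure.smul_apply, withDensity_apply _ MeasurableSet.univ,
    setLIntegral_univ, ← hκ, smul_eq_mul, ENNReal.inv_mul_cancel hκ0.ne' hκt.ne]

theorem lintegral_sizeBiasedLaw {G : ℝ≥0 → ℝ≥0∞} (hG : Measurable G) :
    ∫⁻ x, G x ∂(sizeBiasedLaw κ ρ) = κ⁻¹ * ∫⁻ x, x * G x ∂ρ := by
  rw [sizeBiasedLaw, lintegral_smul_measure, smul_eq_mul,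
    lintegral_withDensity_eq_lintegral_mul _ (by fun_prop) hG]
  rfl

theorem lintegral_timeLaw (hf : Measurable f) (a : ℝ≥0) {G : ℝ → ℝ≥0∞} (hG : Measurable G) :
    ∫⁻ s, G s ∂(timeLaw f a) = (primitiveAt f a)⁻¹ * ∫⁻ s in Icc 0 (a : ℝ), f (a - s) * G s := by
  have h1 : Measurable fun s : ℝ => (f (a - s) : ℝ≥0∞) / primitiveAt f a := by fun_prop
  rw [timeLaw, lintegral_withDensity_eq_lintegral_mul _ h1 hG,
    ← lintegral_const_mul _ (by fun_prop)]
  refine lintegral_congr fun s => ?_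
  simp only [Pi.mul_apply, ENNReal.div_eq_inv_mul, mul_assoc]

theorem isProbabilityMeasure_timeLaw (hf : Measurable f) {a : ℝ≥0} (h0 : 0 < primitiveAt f a)
    (ht : primitiveAt f a < ∞) : IsProbabilityMeasure (timeLaw f a) := by
  refine ⟨?_⟩
  rw [← lintegral_one, lintegral_timeLaw hf a measurable_const]
  simp only [mul_one]
  rw [setLIntegral_sub_eq_primitiveAt, ENNReal.inv_mul_cancel h0.ne' ht.ne]

theorem setLIntegral_Ici_sub_mul (hfneg : ∀ u < 0, f u = 0) (a : ℝ≥0) (h : ℝ → ℝ≥0∞) :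
    ∫⁻ s in Ici (0 : ℝ), f (a - s) * h s = ∫⁻ s in Icc 0 (a : ℝ), f (a - s) * h s := by
  rw [← lintegral_indicator measurableSet_Icc, ← lintegral_indicator measurableSet_Ici]
  refine lintegral_congr fun s => ?_
  by_cases hs0 : 0 ≤ s
  · by_cases hst : s ≤ a
    · rw [indicator_of_mem (mem_Ici.2 hs0), indicator_of_mem (mem_Icc.2 ⟨hs0, hst⟩)]
    · rw [indicator_of_mem (mem_Ici.2 hs0), indicator_of_notMem fun h => hst h.2,
        hfneg _ (by linarith [not_le.1 hst])]
      simp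
  · rw [indicator_of_notMem (by simpa using hs0), indicator_of_notMem fun h => hs0 h.1]

theorem measurable_lintegral_shiftPath (hf : Measurable f) [SFinite ρ]
    {F : ℝ → ℝ≥0 → (ℝ≥0 → ℝ≥0) → ℝ≥0∞}
    (hF : Measurable fun p : (ℝ × ℝ≥0) × (ℝ≥0 → ℝ≥0) => F p.1.1 p.1.2 p.2) :
    Measurable fun s => ∫⁻ x, F s x (shiftPath f x s) ∂ρ :=
  Measurable.lintegral_prod_right' (f := fun p : ℝ × ℝ≥0 => F p.1 p.2 (shiftPath f p.2 p.1))
    (hF.comp (measurable_id.prodMk (measurable_shiftPath hf)))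

/-- The size-biased Lévy measure is the law of a path `V f(· - U)`, up to a constant. -/
theorem lintegral_eval_mul_shiftLevy (hf : Measurable f) (hfneg : ∀ u < 0, f u = 0) [SFinite ρ]
    (hκ0 : 0 < κ) (hκt : κ < ∞) {a : ℝ≥0}
    (h0 : 0 < primitiveAt f a) (ht : primitiveAt f a < ∞)
    {G : (ℝ≥0 → ℝ≥0) → ℝ≥0∞} (hG : Measurable G) :
    ∫⁻ y, y a * G y ∂(shiftLevy f univ ρ)
      = κ * primitiveAt f a *
        ∫⁻ s, ∫⁻ x, G (shiftPath f x s) ∂(sizeBiasedLaw κ ρ) ∂(timeLaw f a) := by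
  have hGs : ∀ s, Measurable fun x => G (shiftPath f x s) := fun s =>
    hG.comp ((measurable_shiftPath hf).comp (measurable_const.prodMk measurable_id))
  have hH : Measurable fun s => ∫⁻ x, x * G (shiftPath f x s) ∂ρ :=
    measurable_lintegral_shiftPath hf (F := fun _ x y => x * G y) (by fun_prop)
  simp_rw [lintegral_sizeBiasedLaw (hGs _)]
  rw [lintegral_timeLaw hf a (hH.const_mul _),
    lintegral_shiftLevy hf univ (F := fun y => y a * G y) (by fun_prop), inter_univ]
  -- The weight `y a = x f(a - s)` factors: `x` becomes the size-bias of `V` and `f(a - s)` the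
  -- density of `U`.
  have h1 : ∀ s : ℝ, ∫⁻ x, (shiftPath f x s a : ℝ≥0∞) * G (shiftPath f x s) ∂ρ
      = f (a - s) * ∫⁻ x, x * G (shiftPath f x s) ∂ρ := by
    intro s
    have hx : Measurable fun x : ℝ≥0 => (x : ℝ≥0∞) * G (shiftPath f x s) :=
      measurable_coe_nnreal_ennreal.mul (hGs s)
    rw [← lintegral_const_mul _ hx]
    refine lintegral_congr fun x => ?_
    rw [shiftPath, ENNReal.coe_mul]
    ring
  simp_rw [h1]
  rw [setLIntegral_Ici_sub_mul hfneg]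
  simp_rw [mul_left_comm _ κ⁻¹]
  rw [lintegral_const_mul _ (by fun_prop)]
  set J := ∫⁻ s in Icc 0 (a : ℝ), f (a - s) * ∫⁻ x, x * G (shiftPath f x s) ∂ρ
  calc J = (κ * κ⁻¹) * (primitiveAt f a * (primitiveAt f a)⁻¹) * J := by
        rw [ENNReal.mul_inv_cancel hκ0.ne' hκt.ne, ENNReal.mul_inv_cancel h0.ne' ht.ne]
        simp
    _ = _ := by ring

/-- The law of `(Y, V)` reweighted by `κ θ⁻¹ V⁻¹ e^{θY}`. -/
theorem lintegral_shiftLevy_eq_expMeasure (hf : Measurable f) [SFinite ρ]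
    (hρ0 : ∀ᵐ x ∂ρ, x ≠ 0) (hκ0 : 0 < κ) (hκt : κ < ∞) {θ : ℝ} (hθ : 0 < θ)
    {F : (ℝ≥0 → ℝ≥0) → ℝ≥0∞} (hF : Measurable F) :
    ∫⁻ y, F y ∂(shiftLevy f univ ρ) = κ / ENNReal.ofReal θ *
      ∫⁻ y, ∫⁻ x, (x : ℝ≥0∞)⁻¹ * ENNReal.ofReal (Real.exp (θ * y)) * F (shiftPath f x y)
        ∂(sizeBiasedLaw κ ρ) ∂(expMeasure θ) := by
  have hFs : ∀ s, Measurable fun x => F (shiftPath f x s) := fun s =>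
    hF.comp ((measurable_shiftPath hf).comp (measurable_const.prodMk measurable_id))
  have hinner : ∀ y : ℝ, ∫⁻ x, (x : ℝ≥0∞)⁻¹ * ENNReal.ofReal (Real.exp (θ * y)) *
      F (shiftPath f x y) ∂(sizeBiasedLaw κ ρ)
      = κ⁻¹ * (ENNReal.ofReal (Real.exp (θ * y)) * ∫⁻ x, F (shiftPath f x y) ∂ρ) := by
    intro y
    have hx : Measurable fun x : ℝ≥0 =>
        (x : ℝ≥0∞)⁻¹ * ENNReal.ofReal (Real.exp (θ * y)) * F (shiftPath f x y) :=
      (measurable_coe_nnreal_ennreal.inv.mul_const _).mul (hFs y)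
    rw [lintegral_sizeBiasedLaw hx,
      ← lintegral_const_mul _ (hFs y)]
    congr 1
    refine lintegral_congr_ae ?_
    -- The size-bias factor cancels `x⁻¹` only for `x ≠ 0`, which holds `ρ`-almost everywhere.
    filter_upwards [hρ0] with x hx
    rw [← mul_assoc, ← mul_assoc, ENNReal.mul_inv_cancel (by simpa using hx) ENNReal.coe_ne_top,
      one_mul]
  have hH : Measurable fun s => ∫⁻ x, F (shiftPath f x s) ∂ρ :=
    measurable_lintegral_shiftPath hf (F := fun _ _ y => F y) (by fun_prop)
  simp_rw [hinner]
  rw [lintegral_const_mul _ (by fun_prop), lintegral_shiftLevy hf univ hF, inter_univ]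
  -- The weight `e^{θy}` cancels the exponential density and leaves `θ` times Lebesgue measure on
  -- `[0, ∞)`.
  have hexp : ∫⁻ y, ENNReal.ofReal (Real.exp (θ * y)) * ∫⁻ x, F (shiftPath f x y) ∂ρ
      ∂(expMeasure θ) = ENNReal.ofReal θ * ∫⁻ s in Ici 0, ∫⁻ x, F (shiftPath f x s) ∂ρ := by
    have hpdf : Measurable (exponentialPDF θ) := (measurable_exponentialPDFReal θ).ennreal_ofReal
    have hdef : expMeasure θ = volume.withDensity (exponentialPDF θ) := rfl
    rw [hdef, lintegral_withDensity_eq_lintegral_mul _ hpdf (by fun_prop),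
      ← lintegral_const_mul _ hH, ← lintegral_indicator measurableSet_Ici]
    refine lintegral_congr fun s => ?_
    simp only [Pi.mul_apply]
    by_cases hs : 0 ≤ s
    · rw [indicator_of_mem (mem_Ici.2 hs), exponentialPDF_of_nonneg hs, ← mul_assoc,
        ← ENNReal.ofReal_mul (by positivity), mul_assoc, ← Real.exp_add]
      simp
    · rw [indicator_of_notMem (by simpa using hs), exponentialPDF_of_neg (not_le.1 hs), zero_mul]
  rw [hexp]
  have hθ' : ENNReal.ofReal θ ≠ 0 := by simpa using hθ
  set J := ∫⁻ s in Ici (0 : ℝ), ∫⁻ x, F (shiftPath f x s) ∂ρ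
  calc J = (κ * κ⁻¹) * ((ENNReal.ofReal θ)⁻¹ * ENNReal.ofReal θ) * J := by
        rw [ENNReal.mul_inv_cancel hκ0.ne' hκt.ne,
          ENNReal.inv_mul_cancel hθ' ENNReal.ofReal_ne_top]
        simp
    _ = _ := by
        rw [ENNReal.div_eq_inv_mul]
        ring

end Representation

/-- A Lévy measure is characterized by the integrals of measurable functions. -/
theorem IsProcessLevyMeasure.iff_lintegral_eq {E : Type*} {ν₀ μ : Measure (E → ℝ≥0)}
    (h : IsProcessLevyMeasure ν₀ μ) {Φ : ((E → ℝ≥0) → ℝ≥0∞) → ℝ≥0∞}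
    (hΦ : ∀ F, Measurable F → ∫⁻ y, F y ∂ν₀ = Φ F) (ν : Measure (E → ℝ≥0)) :
    IsProcessLevyMeasure ν μ ↔ ∀ F, Measurable F → ∫⁻ y, F y ∂ν = Φ F := by
  refine ⟨fun hν => by rw [hν.unique h]; exact hΦ, fun hν => ?_⟩
  have : ν = ν₀ := by
    refine Measure.ext fun A hA => ?_
    rw [← lintegral_indicator_one hA, ← lintegral_indicator_one hA,
      hν _ (measurable_one.indicator hA), hΦ _ (measurable_one.indicator hA)]
  rwa [this]

theorem ProbabilityTheory.IndepFun.lintegral_comp_prodMk {Ω X Y : Type*} [MeasurableSpace Ω]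
    [MeasurableSpace X] [MeasurableSpace Y] {P : Measure Ω} [IsFiniteMeasure P] {U : Ω → X}
    {V : Ω → Y} {μ : Measure X} {ν : Measure Y} [SFinite ν] (hU : HasLaw U μ P) (hV : HasLaw V ν P)
    (h : IndepFun U V P) {G : X × Y → ℝ≥0∞} (hG : Measurable G) :
    ∫⁻ ω, G (U ω, V ω) ∂P = ∫⁻ u, ∫⁻ v, G (u, v) ∂ν ∂μ := by
  have h1 := (indepFun_iff_map_prod_eq_prod_map_map hU.aemeasurable hV.aemeasurable).1 h
  rw [hU.map_eq, hV.map_eq] at h1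
  rw [← lintegral_map' (f := G) hG.aemeasurable (hU.aemeasurable.prodMk hV.aemeasurable), h1,
    lintegral_prod _ hG.aemeasurable]

namespace Subordinator

variable {Ω : Type*} [MeasurableSpace Ω] {P : Measure Ω} [IsProbabilityMeasure P]
  {f : ℝ → ℝ≥0} {ρ : Measure ℝ≥0}

/-- Apply the Palm formula to indicators and identify the biased Lévy measure with the law of `V f(·
- U)`; the factor `κ I(a)` is exactly the normalization of the density. -/
theorem processLaw_add_eq_withDensity (Z : Subordinator P)
    (hρ : IsDriftlessLevyMeasure ρ (P.map (Z.val 1)))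
    (hκ0 : 0 < Z.mean) (hκ : Z.mean < ∞) (hf : Measurable f) (hfneg : ∀ u < 0, f u = 0)
    (hfint : ∀ t : ℝ≥0, 0 < t → primitiveAt f t < ∞) {a : ℝ≥0} (ha : 0 < a)
    (hI : 0 < primitiveAt f a) {U : Ω → ℝ} {V : Ω → ℝ≥0} (hU : HasLaw U (timeLaw f a) P)
    (hV : HasLaw V (sizeBiasedLaw Z.mean ρ) P) (hUV : IndepFun U V P)
    (hUVψ : IndepFun (fun ω => (U ω, V ω)) (fun ω t => Z.conv f t ω) P) :
    processLaw P (fun t ω => Z.conv f t ω + V ω * f (t - U ω)) =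
      processLaw (P.withDensity fun ω => Z.conv f a ω / (Z.mean * primitiveAt f a))
        (Z.conv f) := by
  have hm := Z.lintegral_levy_lt_top hρ hκ
  have := hρ.sFinite hm
  have := isProbabilityMeasure_sizeBiasedLaw (Z.mean_eq hρ hκ) hκ0 hκ
  have := isProbabilityMeasure_timeLaw hf hI (hfint a ha)
  have hψ : Measurable fun ω t => Z.conv f t ω :=
    Z.measurable_convOn_path hf hfneg MeasurableSet.univ
  have hlev : HasLevyLaplace (shiftLevy f univ ρ) (processLaw P (Z.conv f)) :=
    Z.hasLevyLaplace_convOn hρ hm hf hfneg hfint MeasurableSet.univ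
  have hμ : IsProbabilityMeasure (processLaw P (Z.conv f)) :=
    Z.isProbabilityMeasure_processLaw_convOn hf hfneg MeasurableSet.univ
  have hψL : HasLaw (fun ω t => Z.conv f t ω) (processLaw P (Z.conv f)) P :=
    ⟨hψ.aemeasurable, rfl⟩
  have hΦ : Measurable fun p : (ℝ × ℝ≥0) × (ℝ≥0 → ℝ≥0) => p.2 + shiftPath f p.1.2 p.1.1 :=
    measurable_snd.add ((measurable_shiftPath hf).comp measurable_fst)
  have hUVm : AEMeasurable (fun ω => (U ω, V ω)) P := hU.aemeasurable.prodMk hV.aemeasurable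
  have hUVL : HasLaw (fun ω => (U ω, V ω)) ((timeLaw f a).prod (sizeBiasedLaw Z.mean ρ)) P :=
    ⟨hUVm, by
      rw [(indepFun_iff_map_prod_eq_prod_map_map hU.aemeasurable hV.aemeasurable).1 hUV,
        hU.map_eq, hV.map_eq]⟩
  refine Measure.ext fun A hA => ?_
  have hAm : Measurable (A.indicator (1 : (ℝ≥0 → ℝ≥0) → ℝ≥0∞)) := measurable_one.indicator hA
  have hL : processLaw P (fun t ω => Z.conv f t ω + V ω * f (t - U ω)) A
      = ∫⁻ z, ∫⁻ s, ∫⁻ x, A.indicator 1 (z + shiftPath f x s) ∂(sizeBiasedLaw Z.mean ρ)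
        ∂(timeLaw f a) ∂(processLaw P (Z.conv f)) := by
    have hG : Measurable fun p : (ℝ≥0 → ℝ≥0) × (ℝ × ℝ≥0) =>
        A.indicator (1 : (ℝ≥0 → ℝ≥0) → ℝ≥0∞) (p.1 + shiftPath f p.2.2 p.2.1) :=
      hAm.comp (hΦ.comp measurable_swap)
    have hpath : AEMeasurable (fun ω (t : ℝ≥0) => Z.conv f t ω + V ω * f (t - U ω)) P :=
      hΦ.comp_aemeasurable (hUVm.prodMk hψ.aemeasurable)
    rw [processLaw, ← lintegral_indicator_one hA, lintegral_map' hAm.aemeasurable hpath]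
    refine (hUVψ.symm.lintegral_comp_prodMk hψL hUVL hG).trans ?_
    refine lintegral_congr fun z => ?_
    exact lintegral_prod _ (hG.comp (measurable_const.prodMk measurable_id)).aemeasurable
  have hdens : Measurable fun ω => (Z.conv f a ω : ℝ≥0∞) / (Z.mean * primitiveAt f a) := by
    have : Measurable (Z.conv f a) := Z.measurable_convOn hf hfneg MeasurableSet.univ a
    fun_prop
  have hR : processLaw (P.withDensity fun ω => Z.conv f a ω / (Z.mean * primitiveAt f a))
      (Z.conv f) A = (Z.mean * primitiveAt f a)⁻¹ *
        ∫⁻ z, z a * A.indicator 1 z ∂(processLaw P (Z.conv f)) := by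
    have hcomp : Measurable fun ω => A.indicator (1 : (ℝ≥0 → ℝ≥0) → ℝ≥0∞) fun t => Z.conv f t ω :=
      hAm.comp hψ
    have hza : Measurable fun z : ℝ≥0 → ℝ≥0 =>
        (z a : ℝ≥0∞) * A.indicator (1 : (ℝ≥0 → ℝ≥0) → ℝ≥0∞) z :=
      (measurable_coe_nnreal_ennreal.comp (measurable_pi_apply a)).mul hAm
    rw [processLaw, ← lintegral_indicator_one hA, lintegral_map hAm hψ,
      lintegral_withDensity_eq_lintegral_mul _ hdens hcomp, processLaw,
      lintegral_map hza hψ, ← lintegral_const_mul _ ?_]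
    · refine lintegral_congr fun ω => ?_
      simp only [Pi.mul_apply, ENNReal.div_eq_inv_mul, mul_assoc]
    · exact hza.comp hψ
  rw [hL, hR, hlev.lintegral_eval_mul a hAm]
  have hc0 : Z.mean * primitiveAt f a ≠ 0 := mul_ne_zero hκ0.ne' hI.ne'
  have hct : Z.mean * primitiveAt f a ≠ ∞ := (ENNReal.mul_lt_top hκ (hfint a ha)).ne
  rw [← lintegral_const_mul' _ _ (ENNReal.inv_ne_top.2 hc0)]
  refine lintegral_congr fun z => ?_
  rw [lintegral_eval_mul_shiftLevy hf hfneg hκ0 hκ hI (hfint a ha)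
    (G := fun y => A.indicator 1 (z + y)) (hAm.comp (measurable_const_add z)),
    ← mul_assoc, ENNReal.inv_mul_cancel hc0 hct, one_mul]

end Subordinator

/-! ### Decomposition at a time -/

theorem zeroTimes_subset (f : ℝ → ℝ≥0) (a : ℝ≥0) : zeroTimes f a ⊆ Ici 0 := fun _ hs => hs.1

theorem measurableSet_zeroTimes {f : ℝ → ℝ≥0} (hf : Measurable f) (a : ℝ≥0) :
    MeasurableSet (zeroTimes f a) :=
  measurableSet_Ici.inter
    (measurableSet_eq_fun (hf.comp (measurable_const_sub (a : ℝ))) measurable_const)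

theorem shiftLevy_add_compl (f : ℝ → ℝ≥0) (hf : Measurable f) {D : Set ℝ} (hD : MeasurableSet D)
    (ρ : Measure ℝ≥0) [SFinite ρ] :
    shiftLevy f univ ρ = shiftLevy f D ρ + shiftLevy f (Ici 0 \ D) ρ := by
  have h1 : Ici (0 : ℝ) ∩ univ = (Ici 0 ∩ D) ∪ (Ici 0 ∩ (Ici 0 \ D)) := by
    ext s
    simp only [mem_inter_iff, mem_univ, and_true, mem_union, Set.mem_sdiff]
    tauto
  have h2 : Disjoint (Ici (0 : ℝ) ∩ D) (Ici 0 ∩ (Ici 0 \ D)) :=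
    disjoint_left.2 fun s hs hs' => hs'.2.2 hs.2
  rw [shiftLevy, h1, Measure.restrict_union h2
    (measurableSet_Ici.inter (measurableSet_Ici.diff hD)), Measure.add_prod,
    Measure.map_add _ _ (measurable_shiftPath hf)]
  rfl

namespace Subordinator

variable {Ω : Type*} [MeasurableSpace Ω] {P : Measure Ω} [IsProbabilityMeasure P]
  {f : ℝ → ℝ≥0} {ρ : Measure ℝ≥0}

/-- The Lévy measures over `D` and its complement add up, so the Laplace functionals multiply.
Independence of the two parts is never argued pathwise. -/
theorem processLaw_conv_eq_conv (Z : Subordinator P)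
    (hρ : IsDriftlessLevyMeasure ρ (P.map (Z.val 1))) (hm : ∫⁻ x, x ∂ρ < ∞)
    (hf : Measurable f) (hfneg : ∀ u < 0, f u = 0)
    (hfint : ∀ t : ℝ≥0, 0 < t → primitiveAt f t < ∞) {D : Set ℝ} (hD : MeasurableSet D) :
    processLaw P (Z.conv f)
      = (processLaw P (Z.convOn f D)).conv (processLaw P (Z.convOn f (Ici 0 \ D))) := by
  have := hρ.sFinite hm
  have hD' : MeasurableSet (Ici (0 : ℝ) \ D) := measurableSet_Ici.diff hD
  have := Z.isProbabilityMeasure_processLaw_convOn hf hfneg hD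
  have := Z.isProbabilityMeasure_processLaw_convOn hf hfneg hD'
  have : IsProbabilityMeasure (processLaw P (Z.conv f)) :=
    Z.isProbabilityMeasure_processLaw_convOn hf hfneg MeasurableSet.univ
  have h0 : HasLevyLaplace (shiftLevy f univ ρ) (processLaw P (Z.conv f)) :=
    Z.hasLevyLaplace_convOn hρ hm hf hfneg hfint MeasurableSet.univ
  have h1 := Z.hasLevyLaplace_convOn hρ hm hf hfneg hfint hD
  have h2 := Z.hasLevyLaplace_convOn hρ hm hf hfneg hfint hD'
  refine ext_of_laplace fun n t α => ?_
  rw [laplace_conv, h0.laplace, h1.laplace, h2.laplace, ← Real.exp_add, ← neg_add,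
    shiftLevy_add_compl f hf hD, integral_add_measure (integrable_one_sub_exp_neg_sum h1.moment t α)
    (integrable_one_sub_exp_neg_sum h2.moment t α)]

/-- On `D_a` the integrand `f(a - s)` is zero, so the first part vanishes at `a`. Off `D_a`, a path
`x f(· - s)` vanishes at `a` only when `x = 0`, and then it is the zero path. -/
theorem isCondLawAtZero_convOn_zeroTimes (Z : Subordinator P)
    (hρ : IsDriftlessLevyMeasure ρ (P.map (Z.val 1))) (hm : ∫⁻ x, x ∂ρ < ∞)
    (hf : Measurable f) (hfneg : ∀ u < 0, f u = 0)
    (hfint : ∀ t : ℝ≥0, 0 < t → primitiveAt f t < ∞) (a : ℝ≥0) :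
    IsCondLawAtZero (processLaw P (Z.conv f)) a
      (processLaw P (Z.convOn f (zeroTimes f a))) := by
  have := hρ.sFinite hm
  have hD := measurableSet_zeroTimes hf a
  have hD' : MeasurableSet (Ici (0 : ℝ) \ zeroTimes f a) := measurableSet_Ici.diff hD
  have := Z.isProbabilityMeasure_processLaw_convOn hf hfneg hD
  have := Z.isProbabilityMeasure_processLaw_convOn hf hfneg hD'
  have hS : MeasurableSet {y : ℝ≥0 → ℝ≥0 | y a = 0} :=
    measurableSet_eq_fun (measurable_pi_apply a) measurable_const
  rw [Z.processLaw_conv_eq_conv hρ hm hf hfneg hfint hD]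
  refine isCondLawAtZero_conv (Z.hasLevyLaplace_convOn hρ hm hf hfneg hfint hD') ?_ fun t => ?_
  · rw [processLaw, ae_map_iff (Z.measurable_convOn_path hf hfneg hD).aemeasurable hS]
    refine Eventually.of_forall fun ω => ?_
    have h1 : ∫⁻ s in Ioc 0 (a : ℝ) ∩ zeroTimes f a, f (a - s) ∂(Z.stieltjes ω).measure = 0 := by
      rw [setLIntegral_congr_fun (g := fun _ => 0) (measurableSet_Ioc.inter hD)
        fun s hs => by simp [hs.2.2]]
      simp
    simp [convOn, h1]
  · rw [← lintegral_indicator hS, lintegral_shiftLevy hf _ (Measurable.indicator (by fun_prop) hS)]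
    rw [setLIntegral_congr_fun (g := fun _ => 0) (measurableSet_Ici.inter hD')]
    · simp
    · intro s hs
      have hne : f (a - s) ≠ 0 := fun h => hs.2.2 ⟨hs.1, h⟩
      refine (lintegral_congr fun x => ?_).trans lintegral_zero
      refine indicator_apply_eq_zero.2 fun hx => ?_
      have hx' : x * f (a - s) = 0 := hx
      have hx0 : x = 0 := (mul_eq_zero.1 hx').resolve_right hne
      simp [shiftPath, hx0]

/-- The Lévy measure of `t ↦ ∫_0^t f(t - s) 1_D(s) dZ_s`. -/
theorem isProcessLevyMeasure_convOn (Z : Subordinator P)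
    (hρ : IsDriftlessLevyMeasure ρ (P.map (Z.val 1))) (hm : ∫⁻ x, x ∂ρ < ∞)
    (hf : Measurable f) (hfneg : ∀ u < 0, f u = 0)
    (hfint : ∀ t : ℝ≥0, 0 < t → primitiveAt f t < ∞) (hpos : ∃ b, 0 < primitiveAt f b)
    {D : Set ℝ} (hD : MeasurableSet D) :
    IsProcessLevyMeasure (shiftLevy f D ρ) (processLaw P (Z.convOn f D)) := by
  have := hρ.sFinite hm
  obtain ⟨J, hJ, hae⟩ := exists_countable_ae_shiftLevy_ne_zero hf hfneg hρ.ae_ne_zero hpos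
  exact (Z.hasLevyLaplace_convOn hρ hm hf hfneg hfint hD).isProcessLevyMeasure hJ (hae D)

theorem isProcessLevyMeasure_convOn_iff (Z : Subordinator P)
    (hρ : IsDriftlessLevyMeasure ρ (P.map (Z.val 1))) (hm : ∫⁻ x, x ∂ρ < ∞)
    (hf : Measurable f) (hfneg : ∀ u < 0, f u = 0)
    (hfint : ∀ t : ℝ≥0, 0 < t → primitiveAt f t < ∞) (hpos : ∃ b, 0 < primitiveAt f b)
    {D : Set ℝ} (hD : MeasurableSet D) (hD0 : D ⊆ Ici 0) (ν : Measure (ℝ≥0 → ℝ≥0)) :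
    IsProcessLevyMeasure ν (processLaw P (Z.convOn f D)) ↔
      ∀ F : (ℝ≥0 → ℝ≥0) → ℝ≥0∞, Measurable F →
        ∫⁻ y, F y ∂ν = ∫⁻ s in D, ∫⁻ x, F (shiftPath f x s) ∂ρ := by
  have := hρ.sFinite hm
  refine (Z.isProcessLevyMeasure_convOn hρ hm hf hfneg hfint hpos hD).iff_lintegral_eq
    (Φ := fun F => ∫⁻ s in D, ∫⁻ x, F (shiftPath f x s) ∂ρ) (fun F hF => ?_) ν
  rw [lintegral_shiftLevy hf D hF, inter_eq_right.2 hD0]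

theorem lintegral_shiftLevy_eq_lintegral_hasLaw (Z : Subordinator P)
    (hρ : IsDriftlessLevyMeasure ρ (P.map (Z.val 1))) (hκ0 : 0 < Z.mean) (hκ : Z.mean < ∞)
    (hf : Measurable f) {θ : ℝ} (hθ : 0 < θ)
    {Ω' : Type*} [MeasurableSpace Ω'] {P' : Measure Ω'} [IsProbabilityMeasure P']
    {Y : Ω' → ℝ} {V : Ω' → ℝ≥0} (hY : HasLaw Y (expMeasure θ) P')
    (hV : HasLaw V (sizeBiasedLaw Z.mean ρ) P') (hYV : IndepFun Y V P')
    {F : (ℝ≥0 → ℝ≥0) → ℝ≥0∞} (hF : Measurable F) :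
    ∫⁻ y, F y ∂(shiftLevy f univ ρ) = Z.mean / ENNReal.ofReal θ *
      ∫⁻ ω, (V ω : ℝ≥0∞)⁻¹ * ENNReal.ofReal (Real.exp (θ * Y ω)) *
        F (shiftPath f (V ω) (Y ω)) ∂P' := by
  have := hρ.sFinite (Z.lintegral_levy_lt_top hρ hκ)
  have := isProbabilityMeasure_sizeBiasedLaw (Z.mean_eq hρ hκ) hκ0 hκ
  rw [lintegral_shiftLevy_eq_expMeasure hf hρ.ae_ne_zero hκ0 hκ hθ hF]
  congr 1
  have hG : Measurable fun p : ℝ × ℝ≥0 => (p.2 : ℝ≥0∞)⁻¹ * ENNReal.ofReal (Real.exp (θ * p.1)) *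
      F (shiftPath f p.2 p.1) :=
    Measurable.mul (by fun_prop) (hF.comp (measurable_shiftPath hf))
  exact (hYV.lintegral_comp_prodMk hY hV hG).symm

end Subordinator

end

theorem mainTheorem6 {Ω : Type*} [MeasurableSpace Ω] (P : Measure Ω)
    [IsProbabilityMeasure P] (Z : Subordinator P) (ρ : Measure ℝ≥0)
    (hρ : IsDriftlessLevyMeasure ρ (P.map (Z.val 1)))
    (hκ0 : 0 < Z.mean) (hκ : Z.mean < ∞)
    (f : ℝ → ℝ≥0) (hf : Measurable f) (hfneg : ∀ u < 0, f u = 0)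
    (hfint : ∀ t : ℝ≥0, 0 < t → primitiveAt f t < ∞) :
    IsProbabilityMeasure (sizeBiasedLaw Z.mean ρ) ∧
    -- size-bias identity
    (∀ a : ℝ≥0, 0 < a → 0 < primitiveAt f a →
      IsProbabilityMeasure (timeLaw f a) ∧
      ∀ (U : Ω → ℝ) (V : Ω → ℝ≥0),
        HasLaw U (timeLaw f a) P → HasLaw V (sizeBiasedLaw Z.mean ρ) P →
        IndepFun U V P →
        IndepFun (fun ω => (U ω, V ω)) (fun ω t => Z.conv f t ω) P →
        processLaw P (fun t ω => Z.conv f t ω + V ω * f (t - U ω)) =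
          processLaw
            (P.withDensity fun ω => Z.conv f a ω / (Z.mean * primitiveAt f a)) (Z.conv f)) ∧
    -- representation of the Lévy measure
    ((∃ a, 0 < primitiveAt f a) → ∀ θ : ℝ, 0 < θ →
      ∫⁻ s in Ici 0, ENNReal.ofReal (Real.exp (-θ * s)) * f s < ∞ →
      ∀ {Ω' : Type*} [MeasurableSpace Ω'] (P' : Measure Ω') [IsProbabilityMeasure P']
        (Y : Ω' → ℝ) (V : Ω' → ℝ≥0),
        HasLaw Y (expMeasure θ) P' → HasLaw V (sizeBiasedLaw Z.mean ρ) P' →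
        IndepFun Y V P' →
        (∀ ν : Measure (ℝ≥0 → ℝ≥0), IsProcessLevyMeasure ν (processLaw P (Z.conv f)) ↔
          ∀ F : (ℝ≥0 → ℝ≥0) → ℝ≥0∞, Measurable F →
            ∫⁻ y, F y ∂ν = Z.mean / ENNReal.ofReal θ *
              ∫⁻ ω, (V ω : ℝ≥0∞)⁻¹ * ENNReal.ofReal (Real.exp (θ * Y ω)) *
                F (shiftPath f (V ω) (Y ω)) ∂P') ∧
        IsProcessLevyMeasure
          (processLaw
            (P'.withDensity fun ω => Z.mean / ENNReal.ofReal θ *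
              ((V ω : ℝ≥0∞)⁻¹ * ENNReal.ofReal (Real.exp (θ * Y ω))))
            (fun (t : ℝ≥0) ω => V ω * f (t - Y ω)))
          (processLaw P (Z.conv f))) ∧
    -- conditioning decomposition
    (∀ a : ℝ≥0,
      (∀ Q R : Measure (ℝ≥0 → ℝ≥0), IsProbabilityMeasure Q → IsProbabilityMeasure R →
        ((IsCondLawAtZero (processLaw P (Z.conv f)) a Q ∧
            processLaw P (Z.conv f) = Q.conv R) ↔
          (Q = processLaw P (Z.convOn f (zeroTimes f a)) ∧
            R = processLaw P (Z.convOn f (Ici 0 \ zeroTimes f a))))) ∧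
      IsProbabilityMeasure (processLaw P (Z.convOn f (zeroTimes f a))) ∧
      IsProbabilityMeasure (processLaw P (Z.convOn f (Ici 0 \ zeroTimes f a))) ∧
      IsInfDivLaw (processLaw P (Z.convOn f (zeroTimes f a))) ∧
      IsInfDivLaw (processLaw P (Z.convOn f (Ici 0 \ zeroTimes f a))) ∧
      ((∃ b, 0 < primitiveAt f b) →
        (∀ ν : Measure (ℝ≥0 → ℝ≥0),
          IsProcessLevyMeasure ν (processLaw P (Z.convOn f (zeroTimes f a))) ↔
          ∀ F : (ℝ≥0 → ℝ≥0) → ℝ≥0∞, Measurable F →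
            ∫⁻ y, F y ∂ν = ∫⁻ s in zeroTimes f a, ∫⁻ x, F (shiftPath f x s) ∂ρ) ∧
        (∀ ν : Measure (ℝ≥0 → ℝ≥0),
          IsProcessLevyMeasure ν
            (processLaw P (Z.convOn f (Ici 0 \ zeroTimes f a))) ↔
          ∀ F : (ℝ≥0 → ℝ≥0) → ℝ≥0∞, Measurable F →
            ∫⁻ y, F y ∂ν =
              ∫⁻ s in Ici 0 \ zeroTimes f a, ∫⁻ x, F (shiftPath f x s) ∂ρ))) := by
  have hm := Z.lintegral_levy_lt_top hρ hκ
  have hmean := Z.mean_eq hρ hκ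
  refine ⟨isProbabilityMeasure_sizeBiasedLaw hmean hκ0 hκ, fun a ha hI => ⟨?_, ?_⟩, ?_, fun a => ?_⟩
  · exact isProbabilityMeasure_timeLaw hf hI (hfint a ha)
  · intro U V hU hV hUV hUVψ
    exact Z.processLaw_add_eq_withDensity hρ hκ0 hκ hf hfneg hfint ha hI hU hV hUV hUVψ
  · intro hpos θ hθ _ Ω' _ P' _ Y V hY hV hYV
    have hlev : IsProcessLevyMeasure (shiftLevy f univ ρ) (processLaw P (Z.conv f)) :=
      Z.isProcessLevyMeasure_convOn hρ hm hf hfneg hfint hpos MeasurableSet.univ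
    have hiff := hlev.iff_lintegral_eq (Φ := fun F => Z.mean / ENNReal.ofReal θ *
      ∫⁻ ω, (V ω : ℝ≥0∞)⁻¹ * ENNReal.ofReal (Real.exp (θ * Y ω)) *
        F (shiftPath f (V ω) (Y ω)) ∂P')
      fun F hF => Z.lintegral_shiftLevy_eq_lintegral_hasLaw hρ hκ0 hκ hf hθ hY hV hYV hF
    refine ⟨hiff, (hiff _).2 fun F hF => ?_⟩
    have hYm := hY.aemeasurable
    have hVm := hV.aemeasurable
    have hdens : AEMeasurable (fun ω => Z.mean / ENNReal.ofReal θ *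
        ((V ω : ℝ≥0∞)⁻¹ * ENNReal.ofReal (Real.exp (θ * Y ω)))) P' := by fun_prop
    have hpath : AEMeasurable (fun ω (t : ℝ≥0) => V ω * f (t - Y ω)) P' :=
      (measurable_shiftPath hf).comp_aemeasurable (hYm.prodMk hVm)
    have hcomp : AEMeasurable (fun ω => F fun t : ℝ≥0 => V ω * f (t - Y ω)) P' :=
      hF.comp_aemeasurable hpath
    -- The path map is only almost everywhere measurable for `P'`; this passes to the weighted
    -- measure by absolute continuity.
    rw [processLaw, lintegral_map' hF.aemeasurable
      (hpath.mono_ac (withDensity_absolutelyContinuous _ _)),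
      lintegral_withDensity_eq_lintegral_mul₀ hdens hcomp, ← lintegral_const_mul'' _ ?_]
    · refine lintegral_congr fun ω => ?_
      simp only [Pi.mul_apply, mul_assoc]
      rfl
    · exact AEMeasurable.mul (by fun_prop) hcomp
  · have hD := measurableSet_zeroTimes hf a
    have hD' : MeasurableSet (Ici (0 : ℝ) \ zeroTimes f a) := measurableSet_Ici.diff hD
    have hQ := Z.isProbabilityMeasure_processLaw_convOn hf hfneg hD
    have hR := Z.isProbabilityMeasure_processLaw_convOn hf hfneg hD'
    have hdec := Z.processLaw_conv_eq_conv hρ hm hf hfneg hfint hD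
    have hcond := Z.isCondLawAtZero_convOn_zeroTimes hρ hm hf hfneg hfint a
    refine ⟨fun Q R _ _ => ⟨?_, ?_⟩, hQ, hR, Z.isInfDivLaw_convOn hρ hm hf hfneg hfint hD,
      Z.isInfDivLaw_convOn hρ hm hf hfneg hfint hD', fun hpos => ⟨?_, ?_⟩⟩
    · rintro ⟨h1, h2⟩
      -- The conditional limit determines `Q`; then `R` follows by cancelling the Laplace functional
      -- of `Q`, an exponential and so never zero.
      obtain rfl := h1.unique hcond
      refine ⟨rfl, ?_⟩
      exact (Z.hasLevyLaplace_convOn hρ hm hf hfneg hfint hD).conv_right_cancel (h2.symm.trans hdec)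
    · rintro ⟨rfl, rfl⟩
      exact ⟨hcond, hdec⟩
    · exact Z.isProcessLevyMeasure_convOn_iff hρ hm hf hfneg hfint hpos hD (zeroTimes_subset f a)
    · exact Z.isProcessLevyMeasure_convOn_iff hρ hm hf hfneg hfint hpos hD' sdiff_subset
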